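/- Throughout, functions are complex-valued on $\mathbb R^3$, $\langle x\rangle=(1+|x|^2)^{1/2}$ and $\langle D\rangle=(1-\Delta)^{1/2}$. For $\ell,s\in\mathbb R$ let $H^{\ell,s}$ be the space of tempered distributions $f$ with $\langle x\rangle^s\langle D\rangle^\ell f\in L^2(\mathbb R^3)$, normed by $\|f\|_{H^{\ell,s}}=\|\langle x\rangle^s\langle D\rangle^\ell f\|_{L^2}$, and let $L^{2,s}=H^{0,s}$. Spaces $\mathbf B(X,Y)$ of bounded linear operators carry the operator norm, and $\mathbf B(X)=\mathbf B(X,X)$. Let $-\Delta$ and $\sqrt{-\Delta}$ be the selfadjoint operators in $L^2(\mathbb R^3)$ with domains $H^2(\mathbb R^3)$ and $H^1(\mathbb R^3)$, with resolvents $\Gamma_0(z)=(-\Delta-z)^{-1}$ and $R_0(z)=(\sqrt{-\Delta}-z)^{-1}$. Put $\mathbb C^\pm=\{z\in\mathbb C:\pm\operatorname{Im}z>0\}$. **Theorem.** Let $s>1/2$. For every $\lambda>0$ the limits $$R_0^\pm(\lambda)=\lim_{\mu\downarrow0}R_0(\lambda\pm i\mu)\ \text{ in }\mathbf B(L^{2,s},H^{1,-s}),\qquad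 \Gamma_0^\pm(\lambda)=\lim_{\mu\downarrow0}\Gamma_0(\lambda\pm i\mu)\ \text{ in }\mathbf B(L^{2,s},H^{2,-s})$$ exist. Let $R_0^\pm$ and $\Gamma_0^\pm$ be the extended resolvents on $\mathbb C^\pm\cup(0,\infty)$ which are equal to $R_0(z)$ and $\Gamma_0(z)$ (restricted to $L^{2,s}$) for $z\in\mathbb C^\pm$ and to these limits on $(0,\infty)$. Then $R_0^\pm$ is a $\mathbf B(L^{2,s},H^{1,-s})$-valued continuous function on $\mathbb C^\pm\cup(0,\infty)$ (the limiting absorption principle for $\sqrt{-\Delta}$). Moreover, let $b>a>0$ and put $$D_{ab}=\{\lambda+i\mu: a\le\lambda\le b,\ |\mu|\le a/2\},\qquad D_{ab}^\pm=\{z\in D_{ab}:\pm\operatorname{Im}z\ge0\}.$$ Then there exist operator-valued functions $A(z)$ and $B(z)$ such that 1. $A$ is a $\mathbf B(L^{2,s})$-valued continuous function on $\mathbb C$; 2. $B$ is a $\mathbf B(L^{2,s},H^{1,-s})$-valued continuous function on $D_{ab}$; 3. $R_0^{\pm}(z)=\Gamma_0^{\pm}(z^2)A(z)+B(z)$ for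 all $z\in D_{ab}^{\pm}$ (both signs, with the same $A$ and $B$). -/

import Mathlib

open MeasureTheory Filter Topology TemperedDistribution
open scoped SchwartzMap FourierTransform Laplacian

namespace SqrtLaplacian

noncomputable section

/-- Euclidean space `ℝ³`. -/
abbrev E3 : Type := EuclideanSpace ℝ (Fin 3)

/-- The Hilbert space `L²(ℝ³)` of complex-valued square-integrable functions. -/
abbrev L2 : Type := Lp ℂ 2 (volume : Measure E3)

/-- The canonical embedding `L²(ℝ³) → 𝓢'(ℝ³)`, as a linear map. -/
def toDist : L2 →ₗ[ℂ] 𝓢'(E3, ℂ) :=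
  (Lp.toTemperedDistributionCLM ℂ (volume : Measure E3) 2 : L2 →L[ℂ] 𝓢'(E3, ℂ))

theorem toDist_injective : Function.Injective toDist :=
  LinearMap.ker_eq_bot.mp
    (Lp.ker_toTemperedDistributionCLM_eq_bot (F := ℂ) (μ := (volume : Measure E3)) (p := 2))

theorem toDist_apply (g : L2) (φ : 𝓢(E3, ℂ)) : toDist g φ = ∫ x, φ x * g x :=
  Lp.toTemperedDistribution_apply g φ

/-! ### Weighted Sobolev spaces -/

/-- Multiplication by `⟨x⟩ˢ = (1 + |x|²)^(s/2)` on tempered distributions. -/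
def weight (s : ℝ) : 𝓢'(E3, ℂ) →L[ℂ] 𝓢'(E3, ℂ) :=
  smulLeftCLM ℂ (fun x : E3 => (((1 + ‖x‖ ^ 2) ^ (s / 2) : ℝ) : ℂ))

/-- The symbol of `⟨D⟩^ℓ`, `D = -i∂`. Mathlib's Fourier transform has the phase
`exp (-2πi x·ξ)`, so that `|D|²` has the symbol `(2π)²|ξ|²`. -/
def bracketSymbol (l : ℝ) (ξ : E3) : ℂ := (((1 + ‖(2 * Real.pi) • ξ‖ ^ 2) ^ (l / 2) : ℝ) : ℂ)

/-- The operator `⟨D⟩^ℓ = (1 - Δ)^(ℓ/2)` on tempered distributions. -/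
def bracketD (l : ℝ) : 𝓢'(E3, ℂ) →L[ℂ] 𝓢'(E3, ℂ) :=
  fourierMultiplierCLM ℂ (bracketSymbol l)

theorem bracketSymbol_temperate (l : ℝ) : (bracketSymbol l).HasTemperateGrowth := by
  have h : (fun ξ : E3 => (2 * Real.pi) • ξ).HasTemperateGrowth := by fun_prop
  have h2 := (Function.hasTemperateGrowth_one_add_norm_sq_rpow E3 (l / 2)).comp h
  exact (Function.HasTemperateGrowth.comp (g := fun r : ℝ => (r : ℂ)) (by fun_prop) h2 :)

theorem bracketSymbol_neg_mul (l : ℝ) : bracketSymbol l * bracketSymbol (-l) = fun _ => 1 := by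
  funext ξ
  change (((1 + ‖(2 * Real.pi) • ξ‖ ^ 2) ^ (l / 2) : ℝ) : ℂ) *
    (((1 + ‖(2 * Real.pi) • ξ‖ ^ 2) ^ (-l / 2) : ℝ) : ℂ) = 1
  rw [← Complex.ofReal_mul]
  rw [← Real.rpow_add (by positivity), show l / 2 + -l / 2 = 0 by ring]
  simp

theorem weight_neg_weight (s : ℝ) (f : 𝓢'(E3, ℂ)) : weight (-s) (weight s f) = f := by
  unfold weight
  rw [smulLeftCLM_smulLeftCLM_apply (by fun_prop) (by fun_prop)]
  have : ((fun x : E3 => (((1 + ‖x‖ ^ 2) ^ (s / 2) : ℝ) : ℂ)) *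
      fun x : E3 => (((1 + ‖x‖ ^ 2) ^ (-s / 2) : ℝ) : ℂ)) = fun _ => 1 := by
    ext x
    simp only [Pi.mul_apply]
    norm_cast
    rw [← Real.rpow_add (by positivity), show s / 2 + -s / 2 = 0 by ring]
    simp
  rw [this]
  simp

theorem bracketD_neg_bracketD (l : ℝ) (f : 𝓢'(E3, ℂ)) : bracketD (-l) (bracketD l f) = f := by
  unfold bracketD
  rw [fourierMultiplierCLM_fourierMultiplierCLM_apply (bracketSymbol_temperate _)
    (bracketSymbol_temperate _), bracketSymbol_neg_mul]
  simp

theorem bracketD_zero (f : 𝓢'(E3, ℂ)) : bracketD 0 f = f := by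
  have : bracketSymbol 0 = fun _ => 1 := by ext; simp [bracketSymbol]
  simp [bracketD, this]

/-- The linear map `f ↦ ⟨x⟩ˢ ⟨D⟩^ℓ f` on tempered distributions. -/
def weightBracket (l s : ℝ) : 𝓢'(E3, ℂ) →ₗ[ℂ] 𝓢'(E3, ℂ) :=
  (weight s ∘L bracketD l : 𝓢'(E3, ℂ) →L[ℂ] 𝓢'(E3, ℂ))

theorem weightBracket_injective (l s : ℝ) : Function.Injective (weightBracket l s) := by
  intro f g h
  have h1 : weight s (bracketD l f) = weight s (bracketD l g) := h
  rw [← bracketD_neg_bracketD l f, ← weight_neg_weight s (bracketD l f), h1, weight_neg_weight,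
    bracketD_neg_bracketD]

/-- `H^{ℓ,s}` as a set of tempered distributions: those `f` with `⟨x⟩ˢ ⟨D⟩^ℓ f ∈ L²(ℝ³)`. -/
def sobolevSubmodule (l s : ℝ) : Submodule ℂ 𝓢'(E3, ℂ) :=
  (LinearMap.range toDist).comap (weightBracket l s)

/-- The weighted Sobolev space `H^{ℓ,s}(ℝ³)`. This is a copy of `sobolevSubmodule l s` which does
not inherit the topology of `𝓢'`; it carries the norm `‖⟨x⟩ˢ ⟨D⟩^ℓ f‖_{L²}` instead. -/
def WSobolev (l s : ℝ) : Type := sobolevSubmodule l s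

instance (l s : ℝ) : AddCommGroup (WSobolev l s) :=
  inferInstanceAs (AddCommGroup (sobolevSubmodule l s))

instance (l s : ℝ) : Module ℂ (WSobolev l s) :=
  inferInstanceAs (Module ℂ (sobolevSubmodule l s))

/-- The tempered distribution underlying an element of `H^{ℓ,s}`. -/
def WSobolev.dist {l s : ℝ} : WSobolev l s →ₗ[ℂ] 𝓢'(E3, ℂ) := (sobolevSubmodule l s).subtype

/-- The map `H^{ℓ,s} → L²`, `f ↦ ⟨x⟩ˢ ⟨D⟩^ℓ f`. -/
def WSobolev.toL2 {l s : ℝ} : WSobolev l s →ₗ[ℂ] L2 :=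
  (LinearEquiv.ofInjective toDist toDist_injective).symm.toLinearMap ∘ₗ
    ((weightBracket l s).restrict (p := sobolevSubmodule l s) (q := LinearMap.range toDist)
      fun _ h => h)

theorem WSobolev.toDist_toL2 {l s : ℝ} (f : WSobolev l s) :
    toDist f.toL2 = weight s (bracketD l f.dist) :=
  congrArg Subtype.val ((LinearEquiv.ofInjective toDist toDist_injective).apply_symm_apply
    ⟨weightBracket l s f.dist, f.2⟩)

theorem WSobolev.toL2_injective {l s : ℝ} :
    Function.Injective (WSobolev.toL2 : WSobolev l s →ₗ[ℂ] L2) := by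
  intro f g h
  refine Subtype.ext (weightBracket_injective l s ?_)
  have := congrArg toDist h
  rw [toDist_toL2, toDist_toL2] at this
  exact this

/-- The norm of `H^{ℓ,s}` is `‖f‖ = ‖⟨x⟩ˢ ⟨D⟩^ℓ f‖_{L²}`. -/
instance (l s : ℝ) : NormedAddCommGroup (WSobolev l s) :=
  NormedAddCommGroup.induced _ _ (WSobolev.toL2 : WSobolev l s →ₗ[ℂ] L2) WSobolev.toL2_injective

instance (l s : ℝ) : NormedSpace ℂ (WSobolev l s) :=
  NormedSpace.induced ℂ _ _ (WSobolev.toL2 : WSobolev l s →ₗ[ℂ] L2)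

theorem WSobolev.norm_eq {l s : ℝ} (f : WSobolev l s) : ‖f‖ = ‖f.toL2‖ := rfl

/-- The weighted space `L^{2,s}(ℝ³) = {f | ⟨x⟩ˢ f ∈ L²(ℝ³)}`, i.e. `H^{0,s}(ℝ³)`, with the norm
`‖⟨x⟩ˢ f‖_{L²}`. -/
abbrev WL2 (s : ℝ) : Type := WSobolev 0 s

theorem WL2.toDist_toL2 {s : ℝ} (f : WL2 s) : toDist f.toL2 = weight s f.dist := by
  rw [WSobolev.toDist_toL2, bracketD_zero]

/-! ### The operators `-Δ` and `√(-Δ)` in `L²(ℝ³)` -/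

/-- The selfadjoint operator `-Δ` in `L²(ℝ³)`: the distributional Laplacian on the domain
`H²(ℝ³) = {u ∈ L² | Δu ∈ L²}`. -/
def negLaplacian : L2 →ₗ.[ℂ] L2 where
  domain := (LinearMap.range toDist).comap
    ((-(LineDeriv.laplacianCLM ℂ E3 𝓢'(E3, ℂ)).toLinearMap) ∘ₗ toDist)
  toFun := (LinearEquiv.ofInjective toDist toDist_injective).symm.toLinearMap ∘ₗ
    (((-(LineDeriv.laplacianCLM ℂ E3 𝓢'(E3, ℂ)).toLinearMap) ∘ₗ toDist).restrict
      (p := (LinearMap.range toDist).comap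
        ((-(LineDeriv.laplacianCLM ℂ E3 𝓢'(E3, ℂ)).toLinearMap) ∘ₗ toDist))
      (q := LinearMap.range toDist) fun _ h => h)

theorem toDist_negLaplacian (u : negLaplacian.domain) :
    toDist (negLaplacian u) = -Δ (toDist (u : L2)) := by
  rw [← laplacianCLM_apply]
  exact congrArg Subtype.val
    ((LinearEquiv.ofInjective toDist toDist_injective).apply_symm_apply ⟨_, u.2⟩)

/-- The symbol `2π|ξ|` of `√(-Δ)` (for the phase `exp (-2πi x·ξ)`). -/
def absSymbol (ξ : E3) : ℂ := ((‖(2 * Real.pi) • ξ‖ : ℝ) : ℂ)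

theorem absSymbol_add (u v : L2) :
    (fun ξ => absSymbol ξ * (𝓕 (u + v) : L2) ξ) =ᵐ[volume]
      (fun ξ => absSymbol ξ * (𝓕 u : L2) ξ) + fun ξ => absSymbol ξ * (𝓕 v : L2) ξ := by
  rw [FourierTransform.fourier_add]
  filter_upwards [Lp.coeFn_add (𝓕 u : L2) (𝓕 v)] with ξ h
  rw [h, Pi.add_apply, Pi.add_apply, mul_add]

theorem absSymbol_smul (c : ℂ) (u : L2) :
    (fun ξ => absSymbol ξ * (𝓕 (c • u) : L2) ξ) =ᵐ[volume]
      c • fun ξ => absSymbol ξ * (𝓕 u : L2) ξ := by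
  rw [FourierTransform.fourier_smul]
  filter_upwards [Lp.coeFn_smul c (𝓕 u : L2)] with ξ h
  rw [h, Pi.smul_apply, Pi.smul_apply, smul_eq_mul, smul_eq_mul, mul_left_comm]

/-- The selfadjoint operator `H₀ = √(-Δ)` in `L²(ℝ³)`: conjugate by the Fourier transform of the
maximal operator of multiplication by the symbol of `|D|`; its domain is `H¹(ℝ³)`. -/
def sqrtNegLaplacian : L2 →ₗ.[ℂ] L2 where
  domain :=
    { carrier := {u | MemLp (fun ξ => absSymbol ξ * (𝓕 u : L2) ξ) 2 volume}
      add_mem' := fun {u v} hu hv => (memLp_congr_ae (absSymbol_add u v)).2 (hu.add hv)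
      zero_mem' := by
        have := absSymbol_smul 0 0
        rw [zero_smul, zero_smul] at this
        exact (memLp_congr_ae this).2 MemLp.zero'
      smul_mem' := fun c u hu => (memLp_congr_ae (absSymbol_smul c u)).2 (hu.const_smul c) }
  toFun :=
    { toFun := fun u => 𝓕⁻ (u.2.toLp : L2)
      map_add' := fun u v => by
        rw [← FourierTransform.fourierInv_add, ← MemLp.toLp_add]
        exact congrArg _ (MemLp.toLp_congr _ _ (absSymbol_add u v))
      map_smul' := fun c u => by
        rw [RingHom.id_apply, ← FourierTransform.fourierInv_smul, ← MemLp.toLp_const_smul]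
        exact congrArg _ (MemLp.toLp_congr _ _ (absSymbol_smul c u)) }

/-! ### Resolvents and extended resolvents -/

/-- `R = (T - z)⁻¹`: the point `z` is in the resolvent set of the operator `T` in `L²(ℝ³)`, and
the bounded operator `R` is the two-sided inverse of `T - z : D(T) → L²(ℝ³)`. -/
def IsResolventAt (T : L2 →ₗ.[ℂ] L2) (z : ℂ) (R : L2 →L[ℂ] L2) : Prop :=
  (∀ f : L2, ∃ h : R f ∈ T.domain, T ⟨R f, h⟩ - z • R f = f) ∧
    ∀ u : T.domain, R (T u - z • (u : L2)) = u

/-- `G` is the extended resolvent of `T` from the upper (`σ = 1`) or lower (`σ = -1`) half-plane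
`{z | σ Im z > 0}`, with values in `B(L^{2,s}, H^{ℓ,-s})`:
* for `σ Im z > 0`, `G z` is `(T - z)⁻¹` restricted to `L^{2,s} ⊂ L²`;
* for `t > 0`, `G t` is the limit in operator norm of `G (t + iσμ)` as `μ ↓ 0`.

These two properties determine `G` on `{z | σ Im z > 0} ∪ (0, ∞)`. -/
structure IsExtendedResolvent (T : L2 →ₗ.[ℂ] L2) (σ : ℝ) {l s : ℝ}
    (G : ℂ → (WL2 s →L[ℂ] WSobolev l (-s))) : Prop where
  resolvent : ∀ z : ℂ, 0 < σ * z.im → ∃ R : L2 →L[ℂ] L2, IsResolventAt T z R ∧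
    ∀ f : WL2 s, ∃ g : L2, f.dist = toDist g ∧ (G z f).dist = toDist (R g)
  limit : ∀ t : ℝ, 0 < t →
    Tendsto (fun μ : ℝ => G ((t : ℂ) + (σ * μ : ℝ) * Complex.I)) (𝓝[>] 0) (𝓝 (G t))

/-- The domain `{z | σ Im z > 0} ∪ (0, ∞)` of the extended resolvents, `σ = ±1`. -/
def extendedHalfPlane (σ : ℝ) : Set ℂ := {z | 0 < σ * z.im ∨ (z.im = 0 ∧ 0 < z.re)}

/-- The box `D_{ab} = {λ + iμ | a ≤ λ ≤ b, |μ| ≤ a/2}`. -/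
def box (a b : ℝ) : Set ℂ := {z | a ≤ z.re ∧ z.re ≤ b ∧ |z.im| ≤ a / 2}

/-- The closed half boxes `D_{ab}^± = {z ∈ D_{ab} | ± Im z ≥ 0}`, with `σ = ±1`. -/
def halfBox (σ a b : ℝ) : Set ℂ := {z | z ∈ box a b ∧ 0 ≤ σ * z.im}

end

end SqrtLaplacian

namespace SqrtLaplacian

noncomputable section

/-! ### Bounded multiplication operators and Fourier multipliers on `L²` -/

/-! Through the isometries `WSobolev.equivL2`, both limits become norm limits on `L²` of
⟨x⟩⁻ˢ⟨D⟩^ℓ(p(D) - z)⁻¹⟨x⟩⁻ˢ (`weightedResolvent`), where p is |2πξ|² for -Δ and |2πξ| for √(-Δ).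

For -Δ, the three numbers `perp j ξ` add up to 2|2πξ|². Hence near the sphere |2πξ|² = t at least
one of them is well below t, and a smooth partition of the frequencies reduces the matter to slabs
`perp j ≤ ρ` with ρ < t. On such a slab the resolvent is one-dimensional in the direction j, at the
energy κ² = z - `perp j`, whose real part is bounded below. So it is a superposition over r of
translations by r along the j-th axis, with the kernel i exp(iκ|r|)/(2κ), composed with functions of
`perp j`, which do not move x_j. The kernel stays bounded up to the real axis and is Hölder in z, at
the cost of a factor (1 + |r|)^ε (`exists_lineKernel_holder`). Between the cells x_j ∈ [n, n+1] and
x_j ∈ [m, m+1] only the values of r within 3/2 of m - n contribute (`inner_fm_eq_zero`). This gives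
the bound C|z - z'|^ε (1 + |m|)^ε (1 + |n|)^ε for the matrix elements of differences
(`exists_cell_bound`). Once the weights ⟨x⟩⁻ˢ are inserted, these bounds can be summed by
Cauchy–Schwarz as soon as s - ε > 1/2 (`exists_slab_holder`), so the weighted resolvents are Cauchy
at the real axis. Multipliers with Schwartz symbols are bounded on L^{2,s} (`exists_weighted_fm`),
which lets smooth frequency cutoffs pass through the weights.

For √(-Δ), take a smooth cutoff χ to an annulus around [a, b] and write 1/(|2πξ| - z) = χ(|2πξ| +
z)/(|2πξ|² - z²) + (1 - χ)/(|2πξ| - z). The first term is the resolvent of -Δ at z² after A(z) =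
χ(D)(|D| + z), which is affine in z and bounded on L^{2,s}. The second is B(z), whose denominator
does not vanish for z in the box, real or not (`remainder_num_bound`). The formula is an identity of
symbols off the real axis, and real points follow by passing to the limit (`exists_representation`).
-/

/-- Bounded Borel functions on `ℝ³`. -/
def BddMeas (a : E3 → ℂ) : Prop := Measurable a ∧ ∃ C : ℝ, ∀ x, ‖a x‖ ≤ C

theorem BddMeas.memLp_mul {a : E3 → ℂ} (h : BddMeas a) (f : L2) :
    MemLp (fun x => a x * f x) 2 volume := by
  obtain ⟨hm, C, hC⟩ := h
  refine MemLp.of_le_mul (c := C) (Lp.memLp f) (hm.aestronglyMeasurable.mul (Lp.aestronglyMeasurable f)) ?_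
  filter_upwards with x
  rw [norm_mul]
  exact mul_le_mul_of_nonneg_right (hC x) (norm_nonneg _)

theorem BddMeas.norm_toLp_mul_le {a : E3 → ℂ} (h : BddMeas a) {C : ℝ} (hC : ∀ x, ‖a x‖ ≤ C)
    (f : L2) : ‖(h.memLp_mul f).toLp‖ ≤ C * ‖f‖ := by
  refine Lp.norm_le_mul_norm_of_ae_le_mul ?_
  filter_upwards [(h.memLp_mul f).coeFn_toLp] with x hx
  rw [hx, norm_mul]
  exact mul_le_mul_of_nonneg_right (hC x) (norm_nonneg _)

open Classical in
/-- Multiplication by a bounded Borel function, as an operator on `L²` (zero for other functions). -/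
def mulL (a : E3 → ℂ) : L2 →L[ℂ] L2 :=
  if h : BddMeas a then
    LinearMap.mkContinuous
      { toFun := fun f => (h.memLp_mul f).toLp
        map_add' := fun f g => by
          rw [← MemLp.toLp_add]
          refine MemLp.toLp_congr _ _ ?_
          filter_upwards [Lp.coeFn_add f g] with x hx
          change a x * (f + g : L2) x = a x * f x + a x * g x
          rw [hx, Pi.add_apply, mul_add]
        map_smul' := fun c f => by
          rw [RingHom.id_apply, ← MemLp.toLp_const_smul]
          refine MemLp.toLp_congr _ _ ?_
          filter_upwards [Lp.coeFn_smul c f] with x hx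
          change a x * (c • f : L2) x = c * (a x * f x)
          rw [hx, Pi.smul_apply, smul_eq_mul, mul_left_comm] }
      h.2.choose fun f => h.norm_toLp_mul_le h.2.choose_spec f
  else 0

theorem mulL_coeFn {a : E3 → ℂ} (h : BddMeas a) (f : L2) :
    mulL a f =ᵐ[volume] fun x => a x * f x := by
  have : mulL a f = (h.memLp_mul f).toLp := by rw [mulL, dif_pos h]; rfl
  rw [this]
  exact MemLp.coeFn_toLp _

theorem norm_mulL_le {a : E3 → ℂ} (h : Measurable a) {C : ℝ} (hC : ∀ x, ‖a x‖ ≤ C) :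
    ‖mulL a‖ ≤ C := by
  have hC0 : 0 ≤ C := (norm_nonneg _).trans (hC 0)
  have hb : BddMeas a := ⟨h, C, hC⟩
  refine ContinuousLinearMap.opNorm_le_bound _ hC0 fun f => ?_
  have : mulL a f = (hb.memLp_mul f).toLp := by rw [mulL, dif_pos hb]; rfl
  rw [this]
  exact hb.norm_toLp_mul_le hC f

theorem BddMeas.mul {a b : E3 → ℂ} (ha : BddMeas a) (hb : BddMeas b) : BddMeas (a * b) := by
  obtain ⟨ha, A, hA⟩ := ha
  obtain ⟨hb, B, hB⟩ := hb
  refine ⟨ha.mul hb, A * B, fun x => ?_⟩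
  rw [Pi.mul_apply, norm_mul]
  exact mul_le_mul (hA x) (hB x) (norm_nonneg _) ((norm_nonneg _).trans (hA x))

theorem BddMeas.add {a b : E3 → ℂ} (ha : BddMeas a) (hb : BddMeas b) : BddMeas (a + b) := by
  obtain ⟨ha, A, hA⟩ := ha
  obtain ⟨hb, B, hB⟩ := hb
  exact ⟨ha.add hb, A + B, fun x => (norm_add_le _ _).trans (add_le_add (hA x) (hB x))⟩

theorem BddMeas.sub {a b : E3 → ℂ} (ha : BddMeas a) (hb : BddMeas b) : BddMeas (a - b) := by
  obtain ⟨ha, A, hA⟩ := ha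
  obtain ⟨hb, B, hB⟩ := hb
  exact ⟨ha.sub hb, A + B, fun x => (norm_sub_le _ _).trans (add_le_add (hA x) (hB x))⟩

theorem BddMeas.smul {a : E3 → ℂ} (ha : BddMeas a) (c : ℂ) : BddMeas (c • a) := by
  obtain ⟨ha, A, hA⟩ := ha
  refine ⟨ha.const_smul c, ‖c‖ * A, fun x => ?_⟩
  rw [Pi.smul_apply, norm_smul]
  exact mul_le_mul_of_nonneg_left (hA x) (norm_nonneg _)

theorem BddMeas.conj {a : E3 → ℂ} (ha : BddMeas a) : BddMeas (fun x => (starRingEnd ℂ) (a x)) := by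
  obtain ⟨ha, A, hA⟩ := ha
  exact ⟨Complex.continuous_conj.measurable.comp ha, A, fun x => by simpa using hA x⟩

theorem BddMeas.const (c : ℂ) : BddMeas (fun _ => c) := ⟨measurable_const, ‖c‖, fun _ => le_rfl⟩

theorem mulL_mulL {a b : E3 → ℂ} (ha : BddMeas a) (hb : BddMeas b) (f : L2) :
    mulL a (mulL b f) = mulL (a * b) f := by
  refine Lp.ext ?_
  filter_upwards [mulL_coeFn ha (mulL b f), mulL_coeFn hb f, mulL_coeFn (ha.mul hb) f]
    with x h1 h2 h3
  rw [h1, h2, h3, Pi.mul_apply, mul_assoc]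

theorem mulL_add {a b : E3 → ℂ} (ha : BddMeas a) (hb : BddMeas b) :
    mulL (a + b) = mulL a + mulL b := by
  ext1 f
  refine Lp.ext ?_
  rw [add_apply]
  filter_upwards [mulL_coeFn ha f, mulL_coeFn hb f, mulL_coeFn (ha.add hb) f,
    Lp.coeFn_add (mulL a f) (mulL b f)] with x h1 h2 h3 h4
  rw [h4, Pi.add_apply, h1, h2, h3, Pi.add_apply, add_mul]

theorem mulL_sub {a b : E3 → ℂ} (ha : BddMeas a) (hb : BddMeas b) :
    mulL (a - b) = mulL a - mulL b := by
  ext1 f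
  refine Lp.ext ?_
  rw [sub_apply]
  filter_upwards [mulL_coeFn ha f, mulL_coeFn hb f, mulL_coeFn (ha.sub hb) f,
    Lp.coeFn_sub (mulL a f) (mulL b f)] with x h1 h2 h3 h4
  rw [h4, Pi.sub_apply, h1, h2, h3, Pi.sub_apply, sub_mul]

theorem mulL_smul {a : E3 → ℂ} (ha : BddMeas a) (c : ℂ) :
    mulL (c • a) = c • mulL a := by
  ext1 f
  refine Lp.ext ?_
  rw [smul_apply]
  filter_upwards [mulL_coeFn ha f, mulL_coeFn (ha.smul c) f,
    Lp.coeFn_smul c (mulL a f)] with x h1 h2 h3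
  rw [h3, Pi.smul_apply, h1, h2, Pi.smul_apply, smul_eq_mul, smul_eq_mul, mul_assoc]

theorem mulL_one (f : L2) : mulL (fun _ => 1) f = f := by
  refine Lp.ext ?_
  filter_upwards [mulL_coeFn (.const 1) f] with x h
  rw [h, one_mul]

theorem L2_inner_eq (f g : L2) : inner ℂ f g = ∫ x, (starRingEnd ℂ) (f x) * g x := by
  rw [MeasureTheory.L2.inner_def]
  refine integral_congr_ae (Eventually.of_forall fun x => ?_)
  simp [mul_comm]

theorem inner_mulL_left {a : E3 → ℂ} (ha : BddMeas a) (f g : L2) :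
    inner ℂ (mulL a f) g = inner ℂ f (mulL (fun x => (starRingEnd ℂ) (a x)) g) := by
  rw [L2_inner_eq, L2_inner_eq]
  refine integral_congr_ae ?_
  filter_upwards [mulL_coeFn ha f, mulL_coeFn ha.conj g] with x h1 h2
  rw [h1, h2, map_mul]
  ring

theorem integrable_conj_mul (f g : L2) :
    Integrable (fun x => (starRingEnd ℂ) (f x) * g x) volume := by
  refine (MeasureTheory.L2.integrable_inner (𝕜 := ℂ) f g).congr (Eventually.of_forall fun x => ?_)
  simp [mul_comm]

theorem integral_norm_mul_le (f g : L2) : ∫ x, ‖f x‖ * ‖g x‖ ≤ ‖f‖ * ‖g‖ := by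
  have hf := (Lp.memLp f).norm
  have hg := (Lp.memLp g).norm
  have h := integral_mul_le_Lp_mul_Lq_of_nonneg (μ := (volume : Measure E3)) Real.HolderConjugate.two_two
    (f := fun x => ‖f x‖) (g := fun x => ‖g x‖) (Eventually.of_forall fun _ => norm_nonneg _)
    (Eventually.of_forall fun _ => norm_nonneg _) (by simpa using hf) (by simpa using hg)
  have key : ∀ u : L2, (∫ x, ‖u x‖ ^ (2 : ℝ)) ^ (1 / (2 : ℝ)) = ‖u‖ := fun u => by
    rw [Lp.norm_def, eLpNorm_eq_eLpNorm' (by norm_num) (by norm_num), eLpNorm'_eq_lintegral_enorm,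
      integral_eq_lintegral_of_nonneg_ae (Eventually.of_forall fun _ => by positivity)
        ((Lp.aestronglyMeasurable u).norm.aemeasurable.pow_const _).aestronglyMeasurable,
      ENNReal.toReal_rpow]
    congr 2
    norm_num
  rwa [key, key] at h

/-- The Fourier transform on `L²(ℝ³)`. -/
def fou : L2 ≃ₗᵢ[ℂ] L2 := Lp.fourierTransformₗᵢ E3 ℂ

theorem fou_apply (f : L2) : fou f = 𝓕 f := rfl

theorem fou_symm_apply (f : L2) : fou.symm f = 𝓕⁻ f := rfl

/-- The Fourier multiplier with a bounded Borel symbol, as an operator on `L²`. -/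
def fm (a : E3 → ℂ) : L2 →L[ℂ] L2 :=
  (fou.symm : L2 →L[ℂ] L2) ∘L mulL a ∘L (fou : L2 →L[ℂ] L2)

theorem fm_apply (a : E3 → ℂ) (f : L2) : fm a f = fou.symm (mulL a (fou f)) := rfl

theorem fou_fm (a : E3 → ℂ) (f : L2) : fou (fm a f) = mulL a (fou f) := by
  rw [fm_apply, LinearIsometryEquiv.apply_symm_apply]

theorem norm_fm_le {a : E3 → ℂ} (h : Measurable a) {C : ℝ} (hC : ∀ x, ‖a x‖ ≤ C) :
    ‖fm a‖ ≤ C := by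
  refine ContinuousLinearMap.opNorm_le_bound _ ((norm_nonneg _).trans (hC 0)) fun f => ?_
  rw [fm_apply, LinearIsometryEquiv.norm_map, ← fou.norm_map f]
  exact (mulL a).le_of_opNorm_le (norm_mulL_le h hC) _

theorem fm_fm {a b : E3 → ℂ} (ha : BddMeas a) (hb : BddMeas b) (f : L2) :
    fm a (fm b f) = fm (a * b) f := by
  rw [fm_apply, fou_fm, mulL_mulL ha hb, fm_apply]

theorem fm_add {a b : E3 → ℂ} (ha : BddMeas a) (hb : BddMeas b) :
    fm (a + b) = fm a + fm b := by
  ext1 f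
  simp [fm_apply, mulL_add ha hb]

theorem fm_sub {a b : E3 → ℂ} (ha : BddMeas a) (hb : BddMeas b) :
    fm (a - b) = fm a - fm b := by
  ext1 f
  simp [fm_apply, mulL_sub ha hb]

theorem fm_smul {a : E3 → ℂ} (ha : BddMeas a) (c : ℂ) : fm (c • a) = c • fm a := by
  ext1 f
  simp [fm_apply, mulL_smul ha c]

theorem fm_one (f : L2) : fm (fun _ => 1) f = f := by
  rw [fm_apply, mulL_one, LinearIsometryEquiv.symm_apply_apply]

theorem inner_fm (a : E3 → ℂ) (h f : L2) :
    inner ℂ h (fm a f) = inner ℂ (fou h) (mulL a (fou f)) := by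
  rw [← fou.inner_map_map, fou_fm]

theorem inner_fm_left {a : E3 → ℂ} (ha : BddMeas a) (f g : L2) :
    inner ℂ (fm a f) g = inner ℂ f (fm (fun x => (starRingEnd ℂ) (a x)) g) := by
  rw [inner_fm, ← fou.inner_map_map, fou_fm, inner_mulL_left ha]

theorem inner_fm_eq_integral {a : E3 → ℂ} (ha : BddMeas a) (h f : L2) :
    inner ℂ h (fm a f) = ∫ ξ, a ξ * ((starRingEnd ℂ) (fou h ξ) * fou f ξ) := by
  rw [inner_fm, L2_inner_eq]
  refine integral_congr_ae ?_
  filter_upwards [mulL_coeFn ha (fou f)] with x hx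
  rw [hx]
  ring

/-! ### Translations and modulations -/

theorem measurePreserving_sub_const (y : E3) :
    MeasurePreserving (fun x : E3 => x - y) volume volume :=
  measurePreserving_sub_right volume y

/-- Translation by `y` on `L²(ℝ³)`. -/
def transL (y : E3) : L2 →ₗᵢ[ℂ] L2 :=
  Lp.compMeasurePreservingₗᵢ ℂ (fun x : E3 => x - y) (measurePreserving_sub_const y)

theorem transL_coeFn (y : E3) (f : L2) : transL y f =ᵐ[volume] fun x => f (x - y) :=
  Lp.coeFn_compMeasurePreserving f (measurePreserving_sub_const y)

theorem ae_sub_const {P : E3 → Prop} (h : ∀ᵐ x, P x) (y : E3) : ∀ᵐ x : E3, P (x - y) :=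
  (measurePreserving_sub_const y).quasiMeasurePreserving.ae h

/-- The character `x ↦ exp (2πi y·x)`. -/
def ch (y x : E3) : ℂ := (Real.fourierChar (inner ℝ y x) : ℂ)

theorem continuous_ch (y : E3) : Continuous (ch y) := by
  unfold ch
  fun_prop

theorem norm_ch (y x : E3) : ‖ch y x‖ = 1 := Circle.norm_coe _

theorem bddMeas_ch (y : E3) : BddMeas (ch y) :=
  ⟨(continuous_ch y).measurable, 1, fun x => (norm_ch y x).le⟩

theorem ch_neg_left (y x : E3) : ch (-y) x = ch y (-x) := by
  simp [ch]

theorem fourier_comp_sub (φ : 𝓢(E3, ℂ)) (y ξ : E3) :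
    𝓕 (φ.compSubConstCLM ℂ y) ξ = ch (-y) ξ * 𝓕 φ ξ := by
  rw [SchwartzMap.fourier_coe, SchwartzMap.fourier_coe, Real.fourier_eq, Real.fourier_eq,
    ← integral_const_mul, ← integral_sub_right_eq_self
      (fun x : E3 => ch (-y) ξ * (Real.fourierChar (-inner ℝ x ξ) • φ x)) y]
  refine integral_congr_ae (Eventually.of_forall fun x => ?_)
  simp only [SchwartzMap.compSubConstCLM_apply, Circle.smul_def, smul_eq_mul, ch]
  rw [← mul_assoc, ← Circle.coe_mul, ← AddChar.map_add_eq_mul, inner_sub_left, inner_neg_left]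
  congr 4
  ring

theorem transL_toLp (y : E3) (φ : 𝓢(E3, ℂ)) :
    transL y (φ.toLp 2) = (φ.compSubConstCLM ℂ y).toLp 2 := by
  refine Lp.ext ?_
  filter_upwards [transL_coeFn y (φ.toLp 2), ae_sub_const (φ.coeFn_toLp 2 volume) y,
    (φ.compSubConstCLM ℂ y).coeFn_toLp 2] with x h1 h2 h3
  rw [h1, h2, h3, SchwartzMap.compSubConstCLM_apply]

theorem L2_eq_of_schwartz {A B : L2 → L2} (hA : Continuous A) (hB : Continuous B)
    (h : ∀ φ : 𝓢(E3, ℂ), A (φ.toLp 2) = B (φ.toLp 2)) (f : L2) : A f = B f := by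
  have hd : DenseRange (SchwartzMap.toLpCLM ℝ ℂ 2 (volume : Measure E3)) :=
    SchwartzMap.denseRange_toLpCLM (by norm_num)
  exact congrFun (hd.equalizer hA hB (funext fun φ => h φ)) f

theorem fou_transL (y : E3) (f : L2) : fou (transL y f) = mulL (ch (-y)) (fou f) := by
  refine L2_eq_of_schwartz (A := fun f => fou (transL y f)) (B := fun f => mulL (ch (-y)) (fou f))
    (by fun_prop) (by fun_prop) (fun φ => ?_) f
  simp only [fou_apply]
  rw [transL_toLp, SchwartzMap.toLp_fourier_eq, SchwartzMap.toLp_fourier_eq]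
  refine Lp.ext ?_
  filter_upwards [(𝓕 (φ.compSubConstCLM ℂ y)).coeFn_toLp 2, (𝓕 φ).coeFn_toLp 2,
    mulL_coeFn (bddMeas_ch (-y)) ((𝓕 φ).toLp 2)] with x h1 h2 h3
  rw [h1, h3, h2, fourier_comp_sub]

theorem fou_symm_transL (y : E3) (f : L2) :
    fou.symm (transL y f) = mulL (ch y) (fou.symm f) := by
  refine L2_eq_of_schwartz (A := fun f => fou.symm (transL y f))
    (B := fun f => mulL (ch y) (fou.symm f))
    (by fun_prop) (by fun_prop) (fun φ => ?_) f
  simp only [fou_symm_apply]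
  rw [transL_toLp, SchwartzMap.toLp_fourierInv_eq, SchwartzMap.toLp_fourierInv_eq]
  refine Lp.ext ?_
  filter_upwards [(𝓕⁻ (φ.compSubConstCLM ℂ y)).coeFn_toLp 2, (𝓕⁻ φ).coeFn_toLp 2,
    mulL_coeFn (bddMeas_ch y) ((𝓕⁻ φ).toLp 2)] with x h1 h2 h3
  have e : ∀ g : 𝓢(E3, ℂ), 𝓕⁻ g x = 𝓕 g (-x) := fun g => by
    rw [SchwartzMap.fourierInv_coe, Real.fourierInv_eq_fourier_neg, SchwartzMap.fourier_coe]
  rw [h1, h3, h2, e, e, fourier_comp_sub, ch_neg_left, neg_neg]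

theorem fou_modulation (y : E3) (f : L2) : fou (mulL (ch y) f) = transL y (fou f) := by
  rw [← fou.symm.injective.eq_iff, fou_symm_transL, LinearIsometryEquiv.symm_apply_apply,
    LinearIsometryEquiv.symm_apply_apply]

/-- A Fourier multiplier whose symbol is an eigenfunction of the translation by `y` commutes with
the modulation by `y`, up to the eigenvalue. -/
theorem fm_modulation {k : E3 → ℂ} (hk : BddMeas k) {y : E3} {c : ℂ}
    (h : ∀ ξ, k ξ = c * k (ξ - y)) (f : L2) :
    fm k (mulL (ch y) f) = c • mulL (ch y) (fm k f) := by
  apply fou.injective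
  rw [fou_fm, map_smul, fou_modulation, fou_modulation, fou_fm]
  refine Lp.ext ?_
  filter_upwards [mulL_coeFn hk (transL y (fou f)), transL_coeFn y (fou f),
    Lp.coeFn_smul c (transL y (mulL k (fou f))), transL_coeFn y (mulL k (fou f)),
    ae_sub_const (mulL_coeFn hk (fou f)) y] with ξ h1 h2 h3 h4 h5
  rw [h1, h2, h3, Pi.smul_apply, h4, h5, smul_eq_mul, h ξ, mul_assoc]

/-! ### Multipliers that do not depend on one coordinate preserve slabs -/

/-- The coordinate vectors of `ℝ³`. -/
def unitVec (j : Fin 3) : E3 := EuclideanSpace.single j 1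

theorem inner_unitVec (t : ℝ) (j : Fin 3) (x : E3) : inner ℝ (t • unitVec j) x = t * x j := by
  rw [inner_smul_left, unitVec, EuclideanSpace.inner_single_left]
  simp

theorem schwartz_eq_integral (p : 𝓢(ℝ, ℂ)) (y : ℝ) :
    p y = ∫ t, (Real.fourierChar (t * y) : ℂ) * 𝓕 p t := by
  have h := congrArg (fun q : 𝓢(ℝ, ℂ) => q y) (FourierTransform.fourierInv_fourier_eq (F := 𝓢(ℝ, ℂ)) p)
  simp only [SchwartzMap.fourierInv_coe] at h
  rw [← h, Real.fourierInv_eq]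
  refine integral_congr_ae (Eventually.of_forall fun t => ?_)
  simp [Circle.smul_def, mul_comm]

/-- Fourier inversion for p and Fubini: multiplication by a Schwartz function of x_j is a
superposition of modulations along the j-th axis. -/
theorem integral_fourier_mul_char (p : 𝓢(ℝ, ℂ)) (j : Fin 3) (r : ℝ) {u : E3 → ℂ}
    (hu : Integrable u) :
    ∫ t, 𝓕 p t * ((Real.fourierChar (-(t * r)) : ℂ) * ∫ x, ch (t • unitVec j) x * u x) =
      ∫ x, p (x j - r) * u x := by
  have hF : Integrable (fun q : ℝ × E3 => (𝓕 p q.1 * u q.2) *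
      (Real.fourierChar (q.1 * (q.2 j - r)) : ℂ)) (volume.prod volume) := by
    refine ((𝓕 p).integrable.mul_prod hu).mul_bdd (c := 1) ?_ ?_
    · exact Continuous.aestronglyMeasurable (by fun_prop)
    · exact Eventually.of_forall fun q => (Circle.norm_coe _).le
  have e : ∀ t (x : E3), 𝓕 p t * ((Real.fourierChar (-(t * r)) : ℂ) * (ch (t • unitVec j) x * u x)) =
      (𝓕 p t * u x) * (Real.fourierChar (t * (x j - r)) : ℂ) := fun t x => by
    rw [ch, inner_unitVec, mul_sub, sub_eq_add_neg, AddChar.map_add_eq_mul, Circle.coe_mul]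
    ring
  simp_rw [← integral_const_mul, e]
  rw [integral_integral_swap hF]
  refine integral_congr_ae (Eventually.of_forall fun x => ?_)
  simp only
  rw [schwartz_eq_integral, ← integral_mul_const]
  refine integral_congr_ae (Eventually.of_forall fun t => ?_)
  simp only
  ring

/-- Such a k(D) shifts the coordinate x_j by exactly r: it commutes with modulations along the j-th
axis up to a phase. Superposing modulations gives k(D) p(x_j) = p(x_j - r) k(D) in the weak sense.
Here p(x_j) fixes f and p(x_j - r) kills h, so the matrix element vanishes. -/
theorem inner_fm_eq_zero {k : E3 → ℂ} (hk : BddMeas k) (j : Fin 3) {r : ℝ}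
    (hkr : ∀ ξ (t : ℝ), k ξ = (Real.fourierChar (-(t * r)) : ℂ) * k (ξ - t • unitVec j))
    (p : 𝓢(ℝ, ℂ)) {f h : L2} (hf : ∀ᵐ x, f x ≠ 0 → p (x j) = 1)
    (hh : ∀ᵐ x, h x ≠ 0 → p (x j - r) = 0) : inner ℂ h (fm k f) = 0 := by
  set g : L2 := fm (fun ξ => (starRingEnd ℂ) (k ξ)) h with hg
  have adj : ∀ v : L2, inner ℂ h (fm k v) = inner ℂ g v := fun v => by
    rw [hg, inner_fm_left hk.conj]
    simp
  have int : ∀ (v w : L2) (t : ℝ), inner ℂ w (mulL (ch (t • unitVec j)) v) =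
      ∫ x, ch (t • unitVec j) x * ((starRingEnd ℂ) (w x) * v x) := fun v w t => by
    rw [L2_inner_eq]
    refine integral_congr_ae ?_
    filter_upwards [mulL_coeFn (bddMeas_ch (t • unitVec j)) v] with x hx
    rw [hx]
    ring
  have h1 := integral_fourier_mul_char p j 0 (integrable_conj_mul g f)
  have h2 := integral_fourier_mul_char p j r (integrable_conj_mul h (fm k f))
  simp_rw [← int] at h1 h2
  have e : ∀ t : ℝ, (Real.fourierChar (-(t * r)) : ℂ) *
      inner ℂ h (mulL (ch (t • unitVec j)) (fm k f)) =
        inner ℂ g (mulL (ch (t • unitVec j)) f) := fun t => by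
    rw [← inner_smul_right, ← fm_modulation hk (fun ξ => hkr ξ t), adj]
  simp_rw [e] at h2
  simp only [mul_zero, neg_zero, AddChar.map_zero_eq_one, Circle.coe_one, one_mul, sub_zero] at h1
  rw [h2] at h1
  rw [adj, L2_inner_eq]
  have h3 : ∫ x, p (x j) * ((starRingEnd ℂ) (g x) * f x) = ∫ x, (starRingEnd ℂ) (g x) * f x := by
    refine integral_congr_ae ?_
    filter_upwards [hf] with x hx
    by_cases h0 : f x = 0
    · simp [h0]
    · rw [hx h0, one_mul]
  rw [← h3, ← h1]
  refine integral_eq_zero_of_ae ?_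
  filter_upwards [hh] with x hx
  by_cases h0 : h x = 0
  · simp [h0]
  · simp [hx h0]

/-! ### Schwartz multipliers act on weighted `L²` spaces -/

/-- The weight `⟨x⟩ˢ`. -/
def japanese (s : ℝ) (x : E3) : ℂ := (((1 + ‖x‖ ^ 2) ^ (s / 2) : ℝ) : ℂ)

theorem continuous_japanese (s : ℝ) : Continuous (japanese s) := by
  refine Complex.continuous_ofReal.comp ?_
  exact Continuous.rpow_const (by fun_prop) fun x => Or.inl (by positivity)

theorem japanese_temperate (s : ℝ) : (japanese s).HasTemperateGrowth := by
  unfold japanese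
  fun_prop

theorem norm_japanese (s : ℝ) (x : E3) : ‖japanese s x‖ = (1 + ‖x‖ ^ 2) ^ (s / 2) := by
  rw [japanese, Complex.norm_real, Real.norm_of_nonneg (by positivity)]

theorem japanese_mul_neg (s : ℝ) (x : E3) : japanese s x * japanese (-s) x = 1 := by
  rw [japanese, japanese, ← Complex.ofReal_mul, ← Real.rpow_add (by positivity)]
  simp [show s / 2 + -s / 2 = 0 by ring]

theorem japanese_ne_zero (s : ℝ) (x : E3) : japanese s x ≠ 0 :=
  left_ne_zero_of_mul_eq_one (japanese_mul_neg s x)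

theorem norm_japanese_neg_le {s : ℝ} (hs : 0 ≤ s) (x : E3) : ‖japanese (-s) x‖ ≤ 1 := by
  rw [norm_japanese]
  exact Real.rpow_le_one_of_one_le_of_nonpos (by nlinarith [norm_nonneg x]) (by linarith)

theorem bddMeas_japanese_neg {s : ℝ} (hs : 0 ≤ s) : BddMeas (japanese (-s)) :=
  ⟨(continuous_japanese _).measurable, 1, norm_japanese_neg_le hs⟩

theorem mulL_injective {a : E3 → ℂ} (ha : BddMeas a) (h0 : ∀ x, a x ≠ 0) :
    Function.Injective (mulL a) := by
  rw [injective_iff_map_eq_zero]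
  intro f hf
  refine Lp.ext ?_
  filter_upwards [mulL_coeFn ha f, Lp.coeFn_zero ℂ 2 (volume : Measure E3)] with x h1 h2
  rw [hf, h2, Pi.zero_apply, eq_comm, mul_eq_zero] at h1
  rw [h2, h1.resolve_left (h0 x), Pi.zero_apply]

/-- The truncated weights `min ⟨x⟩ˢ n`. -/
def truncWeight (s : ℝ) (n : ℕ) (x : E3) : ℂ := ((min ((1 + ‖x‖ ^ 2) ^ (s / 2)) (n : ℝ) : ℝ) : ℂ)

theorem norm_truncWeight (s : ℝ) (n : ℕ) (x : E3) :
    ‖truncWeight s n x‖ = min ((1 + ‖x‖ ^ 2) ^ (s / 2)) (n : ℝ) := by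
  rw [truncWeight, Complex.norm_real, Real.norm_of_nonneg (by positivity)]

theorem bddMeas_truncWeight (s : ℝ) (n : ℕ) : BddMeas (truncWeight s n) := by
  refine ⟨Continuous.measurable ?_, n, fun x => ?_⟩
  · refine Complex.continuous_ofReal.comp (Continuous.min ?_ continuous_const)
    exact Continuous.rpow_const (by fun_prop) fun x => Or.inl (by positivity)
  · rw [norm_truncWeight]
    exact min_le_right _ _

/-- Multiplication by ⟨x⟩ˢ is unbounded, so membership of u in L^{2,s} is tested with the truncated
weights; Fatou's lemma carries the uniform bound to the limit. -/
theorem exists_mulL_japanese_eq {s : ℝ} (hs : 0 ≤ s) {u : L2} {C : ℝ}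
    (h : ∀ n, ‖mulL (truncWeight s n) u‖ ≤ C) :
    ∃ v : L2, mulL (japanese (-s)) v = u ∧ ‖v‖ ≤ C := by
  have hC : 0 ≤ C := (norm_nonneg _).trans (h 0)
  have hlim : ∀ᵐ x, Tendsto (fun n => mulL (truncWeight s n) u x) atTop
      (𝓝 (japanese s x * u x)) := by
    filter_upwards [ae_all_iff.2 fun n => mulL_coeFn (bddMeas_truncWeight s n) u] with x hx
    refine tendsto_const_nhds.congr' ?_
    obtain ⟨N, hN⟩ := exists_nat_ge ((1 + ‖x‖ ^ 2) ^ (s / 2))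
    filter_upwards [eventually_ge_atTop N] with n hn
    rw [hx, truncWeight, min_eq_left (hN.trans (Nat.cast_le.2 hn)), japanese]
  have hle : eLpNorm (fun x => japanese s x * u x) 2 volume ≤ ENNReal.ofReal C := by
    refine (Lp.eLpNorm_lim_le_liminf_eLpNorm (fun n => Lp.aestronglyMeasurable _) _ hlim).trans ?_
    refine liminf_le_of_frequently_le' (Frequently.of_forall fun n => ?_)
    have := h n
    rw [Lp.norm_def] at this
    exact (ENNReal.le_ofReal_iff_toReal_le (Lp.eLpNorm_ne_top _) hC).2 this
  have hm : MemLp (fun x => japanese s x * u x) 2 volume :=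
    ⟨(continuous_japanese s).aestronglyMeasurable.mul (Lp.aestronglyMeasurable u),
      hle.trans_lt ENNReal.ofReal_lt_top⟩
  refine ⟨hm.toLp, Lp.ext ?_, ?_⟩
  · filter_upwards [mulL_coeFn (bddMeas_japanese_neg hs) hm.toLp, hm.coeFn_toLp] with x h1 h2
    rw [h1, h2, ← mul_assoc, mul_comm (japanese (-s) x), japanese_mul_neg, one_mul]
  · rw [Lp.norm_toLp]
    exact ENNReal.toReal_le_of_le_ofReal hC hle

/-- Injectivity of J makes the chosen preimages depend linearly on g. -/
theorem exists_lift {J T : L2 →L[ℂ] L2} (hJ : Function.Injective J) {C : ℝ}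
    (h : ∀ g, ∃ v, J v = T g ∧ ‖v‖ ≤ C * ‖g‖) : ∃ K : L2 →L[ℂ] L2, ∀ g, J (K g) = T g := by
  choose K hK hn using h
  refine ⟨LinearMap.mkContinuous
    { toFun := K
      map_add' := fun f g => hJ (by rw [map_add, hK, hK, hK, map_add])
      map_smul' := fun c f => hJ (by rw [hK, map_smul, map_smul, hK, RingHom.id_apply]) } C hn,
    fun g => hK g⟩

/-- Peetre's inequality: translating by y changes the weight ⟨x⟩ˢ by at most a factor of order ⟨y⟩ˢ.
-/
theorem one_add_norm_sq_le (x y : E3) :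
    1 + ‖x‖ ^ 2 ≤ 2 * (1 + ‖y‖ ^ 2) * (1 + ‖x - y‖ ^ 2) := by
  have h : ‖x‖ ≤ ‖x - y‖ + ‖y‖ := by simpa using norm_add_le (x - y) y
  have h2 : ‖x‖ ^ 2 ≤ (‖x - y‖ + ‖y‖) ^ 2 := by gcongr
  nlinarith [sq_nonneg (‖x - y‖ - ‖y‖), mul_nonneg (sq_nonneg ‖x - y‖) (sq_nonneg ‖y‖)]

theorem norm_truncWeight_transL_le {s : ℝ} (hs : 0 ≤ s) (n : ℕ) (y : E3) (g : L2) :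
    ‖mulL (truncWeight s n) (transL y (mulL (japanese (-s)) g))‖ ≤
      2 ^ (s / 2) * (1 + ‖y‖ ^ 2) ^ (s / 2) * ‖g‖ := by
  rw [← (transL y).norm_map g]
  refine Lp.norm_le_mul_norm_of_ae_le_mul ?_
  filter_upwards [mulL_coeFn (bddMeas_truncWeight s n) (transL y (mulL (japanese (-s)) g)),
    transL_coeFn y (mulL (japanese (-s)) g), transL_coeFn y g,
    ae_sub_const (mulL_coeFn (bddMeas_japanese_neg hs) g) y] with x h1 h2 h3 h4
  rw [h1, h2, h3, h4, norm_mul, norm_mul, ← mul_assoc]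
  refine mul_le_mul_of_nonneg_right ?_ (norm_nonneg _)
  rw [norm_truncWeight, norm_japanese]
  refine (mul_le_mul_of_nonneg_right (min_le_left _ _) (by positivity)).trans ?_
  have hp : (0 : ℝ) < 1 + ‖x - y‖ ^ 2 := by positivity
  rw [neg_div, Real.rpow_neg hp.le, ← div_eq_mul_inv, div_le_iff₀ (by positivity),
    ← Real.mul_rpow (by positivity) (by positivity), ← Real.mul_rpow (by positivity) (by positivity)]
  exact Real.rpow_le_rpow (by positivity) (one_add_norm_sq_le x y) (by positivity)

theorem bddMeas_schwartz (a : 𝓢(E3, ℂ)) : BddMeas a :=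
  ⟨a.continuous.measurable, SchwartzMap.seminorm ℝ 0 0 a, SchwartzMap.norm_le_seminorm ℝ _⟩

theorem integral_fourier_schwartz_mul (k : 𝓢(E3, ℂ)) {P : E3 → ℂ} (hP : Integrable P) :
    ∫ ξ, (𝓕 k : 𝓢(E3, ℂ)) ξ * P ξ = ∫ y, k y * ∫ ξ, ch (-y) ξ * P ξ := by
  have hF : Integrable (fun q : E3 × E3 => (P q.1 * k q.2) * ch (-q.2) q.1)
      (volume.prod volume) := by
    refine (hP.mul_prod k.integrable).mul_bdd (c := 1) ?_ ?_
    · exact Continuous.aestronglyMeasurable (by unfold ch; fun_prop)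
    · exact Eventually.of_forall fun q => (norm_ch _ _).le
  have e1 : ∀ ξ, (𝓕 k) ξ * P ξ = ∫ y, (P ξ * k y) * ch (-y) ξ := fun ξ => by
    rw [SchwartzMap.fourier_coe, Real.fourier_eq, ← integral_mul_const]
    refine integral_congr_ae (Eventually.of_forall fun y => ?_)
    simp only [ch, Circle.smul_def, smul_eq_mul, inner_neg_left]
    ring
  have e2 : ∀ y, k y * ∫ ξ, ch (-y) ξ * P ξ = ∫ ξ, (P ξ * k y) * ch (-y) ξ := fun y => by
    rw [← integral_const_mul]
    refine integral_congr_ae (Eventually.of_forall fun ξ => ?_)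
    simp only
    ring
  simp_rw [e1, e2]
  exact integral_integral_swap hF

/-- The multiplier is convolution with k, a superposition of translations. The weak form suffices
for norm bounds and avoids vector-valued integrals. -/
theorem inner_fm_schwartz (k : 𝓢(E3, ℂ)) (h f : L2) :
    inner ℂ h (fm (𝓕 k : 𝓢(E3, ℂ)) f) = ∫ y, k y * inner ℂ h (transL y f) := by
  rw [inner_fm_eq_integral (bddMeas_schwartz _),
    integral_fourier_schwartz_mul k (integrable_conj_mul (fou h) (fou f))]
  refine integral_congr_ae (Eventually.of_forall fun y => ?_)
  simp only
  rw [← fou.inner_map_map h, fou_transL, L2_inner_eq]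
  congr 1
  refine integral_congr_ae ?_
  filter_upwards [mulL_coeFn (bddMeas_ch (-y)) (fou f)] with ξ hξ
  rw [hξ]
  ring

/-- A Fourier multiplier with Schwartz symbol is bounded on the weighted space `L^{2,s}`. -/
theorem exists_weighted_fm {s : ℝ} (hs : 0 ≤ s) (a : 𝓢(E3, ℂ)) :
    ∃ K : L2 →L[ℂ] L2, ∀ g, mulL (japanese (-s)) (K g) = fm a (mulL (japanese (-s)) g) := by
  obtain ⟨k, rfl⟩ : ∃ k : 𝓢(E3, ℂ), a = 𝓕 k := ⟨𝓕⁻ a, (FourierTransform.fourier_fourierInv_eq a).symm⟩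
  -- Translation by y costs 2^(s/2)⟨y⟩ˢ on the weighted space, and ⟨y⟩ˢk is still Schwartz, so the
  -- total cost is finite.
  have hint : Integrable fun y => ‖k y‖ * (2 ^ (s / 2) * (1 + ‖y‖ ^ 2) ^ (s / 2)) := by
    have h := (SchwartzMap.smulLeftCLM ℂ (japanese s) k).integrable (μ := volume)
    refine (h.norm.const_mul (2 ^ (s / 2))).congr (Eventually.of_forall fun y => ?_)
    simp only
    rw [SchwartzMap.smulLeftCLM_apply_apply (japanese_temperate s), norm_smul, norm_japanese]
    ring
  set D := ∫ y, ‖k y‖ * (2 ^ (s / 2) * (1 + ‖y‖ ^ 2) ^ (s / 2))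
  have hD : 0 ≤ D := integral_nonneg fun y => by positivity
  refine exists_lift (T := fm (𝓕 k : 𝓢(E3, ℂ)) ∘L mulL (japanese (-s))) (C := D)
    (mulL_injective (bddMeas_japanese_neg hs) (japanese_ne_zero _))
    fun g => exists_mulL_japanese_eq hs fun n => ?_
  set u := mulL (truncWeight s n) ((fm (𝓕 k : 𝓢(E3, ℂ)) ∘L mulL (japanese (-s))) g)
  have key : ∀ h : L2, ‖inner ℂ h u‖ ≤ D * ‖g‖ * ‖h‖ := fun h => by
    have e : inner ℂ h u = ∫ y, k y * inner ℂ h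
        (mulL (truncWeight s n) (transL y (mulL (japanese (-s)) g))) := by
      have hc : (fun x => (starRingEnd ℂ) (truncWeight s n x)) = truncWeight s n := by
        ext x
        rw [truncWeight, Complex.conj_ofReal]
      have hi : ∀ v, inner ℂ h (mulL (truncWeight s n) v) =
          inner ℂ (mulL (truncWeight s n) h) v := fun v => by
        rw [inner_mulL_left (bddMeas_truncWeight s n), hc]
      simp_rw [u, hi]
      rw [ContinuousLinearMap.comp_apply, inner_fm_schwartz]
    rw [e]
    refine (norm_integral_le_of_norm_le ((hint.mul_const ‖g‖).mul_const ‖h‖)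
      (Eventually.of_forall fun y => ?_)).trans_eq ?_
    · rw [norm_mul, mul_assoc, mul_assoc]
      refine mul_le_mul_of_nonneg_left ?_ (norm_nonneg _)
      refine (norm_inner_le_norm _ _).trans ?_
      rw [mul_comm ‖h‖, ← mul_assoc]
      exact mul_le_mul_of_nonneg_right (norm_truncWeight_transL_le hs n y g) (norm_nonneg _)
    · rw [integral_mul_const, integral_mul_const]
  -- Testing against u itself turns the bound for the functional into a bound for ‖u‖.
  have h := key u
  rw [← inner_self_re_eq_norm, ← norm_sq_eq_re_inner, pow_two] at h
  by_cases h0 : ‖u‖ = 0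
  · rw [h0]; positivity
  · exact le_of_mul_le_mul_right h (lt_of_le_of_ne (norm_nonneg _) (Ne.symm h0))

/-! ### The one-dimensional outgoing kernel -/

/-- The derivative of exp has modulus at most 1 on the closed left half-plane, which is convex. -/
theorem norm_exp_sub_exp_le {x y : ℂ} (hx : x.re ≤ 0) (hy : y.re ≤ 0) :
    ‖Complex.exp x - Complex.exp y‖ ≤ ‖x - y‖ := by
  have h := Convex.norm_image_sub_le_of_norm_hasDerivWithin_le (f := Complex.exp)
    (f' := Complex.exp) (s := {z : ℂ | z.re ≤ 0}) (C := 1) (x := y) (y := x)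
    (fun z _ => (Complex.hasDerivAt_exp z).hasDerivWithinAt)
    (fun z hz => by rw [Complex.norm_exp]; exact Real.exp_le_one_iff.2 hz)
    (convex_halfSpace_re_le 0) hy hx
  rwa [one_mul] at h

/-- The kernel `i e^{iκ|r|} / (2κ)` of the resolvent of `-d²/dr²` at `κ²`. -/
def lineKernel (κ : ℂ) (r : ℝ) : ℂ :=
  Complex.I / (2 * κ) * Complex.exp (Complex.I * κ * (|r| : ℝ))

theorem re_I_mul (κ : ℂ) (r : ℝ) : (Complex.I * κ * (|r| : ℝ)).re = -(κ.im * |r|) := by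
  simp

theorem norm_lineKernel (κ : ℂ) (r : ℝ) :
    ‖lineKernel κ r‖ = 1 / (2 * ‖κ‖) * Real.exp (-(κ.im * |r|)) := by
  rw [lineKernel, norm_mul, Complex.norm_exp, re_I_mul, norm_div, norm_mul, Complex.norm_I]
  norm_num

/-- Split at r = 0: both halves are integrals of exponentials that decay because Im κ > 0. -/
theorem integral_lineKernel {κ : ℂ} (hκ : 0 < κ.im) (y : ℝ) :
    ∫ r : ℝ, lineKernel κ r * Complex.exp (-(Complex.I * y * r)) = 1 / ((y : ℂ) ^ 2 - κ ^ 2) := by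
  have hκ0 : κ ≠ 0 := fun h => by simp [h] at hκ
  have hp : (Complex.I * (κ - y)).re < 0 := by simpa using hκ
  have hm : 0 < (-(Complex.I * (κ + y))).re := by simpa using hκ
  have n1 : κ - y ≠ 0 := fun h => by rw [h] at hp; simp at hp
  have n2 : κ + y ≠ 0 := fun h => by rw [h] at hm; simp at hm
  have e1 : ∀ r ∈ Set.Ioi (0 : ℝ), lineKernel κ r * Complex.exp (-(Complex.I * y * r)) =
      Complex.I / (2 * κ) * Complex.exp (Complex.I * (κ - y) * r) := fun r hr => by
    rw [lineKernel, abs_of_pos hr, mul_assoc, ← Complex.exp_add]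
    ring_nf
  have e2 : ∀ r ∈ Set.Iic (0 : ℝ), lineKernel κ r * Complex.exp (-(Complex.I * y * r)) =
      Complex.I / (2 * κ) * Complex.exp (-(Complex.I * (κ + y)) * r) := fun r hr => by
    rw [lineKernel, abs_of_nonpos hr, mul_assoc, ← Complex.exp_add]
    push_cast
    ring_nf
  rw [← setIntegral_univ, ← Set.Iic_union_Ioi (a := (0 : ℝ)),
    setIntegral_union (Set.Iic_disjoint_Ioi le_rfl) measurableSet_Ioi,
    setIntegral_congr_fun measurableSet_Ioi e1, setIntegral_congr_fun measurableSet_Iic e2,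
    integral_const_mul, integral_const_mul, integral_exp_mul_complex_Ioi hp,
    integral_exp_mul_complex_Iic hm]
  · have n3 : (y : ℂ) ^ 2 - κ ^ 2 ≠ 0 := by
      rw [show (y : ℂ) ^ 2 - κ ^ 2 = -((κ - y) * (κ + y)) by ring]
      exact neg_ne_zero.2 (mul_ne_zero n1 n2)
    have hI := Complex.I_ne_zero
    simp only [Complex.ofReal_zero, mul_zero, Complex.exp_zero]
    field_simp
    ring
  · exact IntegrableOn.congr_fun ((integrableOn_exp_mul_complex_Iic hm 0).const_mul _)
      (fun r hr => (e2 r hr).symm) measurableSet_Iic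
  · exact IntegrableOn.congr_fun ((integrableOn_exp_mul_complex_Ioi hp 0).const_mul _)
      (fun r hr => (e1 r hr).symm) measurableSet_Ioi

/-- The change of the prefactor costs 1/c², the change of the exponent |r|/c. No decay is used, so
the bound is uniform up to real κ. -/
theorem norm_lineKernel_sub_le {c : ℝ} (hc : 0 < c) {κ κ' : ℂ} (h : 0 ≤ κ.im) (h' : 0 ≤ κ'.im)
    (hκ : c ≤ ‖κ‖) (hκ' : c ≤ ‖κ'‖) (r : ℝ) :
    ‖lineKernel κ r - lineKernel κ' r‖ ≤ (1 / c ^ 2 + 1 / c) * (‖κ - κ'‖ * (1 + |r|)) := by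
  have n1 : κ ≠ 0 := norm_pos_iff.1 (hc.trans_le hκ)
  have n2 : κ' ≠ 0 := norm_pos_iff.1 (hc.trans_le hκ')
  set E := Complex.exp (Complex.I * κ * (|r| : ℝ))
  set E' := Complex.exp (Complex.I * κ' * (|r| : ℝ))
  have hE : ‖E‖ ≤ 1 := by
    rw [Complex.norm_exp, re_I_mul, Real.exp_le_one_iff, neg_nonpos]
    positivity
  have hEE : ‖E - E'‖ ≤ ‖κ - κ'‖ * |r| := by
    refine (norm_exp_sub_exp_le ?_ ?_).trans_eq ?_
    · rw [re_I_mul, neg_nonpos]; positivity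
    · rw [re_I_mul, neg_nonpos]; positivity
    · rw [← sub_mul, ← mul_sub, norm_mul, norm_mul, Complex.norm_I, one_mul, Complex.norm_real,
        Real.norm_eq_abs, abs_abs]
  have e : lineKernel κ r - lineKernel κ' r =
      Complex.I / 2 * ((κ' - κ) / (κ * κ') * E + 1 / κ' * (E - E')) := by
    change Complex.I / (2 * κ) * E - Complex.I / (2 * κ') * E' = _
    clear_value E E'
    field_simp
    ring
  rw [e, norm_mul, norm_div, Complex.norm_I, Complex.norm_ofNat]
  have h1 : ‖(κ' - κ) / (κ * κ') * E‖ ≤ ‖κ - κ'‖ * (1 / c ^ 2) := by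
    rw [norm_mul, norm_div, norm_mul, norm_sub_rev, div_eq_mul_one_div, mul_assoc]
    refine mul_le_mul_of_nonneg_left ?_ (norm_nonneg _)
    have : 1 / (‖κ‖ * ‖κ'‖) ≤ 1 / c ^ 2 := by
      rw [pow_two]; gcongr
    calc 1 / (‖κ‖ * ‖κ'‖) * ‖E‖ ≤ 1 / c ^ 2 * 1 := by gcongr
      _ = 1 / c ^ 2 := mul_one _
  have h2 : ‖1 / κ' * (E - E')‖ ≤ 1 / c * (‖κ - κ'‖ * |r|) := by
    rw [norm_mul, norm_div, norm_one]
    gcongr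
  have h3 := norm_add_le ((κ' - κ) / (κ * κ') * E) (1 / κ' * (E - E'))
  have h4 : 0 ≤ ‖κ - κ'‖ * (1 / c ^ 2) := by positivity
  have h5 : 0 ≤ 1 / c * (‖κ - κ'‖ * |r|) := by positivity
  have h6 : 0 ≤ 1 / c ^ 2 * (‖κ - κ'‖ * |r|) := by positivity
  have h7 : 0 ≤ 1 / c * ‖κ - κ'‖ := by positivity
  nlinarith

/-! ### Square roots with positive imaginary part, and Hölder continuity in the energy -/

theorem abs_eq_one_of_sq {σ : ℝ} (h : σ ^ 2 = 1) : |σ| = 1 := by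
  rw [← Real.sqrt_sq_eq_abs, h, Real.sqrt_one]

/-- The square root of `w` in the half-plane `σ Re > 0`, `σ = ±1`. -/
def halfRoot (σ : ℝ) (w : ℂ) : ℂ := σ * w ^ (2⁻¹ : ℂ)

theorem halfRoot_sq {σ : ℝ} (hσ : σ ^ 2 = 1) (w : ℂ) : halfRoot σ w ^ 2 = w := by
  rw [halfRoot, mul_pow, ← Complex.ofReal_pow, hσ, Complex.ofReal_one, one_mul]
  exact_mod_cast Complex.cpow_nat_inv_pow w two_ne_zero

/-- The principal root has nonnegative real part, and (Re κ)² = Re w + (Im κ)² ≥ d. -/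
theorem re_halfRoot {σ : ℝ} (hσ : σ ^ 2 = 1) {d : ℝ} (hd : 0 < d) {w : ℂ} (hw : d ≤ w.re) :
    √d ≤ σ * (halfRoot σ w).re := by
  have h0 : w ≠ 0 := fun h => by simp [h] at hw; linarith
  have hre : σ * (halfRoot σ w).re = (w ^ (2⁻¹ : ℂ)).re := by
    rw [halfRoot, Complex.re_ofReal_mul, ← mul_assoc, ← pow_two, hσ, one_mul]
  have hsq : (w ^ (2⁻¹ : ℂ)) ^ 2 = w := by exact_mod_cast Complex.cpow_nat_inv_pow w two_ne_zero
  have hpos : 0 ≤ (w ^ (2⁻¹ : ℂ)).re := by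
    rw [Complex.cpow_def_of_ne_zero h0, Complex.exp_re]
    refine mul_nonneg (Real.exp_nonneg _) (Real.cos_nonneg_of_mem_Icc ?_)
    have him : (Complex.log w * 2⁻¹).im = w.arg / 2 := by
      rw [show (2⁻¹ : ℂ) = ((2⁻¹ : ℝ) : ℂ) by norm_num, Complex.im_mul_ofReal, Complex.log_im]
      ring
    rw [him]
    have h1 := Complex.neg_pi_lt_arg w
    have h2 := Complex.arg_le_pi w
    constructor <;> linarith
  rw [hre]
  refine Real.sqrt_le_iff.2 ⟨hpos, ?_⟩
  have := congrArg Complex.re hsq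
  rw [pow_two, Complex.mul_re] at this
  nlinarith [mul_self_nonneg (w ^ (2⁻¹ : ℂ)).im]

theorem sqrt_le_norm_halfRoot {σ : ℝ} (hσ : σ ^ 2 = 1) {d : ℝ} (hd : 0 < d) {w : ℂ}
    (hw : d ≤ w.re) : √d ≤ ‖halfRoot σ w‖ := by
  refine (re_halfRoot hσ hd hw).trans ((le_abs_self _).trans ?_)
  rw [abs_mul, abs_eq_one_of_sq hσ, one_mul]
  exact Complex.abs_re_le_norm _

/-- From σ Im w = 2(σ Re κ) Im κ with 0 < σ Re κ ≤ 1 + M. This is why the root carries the sign σ: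
approached from either half-plane, it has positive imaginary part and gives a decaying kernel. -/
theorem im_halfRoot {σ : ℝ} (hσ : σ ^ 2 = 1) {d : ℝ} (hd : 0 < d) {w : ℂ} (hw : d ≤ w.re)
    (hi : 0 < σ * w.im) {M : ℝ} (hM : ‖w‖ ≤ M) :
    σ * w.im / (2 * (1 + M)) ≤ (halfRoot σ w).im := by
  have h1 : √d ≤ _ := re_halfRoot hσ hd hw
  have hd' := Real.sqrt_pos.2 hd
  have hsq := halfRoot_sq hσ w
  have him := congrArg Complex.im hsq
  rw [pow_two, Complex.mul_im] at him
  set κ := halfRoot σ w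
  have hn : ‖κ‖ ^ 2 ≤ M := by rw [← norm_pow, hsq]; exact hM
  have hre : σ * κ.re ≤ 1 + M := by
    have := Complex.abs_re_le_norm κ
    have h3 : σ * κ.re ≤ |κ.re| := by
      refine (le_abs_self _).trans_eq ?_
      rw [abs_mul, abs_eq_one_of_sq hσ, one_mul]
    nlinarith [sq_nonneg (‖κ‖ - 1)]
  have e : σ * w.im = 2 * (σ * κ.re) * κ.im := by rw [← him]; ring
  have hp : 0 < σ * κ.re := hd'.trans_le h1
  have hk : 0 < κ.im := by
    rw [e] at hi
    exact pos_of_mul_pos_right hi (by positivity)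
  rw [div_le_iff₀ (by linarith), e]
  nlinarith

/-- Factor w - w' = (κ - κ')(κ + κ'); both roots lie on the same side, so the second factor cannot
be small. -/
theorem norm_halfRoot_sub_le {σ : ℝ} (hσ : σ ^ 2 = 1) {d : ℝ} (hd : 0 < d) {w w' : ℂ}
    (hw : d ≤ w.re) (hw' : d ≤ w'.re) :
    ‖halfRoot σ w - halfRoot σ w'‖ ≤ ‖w - w'‖ / √d := by
  have hd' := Real.sqrt_pos.2 hd
  rw [le_div_iff₀ hd']
  conv_rhs => rw [← halfRoot_sq hσ w, ← halfRoot_sq hσ w', sq_sub_sq, norm_mul, mul_comm]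
  refine mul_le_mul_of_nonneg_left ?_ (norm_nonneg _)
  have h1 := re_halfRoot hσ hd hw
  have h2 := re_halfRoot hσ hd hw'
  have h3 : σ * (halfRoot σ w + halfRoot σ w').re ≤ ‖halfRoot σ w + halfRoot σ w'‖ := by
    refine (le_abs_self _).trans ?_
    rw [abs_mul, abs_eq_one_of_sq hσ, one_mul]
    exact Complex.abs_re_le_norm _
  rw [Complex.add_re, mul_add] at h3
  linarith

/-- Interpolation between a uniform bound and a Lipschitz bound: use the Lipschitz one for τ ≤ 1 and
the uniform one for τ ≥ 1. -/
theorem le_add_mul_rpow {X A B τ ε : ℝ} (hA : 0 ≤ A) (hB : 0 ≤ B) (hτ : 0 ≤ τ) (hε : 0 ≤ ε)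
    (hε1 : ε ≤ 1) (h1 : X ≤ A) (h2 : X ≤ B * τ) : X ≤ (A + B) * τ ^ ε := by
  rcases le_total τ 1 with h | h
  · have h3 : τ ≤ τ ^ ε := by
      rcases hτ.eq_or_lt with h0 | h0
      · rw [← h0]; positivity
      · simpa using Real.rpow_le_rpow_of_exponent_ge h0 h hε1
    have h4 : 0 ≤ τ ^ ε := by positivity
    nlinarith
  · have h3 : 1 ≤ τ ^ ε := Real.one_le_rpow h hε
    nlinarith

/-- Hölder continuity of the outgoing kernel in the spectral parameter. -/
theorem exists_lineKernel_holder {d : ℝ} (hd : 0 < d) {ε : ℝ} (hε : 0 ≤ ε) (hε1 : ε ≤ 1) :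
    ∃ C : ℝ, 0 ≤ C ∧ ∀ σ : ℝ, σ ^ 2 = 1 → ∀ w w' : ℂ, d ≤ w.re → d ≤ w'.re →
      0 < σ * w.im → 0 < σ * w'.im → ∀ r : ℝ,
        ‖lineKernel (halfRoot σ w) r - lineKernel (halfRoot σ w') r‖ ≤
          C * (‖w - w'‖ * (1 + |r|)) ^ ε := by
  have hc := Real.sqrt_pos.2 hd
  set c := √d
  -- The first summand bounds two kernels of size at most 1/(2c); the second is the Lipschitz
  -- constant in κ, divided by c = √d for the passage from κ to w.
  refine ⟨1 / c + (1 / c ^ 2 + 1 / c) / c, by positivity, fun σ hσ w w' hw hw' hi hi' r => ?_⟩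
  have n1 := sqrt_le_norm_halfRoot hσ hd hw
  have n2 := sqrt_le_norm_halfRoot hσ hd hw'
  have hI : ∀ {w : ℂ}, d ≤ w.re → 0 < σ * w.im → 0 ≤ (halfRoot σ w).im := fun hw hi =>
    le_trans (by positivity) (im_halfRoot hσ hd hw hi le_rfl)
  have hb : ∀ {w : ℂ}, d ≤ w.re → 0 < σ * w.im → ‖lineKernel (halfRoot σ w) r‖ ≤ 1 / (2 * c) :=
    fun {w} hw hi => by
      have h := sqrt_le_norm_halfRoot hσ hd hw
      rw [norm_lineKernel]
      have h1 : Real.exp (-((halfRoot σ w).im * |r|)) ≤ 1 := by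
        rw [Real.exp_le_one_iff, neg_nonpos]
        exact mul_nonneg (hI hw hi) (abs_nonneg _)
      calc _ ≤ 1 / (2 * c) * 1 := by gcongr
        _ = _ := mul_one _
  refine le_add_mul_rpow (by positivity) (by positivity) (by positivity) hε hε1 ?_ ?_
  · refine (norm_sub_le _ _).trans ((add_le_add (hb hw hi) (hb hw' hi')).trans_eq ?_)
    field_simp
    ring
  · refine (norm_lineKernel_sub_le hc (hI hw hi) (hI hw' hi') n1 n2 r).trans ?_
    have := norm_halfRoot_sub_le hσ hd hw hw'
    rw [div_mul_eq_mul_div, mul_div_assoc]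
    refine mul_le_mul_of_nonneg_left ?_ (by positivity)
    rw [mul_div_right_comm]
    gcongr

/-! ### The resolvent symbol on a slab of frequencies -/

/-- The symbol `|2πξ|` of `|D|`. -/
def freq (ξ : E3) : ℝ := ‖(2 * Real.pi) • ξ‖

theorem freq_nonneg (ξ : E3) : 0 ≤ freq ξ := norm_nonneg _

theorem freq_eq (ξ : E3) : freq ξ = 2 * Real.pi * ‖ξ‖ := by
  rw [freq, norm_smul, Real.norm_of_nonneg (by positivity)]

theorem continuous_freq : Continuous freq := by
  unfold freq
  fun_prop

/-- The part of `|2πξ|²` orthogonal to the `j`-th coordinate direction. -/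
def perp (j : Fin 3) (ξ : E3) : ℝ := freq ξ ^ 2 - (2 * Real.pi * ξ j) ^ 2

theorem continuous_perp (j : Fin 3) : Continuous (perp j) := by
  unfold perp
  have := continuous_freq
  fun_prop

theorem perp_nonneg (j : Fin 3) (ξ : E3) : 0 ≤ perp j ξ := by
  rw [perp, freq_eq, mul_pow _ ‖ξ‖, mul_pow _ (ξ j), ← mul_sub]
  have h : ξ j ^ 2 ≤ ‖ξ‖ ^ 2 := by
    have := PiLp.norm_apply_le ξ j
    rw [← sq_abs (ξ j)]
    gcongr
    exact this
  exact mul_nonneg (by positivity) (sub_nonneg.2 h)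

theorem sub_unitVec_apply (ξ : E3) (t : ℝ) (j : Fin 3) : (ξ - t • unitVec j) j = ξ j - t := by
  simp [unitVec]

theorem perp_sub_unitVec (j : Fin 3) (ξ : E3) (t : ℝ) : perp j (ξ - t • unitVec j) = perp j ξ := by
  have h1 : ‖ξ - t • unitVec j‖ ^ 2 = ‖ξ‖ ^ 2 - 2 * (t * ξ j) + t ^ 2 := by
    rw [norm_sub_sq_real, real_inner_comm, inner_unitVec, norm_smul, unitVec]
    simp
  rw [perp, perp, freq_eq, freq_eq, mul_pow, h1, sub_unitVec_apply]
  ring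

/-- The resolvent symbol of `-Δ`, restricted to a slab of frequencies around the `j`-th axis. -/
def slab (j : Fin 3) (ρ : ℝ) (z : ℂ) (ξ : E3) : ℂ :=
  if perp j ξ ≤ ρ then 1 / ((freq ξ : ℂ) ^ 2 - z) else 0

/-- The contribution to `slab` of the translation by `r` in the `j`-th direction. -/
def slabKernel (j : Fin 3) (ρ σ : ℝ) (z : ℂ) (r : ℝ) (ξ : E3) : ℂ :=
  if perp j ξ ≤ ρ then
    lineKernel (halfRoot σ (z - perp j ξ)) r * (Real.fourierChar (-(r * ξ j)) : ℂ) else 0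

/-- Only the character depends on ξ_j, since `perp j` is invariant along the j-th axis. This is the
covariance required by `inner_fm_eq_zero`. -/
theorem slabKernel_sub_unitVec (j : Fin 3) (ρ σ : ℝ) (z : ℂ) (r : ℝ) (ξ : E3) (t : ℝ) :
    slabKernel j ρ σ z r ξ =
      (Real.fourierChar (-(t * r)) : ℂ) * slabKernel j ρ σ z r (ξ - t • unitVec j) := by
  rw [slabKernel, slabKernel, perp_sub_unitVec, sub_unitVec_apply]
  split_ifs
  · rw [mul_left_comm, ← Circle.coe_mul, ← AddChar.map_add_eq_mul]
    congr 4
    ring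
  · rw [mul_zero]

theorem measurable_slabKernel (j : Fin 3) (ρ σ : ℝ) (z : ℂ) :
    Measurable (Function.uncurry (slabKernel j ρ σ z)) := by
  change Measurable fun q : ℝ × E3 => slabKernel j ρ σ z q.1 q.2
  have hp := (continuous_perp j).measurable
  unfold slabKernel lineKernel halfRoot
  refine Measurable.ite (measurableSet_le (by fun_prop) (by fun_prop)) ?_ measurable_const
  refine Measurable.mul ?_ (Continuous.measurable (by fun_prop))
  have h1 : Measurable fun q : ℝ × E3 => (σ : ℂ) * (z - (perp j q.2 : ℂ)) ^ (2⁻¹ : ℂ) :=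
    measurable_const.mul (Measurable.pow_const (by fun_prop) _)
  exact (measurable_const.div (measurable_const.mul h1)).mul
    (Complex.measurable_exp.comp (by fun_prop))

theorem measurable_slab (j : Fin 3) (ρ : ℝ) (z : ℂ) : Measurable (slab j ρ z) := by
  have hp := (continuous_perp j).measurable
  have hf := continuous_freq.measurable
  unfold slab
  exact Measurable.ite (measurableSet_le (by fun_prop) (by fun_prop)) (by fun_prop) measurable_const

/-- The spectral parameters for which the slab `perp j ≤ ρ` is uniformly transversal to the
sphere. -/
def Transversal (σ ρ d : ℝ) (z : ℂ) : Prop := ρ + d ≤ z.re ∧ 0 < σ * z.im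

section

variable {σ ρ d : ℝ} {z : ℂ} {j : Fin 3}

theorem Transversal.re_sub (hz : Transversal σ ρ d z) {ξ : E3} (hξ : perp j ξ ≤ ρ) :
    d ≤ (z - perp j ξ).re := by
  rw [Complex.sub_re, Complex.ofReal_re]
  linarith [hz.1]

theorem Transversal.im_sub (hz : Transversal σ ρ d z) (ξ : E3) :
    0 < σ * (z - perp j ξ).im := by
  simpa using hz.2

theorem bddMeas_slab (hz : z.im ≠ 0) : BddMeas (slab j ρ z) := by
  refine ⟨measurable_slab j ρ z, 1 / |z.im|, fun ξ => ?_⟩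
  rw [slab]
  split_ifs
  · rw [norm_div, norm_one]
    refine one_div_le_one_div_of_le (abs_pos.2 hz) ?_
    have := Complex.abs_im_le_norm ((freq ξ : ℂ) ^ 2 - z)
    rwa [Complex.sub_im, ← Complex.ofReal_pow, Complex.ofReal_im, zero_sub, abs_neg,
      Complex.ofReal_pow] at this
  · rw [norm_zero]; positivity

/-- The decay rate c degenerates as z approaches the real axis. The bound serves only for
boundedness and Fubini at fixed z, not for the uniform estimates. -/
theorem Transversal.norm_slabKernel_le (hσ : σ ^ 2 = 1) (hd : 0 < d) (hρ : 0 ≤ ρ)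
    (hz : Transversal σ ρ d z) : ∃ c A : ℝ, 0 < c ∧ ∀ (r : ℝ) (ξ : E3),
      ‖slabKernel j ρ σ z r ξ‖ ≤ A * Real.exp (-(c * |r|)) := by
  refine ⟨σ * z.im / (2 * (1 + (‖z‖ + ρ))), 1 / (2 * √d), ?_, fun r ξ => ?_⟩
  · have := hz.2
    positivity
  have hd' := Real.sqrt_pos.2 hd
  rw [slabKernel]
  split_ifs with hξ
  · rw [norm_mul, Circle.norm_coe, mul_one, norm_lineKernel]
    have h1 := sqrt_le_norm_halfRoot hσ hd (hz.re_sub hξ)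
    have h2 := im_halfRoot hσ hd (hz.re_sub hξ) (hz.im_sub ξ) (M := ‖z‖ + ρ) (by
      refine (norm_sub_le _ _).trans (add_le_add le_rfl ?_)
      rwa [Complex.norm_real, Real.norm_of_nonneg (perp_nonneg j ξ)])
    rw [Complex.sub_im, Complex.ofReal_im, sub_zero] at h2
    gcongr
  · rw [norm_zero]; positivity

theorem Transversal.bddMeas_slabKernel (hσ : σ ^ 2 = 1) (hd : 0 < d) (hρ : 0 ≤ ρ)
    (hz : Transversal σ ρ d z) (r : ℝ) : BddMeas (slabKernel j ρ σ z r) := by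
  obtain ⟨c, A, -, h⟩ := hz.norm_slabKernel_le (j := j) hσ hd hρ
  exact ⟨(measurable_slabKernel j ρ σ z).of_uncurry_left, _, h r⟩

theorem integrable_exp_neg_mul_abs {c : ℝ} (hc : 0 < c) :
    Integrable fun r : ℝ => Real.exp (-(c * |r|)) := by
  rw [← integrableOn_univ, ← Set.Iic_union_Ioi (a := (0 : ℝ))]
  refine IntegrableOn.union ?_ ?_
  · refine IntegrableOn.congr_fun (integrableOn_exp_mul_Iic hc 0) (fun r hr => ?_) measurableSet_Iic
    rw [abs_of_nonpos hr, mul_neg, neg_neg]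
  · refine IntegrableOn.congr_fun (integrableOn_exp_mul_Ioi (neg_lt_zero.2 hc) 0) (fun r hr => ?_)
      measurableSet_Ioi
    rw [abs_of_pos hr, neg_mul]

/-- The formula `integral_lineKernel` at y = 2πξ_j and κ² = z - `perp j ξ`, for which y² - κ² =
|2πξ|² - z. -/
theorem Transversal.integral_slabKernel (hσ : σ ^ 2 = 1) (hd : 0 < d)
    (hz : Transversal σ ρ d z) (ξ : E3) : ∫ r, slabKernel j ρ σ z r ξ = slab j ρ z ξ := by
  unfold slabKernel slab
  split_ifs with hξ
  · have hi : 0 < (halfRoot σ (z - perp j ξ)).im := by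
      refine lt_of_lt_of_le ?_ (im_halfRoot hσ hd (hz.re_sub hξ) (hz.im_sub ξ) le_rfl)
      have := hz.im_sub (j := j) ξ
      positivity
    have h := integral_lineKernel hi (2 * Real.pi * ξ j)
    rw [halfRoot_sq hσ] at h
    have e : ((2 * Real.pi * ξ j : ℝ) : ℂ) ^ 2 - (z - perp j ξ) = (freq ξ : ℂ) ^ 2 - z := by
      rw [perp]
      push_cast
      ring
    rw [e] at h
    rw [← h]
    refine integral_congr_ae (Eventually.of_forall fun r => ?_)
    simp only [Real.fourierChar_apply]
    congr 2
    push_cast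
    ring
  · simp

theorem Transversal.integral_slab_mul (hσ : σ ^ 2 = 1) (hd : 0 < d) (hρ : 0 ≤ ρ)
    (hz : Transversal σ ρ d z) {P : E3 → ℂ} (hP : Integrable P) :
    Integrable (fun r => ∫ ξ, slabKernel j ρ σ z r ξ * P ξ) ∧
    ∫ ξ, slab j ρ z ξ * P ξ = ∫ r, ∫ ξ, slabKernel j ρ σ z r ξ * P ξ := by
  obtain ⟨c, A, hc, hA⟩ := hz.norm_slabKernel_le (j := j) hσ hd hρ
  have hF : Integrable (fun q : ℝ × E3 => slabKernel j ρ σ z q.1 q.2 * P q.2)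
      (volume.prod volume) := by
    refine (((integrable_exp_neg_mul_abs hc).const_mul A).mul_prod hP.norm).mono ?_ ?_
    · exact (measurable_slabKernel j ρ σ z).aestronglyMeasurable.mul hP.aestronglyMeasurable.comp_snd
    · refine Eventually.of_forall fun q => ?_
      rw [norm_mul, norm_mul, norm_norm]
      exact mul_le_mul_of_nonneg_right ((hA q.1 q.2).trans (Real.le_norm_self _)) (norm_nonneg _)
  refine ⟨hF.integral_prod_left, ?_⟩
  rw [integral_integral_swap hF]
  refine integral_congr_ae (Eventually.of_forall fun ξ => ?_)
  simp only
  rw [integral_mul_const, hz.integral_slabKernel hσ hd]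

end

/-! ### Matrix elements between slabs in position space -/

/-- `f` is supported in the slab `n ≤ x_j ≤ n + 1`. -/
def InCell (j : Fin 3) (n : ℤ) (f : L2) : Prop :=
  ∀ᵐ x, f x ≠ 0 → (n : ℝ) ≤ x j ∧ x j ≤ n + 1

theorem exists_schwartz_bump (n : ℤ) : ∃ p : 𝓢(ℝ, ℂ),
    (∀ y : ℝ, (n : ℝ) ≤ y → y ≤ n + 1 → p y = 1) ∧
      ∀ y : ℝ, 1 ≤ |y - (n + 1 / 2)| → p y = 0 := by
  let b : ContDiffBump ((n : ℝ) + 1 / 2) := ⟨1 / 2, 1, by norm_num, by norm_num⟩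
  have hcs : HasCompactSupport fun y => ((b y : ℝ) : ℂ) :=
    b.hasCompactSupport.comp_left (g := fun r : ℝ => (r : ℂ)) Complex.ofReal_zero
  have hcd : ContDiff ℝ (⊤ : ℕ∞) fun y => ((b y : ℝ) : ℂ) :=
    Complex.ofRealCLM.contDiff.comp b.contDiff
  refine ⟨hcs.toSchwartzMap hcd, fun y h1 h2 => ?_, fun y hy => ?_⟩
  · change ((b y : ℝ) : ℂ) = 1
    rw [b.one_of_mem_closedBall, Complex.ofReal_one]
    rw [Metric.mem_closedBall, Real.dist_eq, abs_le]
    constructor <;> simp only [b] <;> linarith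
  · change ((b y : ℝ) : ℂ) = 0
    rw [b.zero_of_le_dist, Complex.ofReal_zero]
    rwa [Real.dist_eq]

/-- The bump for the cell n vanishes at distance 1 from n + 1/2. The cell m has half-width 1/2, so
it misses the bump shifted by r once |r - (m - n)| ≥ 1 + 1/2. -/
theorem Transversal.inner_slabKernel_eq_zero {σ ρ d : ℝ} {z : ℂ} {j : Fin 3} (hσ : σ ^ 2 = 1)
    (hd : 0 < d) (hρ : 0 ≤ ρ) (hz : Transversal σ ρ d z) {m n : ℤ} {f h : L2}
    (hf : InCell j n f) (hh : InCell j m h) {r : ℝ} (hr : 3 / 2 ≤ |r - (m - n)|) :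
    ∫ ξ, slabKernel j ρ σ z r ξ * ((starRingEnd ℂ) (fou h ξ) * fou f ξ) = 0 := by
  obtain ⟨p, hp1, hp0⟩ := exists_schwartz_bump n
  rw [← inner_fm_eq_integral (hz.bddMeas_slabKernel hσ hd hρ r)]
  refine inner_fm_eq_zero (hz.bddMeas_slabKernel hσ hd hρ r) j
    (fun ξ t => slabKernel_sub_unitVec j ρ σ z r ξ t) p ?_ ?_
  · filter_upwards [hf] with x hx h0
    exact hp1 _ (hx h0).1 (hx h0).2
  · filter_upwards [hh] with x hx h0
    obtain ⟨h1, h2⟩ := hx h0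
    refine hp0 _ ?_
    rcases le_abs.1 hr with h | h
    · rw [abs_sub_comm]
      exact le_abs.2 (Or.inl (by linarith))
    · exact le_abs.2 (Or.inl (by linarith))

/-- Hölder bound for the matrix elements of the resolvent between unit slabs in position space. -/
theorem exists_cell_bound {ρ d : ℝ} (hd : 0 < d) (hρ : 0 ≤ ρ) {ε : ℝ} (hε : 0 ≤ ε) (hε1 : ε ≤ 1) :
    ∃ C : ℝ, 0 ≤ C ∧ ∀ (j : Fin 3) (σ : ℝ), σ ^ 2 = 1 → ∀ z z' : ℂ,
      Transversal σ ρ d z → Transversal σ ρ d z' → ∀ (m n : ℤ) (f h : L2),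
        InCell j n f → InCell j m h →
          ‖inner ℂ h (fm (slab j ρ z - slab j ρ z') f)‖ ≤
            C * (‖z - z'‖ * ((1 + |(m : ℝ)|) * (1 + |(n : ℝ)|))) ^ ε * (‖f‖ * ‖h‖) := by
  obtain ⟨C, hC, hk⟩ := exists_lineKernel_holder hd hε hε1
  refine ⟨3 * (C * 3 ^ ε), by positivity, fun j σ hσ z z' hz hz' m n f h hf hh => ?_⟩
  have hi : ∀ {z : ℂ}, Transversal σ ρ d z → z.im ≠ 0 := fun hz h0 => by
    have := hz.2; simp [h0] at this
  set P : E3 → ℂ := fun ξ => (starRingEnd ℂ) (fou h ξ) * fou f ξ with hPdef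
  have hP : Integrable P := integrable_conj_mul _ _
  have hPn : ∫ ξ, ‖P ξ‖ ≤ ‖f‖ * ‖h‖ := by
    have := integral_norm_mul_le (fou h) (fou f)
    rw [fou.norm_map, fou.norm_map, mul_comm ‖h‖] at this
    refine le_trans (le_of_eq ?_) this
    refine integral_congr_ae (Eventually.of_forall fun ξ => ?_)
    simp [hPdef]
  set D : ℝ → E3 → ℂ := fun r ξ => slabKernel j ρ σ z r ξ - slabKernel j ρ σ z' r ξ
  set W := (‖z - z'‖ * ((1 + |(m : ℝ)|) * (1 + |(n : ℝ)|))) ^ ε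
  have hint : ∀ (r : ℝ) {z : ℂ}, Transversal σ ρ d z →
      Integrable fun ξ => slabKernel j ρ σ z r ξ * P ξ := fun r z hz => by
    obtain ⟨hm, B, hB⟩ := hz.bddMeas_slabKernel (j := j) hσ hd hρ r
    exact hP.bdd_mul hm.aestronglyMeasurable (Eventually.of_forall hB)
  have hsub : ∀ r, (∫ ξ, slabKernel j ρ σ z r ξ * P ξ) - ∫ ξ, slabKernel j ρ σ z' r ξ * P ξ =
      ∫ ξ, D r ξ * P ξ := fun r => by
    rw [← integral_sub (hint r hz) (hint r hz')]
    simp only [D, sub_mul]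
  have e : inner ℂ h (fm (slab j ρ z - slab j ρ z') f) = ∫ r, ∫ ξ, D r ξ * P ξ := by
    obtain ⟨i1, h1⟩ := hz.integral_slab_mul (j := j) hσ hd hρ hP
    obtain ⟨i2, h2⟩ := hz'.integral_slab_mul (j := j) hσ hd hρ hP
    rw [fm_sub (bddMeas_slab (hi hz)) (bddMeas_slab (hi hz')), sub_apply,
      inner_sub_right, inner_fm_eq_integral (bddMeas_slab (hi hz)),
      inner_fm_eq_integral (bddMeas_slab (hi hz'))]
    simp_rw [← hsub]
    rw [integral_sub i1 i2, ← h1, ← h2]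
  -- The only translations linking the two cells. The length 3 of this interval is the leading
  -- factor of the constant, and 3^ε comes from 1 + |r| ≤ 3(1 + |m|)(1 + |n|) on it.
  set S : Set ℝ := Set.Icc ((m - n : ℝ) - 3 / 2) ((m - n : ℝ) + 3 / 2) with hS
  have hzero : ∀ r, r ∉ S → ∫ ξ, D r ξ * P ξ = 0 := fun r hr => by
    have hr' : 3 / 2 ≤ |r - (m - n)| := by
      by_contra! hlt
      obtain ⟨h1, h2⟩ := abs_lt.1 hlt
      exact hr ⟨by linarith, by linarith⟩
    rw [← hsub, hz.inner_slabKernel_eq_zero hσ hd hρ hf hh hr',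
      hz'.inner_slabKernel_eq_zero hσ hd hρ hf hh hr', sub_zero]
  have hbound : ∀ r ∈ S, ‖∫ ξ, D r ξ * P ξ‖ ≤ C * 3 ^ ε * W * (‖f‖ * ‖h‖) := fun r hr => by
    have hr1 : 1 + |r| ≤ 3 * ((1 + |(m : ℝ)|) * (1 + |(n : ℝ)|)) := by
      have h1 : |r| ≤ |(m : ℝ)| + |(n : ℝ)| + 3 / 2 := by
        rw [abs_le]
        have := abs_le.1 (le_refl |(m : ℝ)|)
        have := abs_le.1 (le_refl |(n : ℝ)|)
        constructor <;> linarith [hr.1, hr.2]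
      nlinarith [abs_nonneg (m : ℝ), abs_nonneg (n : ℝ),
        mul_nonneg (abs_nonneg (m : ℝ)) (abs_nonneg (n : ℝ))]
    have hD : ∀ ξ, ‖D r ξ‖ ≤ C * 3 ^ ε * W := fun ξ => by
      have hW : (‖z - z'‖ * (1 + |r|)) ^ ε ≤ 3 ^ ε * W := by
        rw [← Real.mul_rpow (by norm_num) (by positivity)]
        refine Real.rpow_le_rpow (by positivity) ?_ hε
        nlinarith [norm_nonneg (z - z')]
      simp only [D, slabKernel]
      split_ifs with hξ
      · rw [← sub_mul, norm_mul, Circle.norm_coe, mul_one]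
        refine (hk σ hσ _ _ (hz.re_sub hξ) (hz'.re_sub hξ) (hz.im_sub ξ) (hz'.im_sub ξ) r).trans ?_
        rw [sub_sub_sub_cancel_right, mul_assoc]
        exact mul_le_mul_of_nonneg_left hW hC
      · rw [sub_zero, norm_zero]; positivity
    refine (norm_integral_le_of_norm_le (hP.norm.const_mul (C * 3 ^ ε * W))
      (Eventually.of_forall fun ξ => ?_)).trans ?_
    · rw [norm_mul]
      exact mul_le_mul_of_nonneg_right (hD ξ) (norm_nonneg _)
    · rw [integral_const_mul]
      exact mul_le_mul_of_nonneg_left hPn (by positivity)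
  rw [e, ← setIntegral_eq_integral_of_forall_compl_eq_zero hzero]
  refine (norm_setIntegral_le_of_norm_le_const (by simp [hS]) hbound).trans_eq ?_
  have hv : volume.real S = 3 := by
    rw [hS, Real.volume_real_Icc]
    norm_num
  rw [hv]
  ring

/-! ### Summation over slabs -/

/-- The indicator function of the slab `n ≤ x_j < n + 1`. -/
def cellInd (j : Fin 3) (n : ℤ) (x : E3) : ℂ := if ⌊x j⌋ = n then 1 else 0

/-- The indicator function of the slab `-N ≤ x_j < N`. -/
def wideInd (j : Fin 3) (N : ℕ) (x : E3) : ℂ := if ⌊x j⌋ ∈ Finset.Ico (-(N : ℤ)) N then 1 else 0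

theorem measurable_floor_coord (j : Fin 3) : Measurable fun x : E3 => ⌊x j⌋ :=
  Int.measurable_floor.comp (by fun_prop)

theorem bddMeas_cellInd (j : Fin 3) (n : ℤ) : BddMeas (cellInd j n) := by
  refine ⟨Measurable.ite (measurable_floor_coord j (measurableSet_singleton n)) measurable_const
    measurable_const, 1, fun x => ?_⟩
  rw [cellInd]
  split_ifs <;> simp

theorem bddMeas_wideInd (j : Fin 3) (N : ℕ) : BddMeas (wideInd j N) := by
  refine ⟨Measurable.ite (measurable_floor_coord j
    (Finset.measurableSet (Finset.Ico (-(N : ℤ)) N))) measurable_const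
    measurable_const, 1, fun x => ?_⟩
  rw [wideInd]
  split_ifs <;> simp

theorem mulL_wideInd (j : Fin 3) (N : ℕ) (f : L2) :
    mulL (wideInd j N) f = ∑ n ∈ Finset.Ico (-(N : ℤ)) N, mulL (cellInd j n) f := by
  have key : ∀ S : Finset ℤ, BddMeas (∑ n ∈ S, cellInd j n) ∧
      mulL (∑ n ∈ S, cellInd j n) = ∑ n ∈ S, mulL (cellInd j n) := fun S => by
    induction S using Finset.induction_on with
    | empty =>
      have h0 : BddMeas (0 : E3 → ℂ) := .const 0
      refine ⟨by simpa using h0, ?_⟩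
      rw [Finset.sum_empty, Finset.sum_empty]
      have := mulL_sub h0 h0
      rwa [sub_self, sub_self] at this
    | insert a S ha ih =>
      rw [Finset.sum_insert ha, Finset.sum_insert ha]
      exact ⟨(bddMeas_cellInd j a).add ih.1, by rw [mulL_add (bddMeas_cellInd j a) ih.1, ih.2]⟩
  have e : wideInd j N = ∑ n ∈ Finset.Ico (-(N : ℤ)) N, cellInd j n := by
    funext x
    rw [Finset.sum_apply]
    simp only [wideInd, cellInd]
    rw [Finset.sum_ite_eq]
  rw [e, (key _).2, sum_apply]

/-- Bessel's inequality for the projections onto disjoint cells: ‖Pf‖² = ⟨f, Pf⟩ for each, and their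
sum is again multiplication by an indicator. -/
theorem sum_norm_sq_cell_le (j : Fin 3) (S : Finset ℤ) (N : ℕ)
    (hS : S = Finset.Ico (-(N : ℤ)) N) (f : L2) :
    ∑ n ∈ S, ‖mulL (cellInd j n) f‖ ^ 2 ≤ ‖f‖ ^ 2 := by
  have h1 : ∀ n, ‖mulL (cellInd j n) f‖ ^ 2 = RCLike.re (inner ℂ f (mulL (cellInd j n) f)) := by
    intro n
    rw [norm_sq_eq_re_inner (𝕜 := ℂ), inner_mulL_left (bddMeas_cellInd j n),
      mulL_mulL (bddMeas_cellInd j n).conj (bddMeas_cellInd j n)]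
    congr 4
    funext x
    simp only [Pi.mul_apply, cellInd]
    split_ifs <;> simp
  simp_rw [h1]
  rw [← map_sum, ← inner_sum, hS, ← mulL_wideInd]
  refine (RCLike.re_le_norm _).trans ((norm_inner_le_norm _ _).trans ?_)
  rw [pow_two]
  refine mul_le_mul_of_nonneg_left ?_ (norm_nonneg _)
  refine ((mulL (wideInd j N)).le_of_opNorm_le
    (norm_mulL_le (bddMeas_wideInd j N).1 (C := 1) fun x => ?_) f).trans_eq (one_mul _)
  rw [wideInd]
  split_ifs <;> simp

theorem inCell_mulL {j : Fin 3} {n : ℤ} {f : L2} (hf : InCell j n f) {a : E3 → ℂ}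
    (ha : BddMeas a) : InCell j n (mulL a f) := by
  filter_upwards [hf, mulL_coeFn ha f] with x h1 h2 h3
  rw [h2] at h3
  exact h1 (right_ne_zero_of_mul h3)

theorem inCell_cellInd (j : Fin 3) (n : ℤ) (f : L2) : InCell j n (mulL (cellInd j n) f) := by
  filter_upwards [mulL_coeFn (bddMeas_cellInd j n) f] with x h1 h2
  rw [h1] at h2
  have h3 : ⌊x j⌋ = n := by
    by_contra h
    simp [cellInd, h] at h2
  rw [← h3]
  exact ⟨Int.floor_le _, (Int.lt_floor_add_one _).le⟩

theorem sq_coord_le (x : E3) (j : Fin 3) : x j ^ 2 ≤ ‖x‖ ^ 2 := by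
  rw [← sq_abs (x j)]
  have := PiLp.norm_apply_le x j
  gcongr
  exact this

/-- The weight sequence which controls the Hölder bound for the resolvent. -/
def cellWeight (s ε : ℝ) (n : ℤ) : ℝ :=
  (1 + |(n : ℝ)|) ^ ε * (3 ^ (s / 2) * (1 + (n : ℝ) ^ 2) ^ (-s / 2))

theorem cellWeight_nonneg (s ε : ℝ) (n : ℤ) : 0 ≤ cellWeight s ε n := by
  unfold cellWeight
  positivity

/-- On the cell |x| ≥ |x_j| ≥ |n| - 1, hence 1 + n² ≤ 3(1 + |x|²): one coordinate already controls
the weight. -/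
theorem norm_japanese_cell_le {s : ℝ} (hs : 0 ≤ s) {j : Fin 3} {n : ℤ} {f : L2}
    (hf : InCell j n f) (ε : ℝ) :
    (1 + |(n : ℝ)|) ^ ε * ‖mulL (japanese (-s)) f‖ ≤ cellWeight s ε n * ‖f‖ := by
  rw [cellWeight, mul_assoc]
  refine mul_le_mul_of_nonneg_left ?_ (by positivity)
  refine Lp.norm_le_mul_norm_of_ae_le_mul ?_
  filter_upwards [mulL_coeFn (bddMeas_japanese_neg hs) f, hf] with x h1 h2
  rw [h1, norm_mul]
  by_cases h0 : f x = 0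
  · simp [h0]
  refine mul_le_mul_of_nonneg_right ?_ (norm_nonneg _)
  obtain ⟨h3, h4⟩ := h2 h0
  have h5 : 1 + (n : ℝ) ^ 2 ≤ 3 * (1 + ‖x‖ ^ 2) := by
    have := sq_coord_le x j
    nlinarith [mul_nonneg (sub_nonneg.2 h3) (sub_nonneg.2 h4), sq_nonneg (x j - 1),
      sq_nonneg (x j + 1), sq_nonneg (2 * x j - n)]
  rw [norm_japanese, neg_div, Real.rpow_neg (by positivity), Real.rpow_neg (by positivity),
    ← div_eq_mul_inv, inv_eq_one_div, div_le_div_iff₀ (by positivity) (by positivity), one_mul,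
    ← Real.mul_rpow (by norm_num) (by positivity)]
  exact Real.rpow_le_rpow (by positivity) h5 (by positivity)

/-- The terms are of order |n|^(-2(s - ε)) with exponent 2(s - ε) > 1. This is where the threshold s
> 1/2 enters. -/
theorem summable_cellWeight_sq {s ε : ℝ} (hε : 0 ≤ ε) (h : 1 / 2 < s - ε) :
    Summable fun n => cellWeight s ε n ^ 2 := by
  have hb := (Real.summable_abs_int_rpow (b := 2 * (s - ε)) (by linarith)).mul_left (3 ^ s * 2 ^ ε)
  refine Summable.of_norm_bounded_eventually hb ?_
  -- At n = 0 the majorant |n|^(-2(s - ε)) is 0 by convention, so that term must be left out of the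
  -- comparison.
  have h0 : ∀ᶠ n : ℤ in cofinite, n ≠ 0 := by
    simpa using (Set.finite_singleton (0 : ℤ)).compl_mem_cofinite
  filter_upwards [h0] with n hn
  have hn' : 0 < |(n : ℝ)| := abs_pos.2 (Int.cast_ne_zero.2 hn)
  rw [Real.norm_of_nonneg (sq_nonneg _), cellWeight, mul_pow, mul_pow,
    ← Real.rpow_mul_natCast (by positivity), ← Real.rpow_mul_natCast (by positivity),
    ← Real.rpow_mul_natCast (by positivity)]
  have e1 : s / 2 * ((2 : ℕ) : ℝ) = s := by push_cast; ring
  have e2 : -s / 2 * ((2 : ℕ) : ℝ) = -s := by push_cast; ring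
  have e3 : ε * ((2 : ℕ) : ℝ) = 2 * ε := by push_cast; ring
  rw [e1, e2, e3]
  have h1 : (1 + |(n : ℝ)|) ^ (2 * ε) ≤ 2 ^ ε * (1 + (n : ℝ) ^ 2) ^ ε := by
    rw [Real.rpow_mul (by positivity), ← Real.mul_rpow (by norm_num) (by positivity)]
    refine Real.rpow_le_rpow (by positivity) ?_ hε
    rw [Real.rpow_two, ← sq_abs (n : ℝ)]
    nlinarith [sq_nonneg (|(n : ℝ)| - 1)]
  have h2 : (1 + (n : ℝ) ^ 2) ^ (-(s - ε)) ≤ |(n : ℝ)| ^ (-(2 * (s - ε))) := by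
    rw [← mul_neg, Real.rpow_mul hn'.le, Real.rpow_two]
    refine Real.rpow_le_rpow_of_nonpos (by positivity) ?_ (by linarith)
    rw [sq_abs]
    linarith
  calc (1 + |(n : ℝ)|) ^ (2 * ε) * (3 ^ s * (1 + (n : ℝ) ^ 2) ^ (-s))
      ≤ 2 ^ ε * (1 + (n : ℝ) ^ 2) ^ ε * (3 ^ s * (1 + (n : ℝ) ^ 2) ^ (-s)) := by gcongr
    _ = 3 ^ s * 2 ^ ε * (1 + (n : ℝ) ^ 2) ^ (-(s - ε)) := by
      rw [show -(s - ε) = ε + -s by ring, Real.rpow_add (by positivity)]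
      ring
    _ ≤ _ := by gcongr

/-- Sandwich an operator on `L²` between weights `⟨x⟩⁻ˢ`. -/
def sandwich (s : ℝ) (M : L2 →L[ℂ] L2) : L2 →L[ℂ] L2 :=
  mulL (japanese (-s)) ∘L M ∘L mulL (japanese (-s))

theorem sandwich_sub (s : ℝ) (M M' : L2 →L[ℂ] L2) :
    sandwich s (M - M') = sandwich s M - sandwich s M' := by
  ext1 f
  simp [sandwich]

theorem inner_mulL_real {a : E3 → ℂ} (ha : BddMeas a) (hr : ∀ x, (starRingEnd ℂ) (a x) = a x)
    (f g : L2) : inner ℂ (mulL a f) g = inner ℂ f (mulL a g) := by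
  rw [inner_mulL_left ha]
  congr 3
  exact funext hr

theorem conj_japanese (s : ℝ) (x : E3) : (starRingEnd ℂ) (japanese s x) = japanese s x := by
  rw [japanese, Complex.conj_ofReal]

theorem conj_wideInd (j : Fin 3) (N : ℕ) (x : E3) :
    (starRingEnd ℂ) (wideInd j N x) = wideInd j N x := by
  rw [wideInd]
  split_ifs <;> simp

theorem norm_one_sub_wideInd_le {s : ℝ} (hs : 0 ≤ s) (j : Fin 3) (N : ℕ) :
    ‖mulL (japanese (-s)) - mulL (wideInd j N) ∘L mulL (japanese (-s))‖ ≤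
      (1 + (N : ℝ) ^ 2) ^ (-(s / 2)) := by
  have hJ := bddMeas_japanese_neg hs
  have hw := bddMeas_wideInd j N
  have e : mulL (japanese (-s)) - mulL (wideInd j N) ∘L mulL (japanese (-s)) =
      mulL (japanese (-s) - wideInd j N * japanese (-s)) := by
    ext1 f
    rw [mulL_sub hJ (hw.mul hJ), sub_apply, sub_apply, ContinuousLinearMap.comp_apply,
      mulL_mulL hw hJ]
  rw [e]
  refine norm_mulL_le (hJ.sub (hw.mul hJ)).1 fun x => ?_
  simp only [Pi.sub_apply, Pi.mul_apply, wideInd]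
  split_ifs with h
  · simp only [one_mul, sub_self, norm_zero]
    positivity
  · rw [zero_mul, sub_zero, norm_japanese, neg_div]
    refine Real.rpow_le_rpow_of_nonpos (by positivity) ?_ (by linarith)
    have := sq_coord_le x j
    have hN : (N : ℝ) ^ 2 ≤ x j ^ 2 := by
      rw [Finset.mem_Ico, not_and_or, not_le, not_lt] at h
      rcases h with h | h
      · have h1 : x j < ((-(N : ℤ) : ℤ) : ℝ) := Int.floor_lt.1 h
        push_cast at h1
        nlinarith [Nat.cast_nonneg (α := ℝ) N]
      · have h1 : (((N : ℤ) : ℤ) : ℝ) ≤ x j := Int.le_floor.1 h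
        push_cast at h1
        nlinarith [Nat.cast_nonneg (α := ℝ) N]
    linarith

/-- The weight ⟨x⟩⁻ˢ is approximated in norm by its restriction to |x_j| below N, so for a fixed
bounded M the truncation error is at most 2‖M‖(1 + N²)^(-s/2) and disappears as N → ∞. Only finite
sums of cells are then needed. -/
theorem norm_sandwich_le {s : ℝ} (hs : 0 < s) (j : Fin 3) (M : L2 →L[ℂ] L2) {K : ℝ}
    (h : ∀ (N : ℕ) (f g : L2), ‖inner ℂ (mulL (wideInd j N) g)
      (sandwich s M (mulL (wideInd j N) f))‖ ≤ K * (‖f‖ * ‖g‖)) :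
    ‖sandwich s M‖ ≤ ‖K‖ := by
  set J := mulL (japanese (-s))
  have hJ := bddMeas_japanese_neg hs.le
  have hJ1 : ‖J‖ ≤ 1 := norm_mulL_le hJ.1 (norm_japanese_neg_le hs.le)
  have hlim : Tendsto (fun N : ℕ => ‖K‖ + 2 * ‖M‖ * (1 + (N : ℝ) ^ 2) ^ (-(s / 2))) atTop
      (𝓝 (‖K‖ + 2 * ‖M‖ * 0)) := by
    refine tendsto_const_nhds.add (tendsto_const_nhds.mul ?_)
    refine (tendsto_rpow_neg_atTop (y := s / 2) (by positivity)).comp ?_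
    refine tendsto_atTop_mono (fun N => ?_) (tendsto_natCast_atTop_atTop (R := ℝ))
    nlinarith [sq_nonneg ((N : ℝ) - 1)]
  rw [mul_zero, add_zero] at hlim
  refine ge_of_tendsto' hlim fun N => ?_
  set W := mulL (wideInd j N)
  set η := (1 + (N : ℝ) ^ 2) ^ (-(s / 2))
  have hη : ‖J - W ∘L J‖ ≤ η := norm_one_sub_wideInd_le hs.le j N
  have hW := bddMeas_wideInd j N
  have hcomm : ∀ f, W (J f) = J (W f) := fun f => by
    simp only [W, J]
    rw [mulL_mulL hW hJ, mulL_mulL hJ hW, mul_comm]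
  have hη' : ∀ f, ‖J f - W (J f)‖ ≤ η * ‖f‖ := fun f => (J - W ∘L J).le_of_opNorm_le hη f
  have hW1 : ∀ f, ‖W f‖ ≤ ‖f‖ := fun f => by
    refine (W.le_of_opNorm_le (norm_mulL_le hW.1 (C := 1) fun x => ?_) f).trans_eq (one_mul _)
    rw [wideInd]
    split_ifs <;> simp
  have hη0 : 0 ≤ η := by positivity
  have hJf : ∀ f, ‖J f‖ ≤ ‖f‖ := fun f => (J.le_of_opNorm_le hJ1 f).trans_eq (one_mul _)
  refine ContinuousLinearMap.opNorm_le_bound _ (by positivity) fun f => ?_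
  have hmid : ‖W (sandwich s M (W f))‖ ≤ ‖K‖ * ‖f‖ := by
    set u := W (sandwich s M (W f)) with hu
    have h1 := h N f u
    rw [inner_mulL_real hW (conj_wideInd j N)] at h1
    change ‖inner ℂ u u‖ ≤ _ at h1
    rw [← inner_self_re_eq_norm, ← norm_sq_eq_re_inner, pow_two, ← mul_assoc] at h1
    by_cases h0 : ‖u‖ = 0
    · rw [h0]; positivity
    · refine (le_of_mul_le_mul_right h1 (lt_of_le_of_ne (norm_nonneg _) (Ne.symm h0))).trans ?_
      exact mul_le_mul_of_nonneg_right (Real.le_norm_self K) (norm_nonneg _)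
  have e : sandwich s M f = (J (M (J f)) - W (J (M (J f)))) + W (J (M (J f - W (J f)))) +
      W (sandwich s M (W f)) := by
    simp only [sandwich, ContinuousLinearMap.comp_apply, map_sub]
    change J (M (J f)) = J (M (J f)) - W (J (M (J f))) + (W (J (M (J f))) - W (J (M (W (J f))))) +
      W (J (M (J (W f))))
    rw [hcomm f]
    abel
  rw [e]
  have b1 : ‖J (M (J f)) - W (J (M (J f)))‖ ≤ η * (‖M‖ * ‖f‖) :=
    (hη' _).trans (mul_le_mul_of_nonneg_left ((M.le_opNorm _).trans
      (mul_le_mul_of_nonneg_left (hJf f) (norm_nonneg _))) hη0)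
  have b2 : ‖W (J (M (J f - W (J f))))‖ ≤ ‖M‖ * (η * ‖f‖) :=
    (hW1 _).trans ((hJf _).trans ((M.le_opNorm _).trans
      (mul_le_mul_of_nonneg_left (hη' f) (norm_nonneg _))))
  refine (norm_add₃_le).trans ((add_le_add (add_le_add b1 b2) hmid).trans_eq ?_)
  ring

/-- The weighted resolvent on a slab of frequencies is Hölder continuous in operator norm, up to
the real axis. -/
theorem exists_slab_holder {s : ℝ} (hs : 1 / 2 < s) {ρ d : ℝ} (hd : 0 < d) (hρ : 0 ≤ ρ) :
    ∃ ε C : ℝ, 0 < ε ∧ ∀ (j : Fin 3) (σ : ℝ), σ ^ 2 = 1 → ∀ z z' : ℂ,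
      Transversal σ ρ d z → Transversal σ ρ d z' →
        ‖sandwich s (fm (slab j ρ z - slab j ρ z'))‖ ≤ C * ‖z - z'‖ ^ ε := by
  -- Half of the room above 1/2 is spent on Hölder continuity, the other half on summability; ε ≤ 1
  -- is needed for the interpolation.
  set ε := min 1 ((s - 1 / 2) / 2)
  have hε : 0 < ε := lt_min one_pos (by linarith)
  have hε1 : ε ≤ 1 := min_le_left _ _
  have hsε : 1 / 2 < s - ε := by
    have : ε ≤ (s - 1 / 2) / 2 := min_le_right _ _
    linarith
  have hs0 : 0 < s := by linarith
  obtain ⟨C, hC, hcell⟩ := exists_cell_bound hd hρ hε.le hε1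
  have hsum := summable_cellWeight_sq hε.le hsε
  set S := ∑' n, cellWeight s ε n ^ 2
  have hS : 0 ≤ S := tsum_nonneg fun n => sq_nonneg _
  refine ⟨ε, C * S, hε, fun j σ hσ z z' hz hz' => ?_⟩
  have hJ := bddMeas_japanese_neg hs0.le
  refine (norm_sandwich_le hs0 j _ (K := C * S * ‖z - z'‖ ^ ε) fun N f g => ?_).trans_eq
    (Real.norm_of_nonneg (by positivity))
  -- The bound for a pair of cells factorises, so one Cauchy–Schwarz inequality in each index, with
  -- a constant independent of N, sums the double series.
  have hcs : ∀ f : L2, ∑ n ∈ Finset.Ico (-(N : ℤ)) N, cellWeight s ε n * ‖mulL (cellInd j n) f‖ ≤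
      √S * ‖f‖ := fun f => by
    refine (Real.sum_mul_le_sqrt_mul_sqrt _ _ _).trans ?_
    refine mul_le_mul (Real.sqrt_le_sqrt (hsum.sum_le_tsum _ fun n _ => sq_nonneg _)) ?_
      (Real.sqrt_nonneg _) (Real.sqrt_nonneg _)
    exact Real.sqrt_le_iff.2 ⟨norm_nonneg _, sum_norm_sq_cell_le j _ N rfl f⟩
  rw [mulL_wideInd, mulL_wideInd, map_sum, sum_inner]
  simp_rw [inner_sum]
  have hterm : ∀ m n : ℤ, ‖inner ℂ (mulL (cellInd j m) g)
      (sandwich s (fm (slab j ρ z - slab j ρ z')) (mulL (cellInd j n) f))‖ ≤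
      C * ‖z - z'‖ ^ ε * ((cellWeight s ε m * ‖mulL (cellInd j m) g‖) *
        (cellWeight s ε n * ‖mulL (cellInd j n) f‖)) := fun m n => by
    have hg := inCell_cellInd j m g
    have hf := inCell_cellInd j n f
    simp only [sandwich, ContinuousLinearMap.comp_apply]
    rw [← inner_mulL_real hJ (conj_japanese _)]
    refine (hcell j σ hσ z z' hz hz' m n _ _ (inCell_mulL hf hJ) (inCell_mulL hg hJ)).trans ?_
    have h1 := norm_japanese_cell_le hs0.le hg ε
    have h2 := norm_japanese_cell_le hs0.le hf ε
    rw [Real.mul_rpow (norm_nonneg _) (by positivity),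
      Real.mul_rpow (by positivity) (by positivity)]
    calc C * (‖z - z'‖ ^ ε * ((1 + |(m : ℝ)|) ^ ε * (1 + |(n : ℝ)|) ^ ε)) *
          (‖mulL (japanese (-s)) (mulL (cellInd j n) f)‖ *
            ‖mulL (japanese (-s)) (mulL (cellInd j m) g)‖)
        = C * ‖z - z'‖ ^ ε *
          (((1 + |(m : ℝ)|) ^ ε * ‖mulL (japanese (-s)) (mulL (cellInd j m) g)‖) *
          ((1 + |(n : ℝ)|) ^ ε * ‖mulL (japanese (-s)) (mulL (cellInd j n) f)‖)) := by ring
      _ ≤ _ := by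
        gcongr
        exact mul_nonneg (cellWeight_nonneg s ε m) (norm_nonneg _)
  refine (norm_sum_le _ _).trans ((Finset.sum_le_sum fun m _ => (norm_sum_le _ _).trans
    (Finset.sum_le_sum fun n _ => hterm m n)).trans ?_)
  simp_rw [← Finset.mul_sum, ← Finset.sum_mul]
  have h0 : ∀ f : L2, 0 ≤ ∑ n ∈ Finset.Ico (-(N : ℤ)) N,
      cellWeight s ε n * ‖mulL (cellInd j n) f‖ := fun f =>
    Finset.sum_nonneg fun n _ => mul_nonneg (cellWeight_nonneg s ε n) (norm_nonneg _)
  calc _ ≤ C * ‖z - z'‖ ^ ε * ((√S * ‖g‖) * (√S * ‖f‖)) := by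
        refine mul_le_mul_of_nonneg_left ?_ (by positivity)
        exact mul_le_mul (hcs g) (hcs f) (h0 f) (by positivity)
    _ = C * (√S * √S) * ‖z - z'‖ ^ ε * (‖f‖ * ‖g‖) := by ring
    _ = _ := by rw [Real.mul_self_sqrt hS]

/-- The open half-plane `σ Im z > 0`. -/
def openHalf (σ : ℝ) : Set ℂ := {z | 0 < σ * z.im}

theorem extendedHalfPlane_subset_closure {σ : ℝ} (hσ : σ ^ 2 = 1) :
    extendedHalfPlane σ ⊆ closure (openHalf σ) := by
  intro z hz
  have hlim : Tendsto (fun μ : ℝ => z + (σ * μ : ℝ) * Complex.I) (𝓝[>] 0) (𝓝 z) := by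
    have : Continuous fun μ : ℝ => z + (σ * μ : ℝ) * Complex.I := by fun_prop
    simpa using (this.tendsto 0).mono_left nhdsWithin_le_nhds
  refine mem_closure_of_tendsto hlim ?_
  filter_upwards [self_mem_nhdsWithin] with μ hμ
  have h1 : 0 ≤ σ * z.im := by
    rcases hz with h | h
    · exact h.le
    · simp [h.1]
  have h2 : (0 : ℝ) < μ := hμ
  simp only [openHalf, Set.mem_ofPred_eq, Complex.add_im, Complex.mul_im, Complex.ofReal_re,
    Complex.I_im, Complex.ofReal_im, Complex.I_re, mul_one, mul_zero, add_zero]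
  nlinarith

theorem exists_tendsto_of_holder {β : Type*} [NormedAddCommGroup β] [CompleteSpace β]
    {l : Filter ℂ} [l.NeBot] {t : ℂ} (hl : l ≤ 𝓝 t) {F : ℂ → β} {ε C : ℝ} (hε : 0 < ε) {U : Set ℂ}
    (hU : U ∈ l) (h : ∀ z ∈ U, ∀ z' ∈ U, ‖F z - F z'‖ ≤ C * ‖z - z'‖ ^ ε) :
    ∃ L, Tendsto F l (𝓝 L) := by
  rw [← cauchy_map_iff_exists_tendsto, cauchy_map_iff']
  rw [tendsto_uniformity_iff_dist_tendsto_zero]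
  have hlim : Tendsto (fun p : ℂ × ℂ => C * ‖p.1 - p.2‖ ^ ε) (l ×ˢ l) (𝓝 0) := by
    have h1 : Tendsto (fun p : ℂ × ℂ => p.1 - p.2) (l ×ˢ l) (𝓝 (t - t)) :=
      (tendsto_fst.mono_right hl).sub (tendsto_snd.mono_right hl)
    have h2 := (h1.norm.rpow_const (p := ε) (Or.inr hε.le)).const_mul C
    simpa [Real.zero_rpow hε.ne'] using h2
  refine squeeze_zero' (Eventually.of_forall fun p => dist_nonneg) ?_ hlim
  filter_upwards [prod_mem_prod hU hU] with p hp
  rw [dist_eq_norm]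
  exact h _ hp.1 _ hp.2

theorem exists_tendsto_slab {s : ℝ} (hs : 1 / 2 < s) {ρ t : ℝ} (hρ : 0 ≤ ρ) (ht : ρ < t)
    (j : Fin 3) {σ : ℝ} (hσ : σ ^ 2 = 1) :
    ∃ L, Tendsto (fun z => sandwich s (fm (slab j ρ z))) (𝓝[openHalf σ] (t : ℂ)) (𝓝 L) := by
  -- Half of the gap t - ρ serves as transversality; the other half leaves a neighbourhood of t for
  -- z.
  obtain ⟨ε, C, hε, h⟩ := exists_slab_holder hs (d := (t - ρ) / 2) (by linarith) hρ
  have : (𝓝[openHalf σ] (t : ℂ)).NeBot := mem_closure_iff_nhdsWithin_neBot.1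
    (extendedHalfPlane_subset_closure hσ (Or.inr ⟨Complex.ofReal_im t, by simp; linarith⟩))
  have hU : {z : ℂ | Transversal σ ρ ((t - ρ) / 2) z} ∈ 𝓝[openHalf σ] (t : ℂ) := by
    have h1 : ∀ᶠ z : ℂ in 𝓝 (t : ℂ), ρ + (t - ρ) / 2 < z.re :=
      Complex.continuous_re.continuousAt.eventually (lt_mem_nhds (by simp; linarith))
    filter_upwards [self_mem_nhdsWithin, h1.filter_mono nhdsWithin_le_nhds] with z h2 h3
    exact ⟨h3.le, h2⟩
  refine exists_tendsto_of_holder (C := C) nhdsWithin_le_nhds hε hU fun z hz z' hz' => ?_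
  have hi : ∀ {z : ℂ}, Transversal σ ρ ((t - ρ) / 2) z → z.im ≠ 0 := fun hz h0 => by
    have := hz.2; simp [h0] at this
  rw [← sandwich_sub, ← fm_sub (bddMeas_slab (hi hz)) (bddMeas_slab (hi hz'))]
  exact h j σ hσ z z' hz hz'

/-! ### Boundary values of localized resolvents -/

theorem sandwich_add (s : ℝ) (M M' : L2 →L[ℂ] L2) :
    sandwich s (M + M') = sandwich s M + sandwich s M' := by
  ext1 f
  simp [sandwich]

theorem sandwich_smul (s : ℝ) (c : ℂ) (M : L2 →L[ℂ] L2) :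
    sandwich s (c • M) = c • sandwich s M := by
  ext1 f
  simp [sandwich]

theorem continuous_sandwich (s : ℝ) : Continuous (sandwich s) := by
  unfold sandwich
  fun_prop

/-- The symbol `n / (p - z)`. -/
def quot (n : E3 → ℂ) (p : E3 → ℝ) (z : ℂ) (ξ : E3) : ℂ := n ξ / ((p ξ : ℂ) - z)

theorem measurable_quot {n : E3 → ℂ} {p : E3 → ℝ} (hn : Measurable n) (hp : Measurable p) (z : ℂ) :
    Measurable (quot n p z) :=
  hn.div ((Complex.measurable_ofReal.comp hp).sub measurable_const)

theorem bddMeas_quot_of_le {n : E3 → ℂ} {p : E3 → ℝ} (hn : Measurable n) (hp : Measurable p)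
    {z : ℂ} {C : ℝ} (hC : 0 ≤ C) (h : ∀ ξ, ‖n ξ‖ ≤ C * ‖(p ξ : ℂ) - z‖) :
    BddMeas (quot n p z) := by
  refine ⟨measurable_quot hn hp z, C, fun ξ => ?_⟩
  rw [quot, norm_div]
  exact div_le_of_le_mul₀ (norm_nonneg _) hC (h ξ)

theorem abs_im_le_norm_sub (p : ℝ) (z : ℂ) : |z.im| ≤ ‖(p : ℂ) - z‖ := by
  have := Complex.abs_im_le_norm ((p : ℂ) - z)
  rwa [Complex.sub_im, Complex.ofReal_im, zero_sub, abs_neg] at this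

theorem sub_ne_zero_of_im {z : ℂ} (hz : z.im ≠ 0) (p : ℝ) : (p : ℂ) - z ≠ 0 :=
  norm_pos_iff.1 ((abs_pos.2 hz).trans_le (abs_im_le_norm_sub p z))

theorem bddMeas_quot {n : E3 → ℂ} {p : E3 → ℝ} (hn : BddMeas n) (hp : Measurable p)
    {z : ℂ} (hz : z.im ≠ 0) : BddMeas (quot n p z) := by
  obtain ⟨hm, C, hC⟩ := hn
  have hC0 : 0 ≤ C := (norm_nonneg _).trans (hC 0)
  have hz' := abs_pos.2 hz
  refine bddMeas_quot_of_le hm hp (C := C / |z.im|) (by positivity) fun ξ => (hC ξ).trans ?_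
  rw [div_mul_eq_mul_div, le_div_iff₀ hz']
  exact mul_le_mul_of_nonneg_left (abs_im_le_norm_sub _ _) hC0

/-- Away from the singularities, the multiplier with symbol `n / (p - z)` is norm continuous. -/
theorem continuousAt_fm_quot {n : E3 → ℂ} {p : E3 → ℝ} (hn : Measurable n) (hp : Measurable p)
    {z₀ : ℂ} {c C : ℝ} (hc : 0 < c) (hC : 0 ≤ C)
    (h : ∀ ξ, n ξ ≠ 0 → c ≤ ‖(p ξ : ℂ) - z₀‖ ∧ ‖n ξ‖ ≤ C * ‖(p ξ : ℂ) - z₀‖) :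
    ContinuousAt (fun z => fm (quot n p z)) z₀ := by
  have hhalf : ∀ z, ‖z - z₀‖ ≤ c / 2 → ∀ ξ, n ξ ≠ 0 → ‖(p ξ : ℂ) - z₀‖ ≤ 2 * ‖(p ξ : ℂ) - z‖ :=
    fun z hz ξ h0 => by
      have h1 := norm_add_le ((p ξ : ℂ) - z) (z - z₀)
      rw [sub_add_sub_cancel] at h1
      linarith [(h ξ h0).1]
  have hb : ∀ z, ‖z - z₀‖ ≤ c / 2 → BddMeas (quot n p z) := fun z hz => by
    refine bddMeas_quot_of_le hn hp (C := C * 2) (by positivity) fun ξ => ?_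
    by_cases h0 : n ξ = 0
    · rw [h0, norm_zero]; positivity
    · rw [mul_assoc]
      exact (h ξ h0).2.trans (mul_le_mul_of_nonneg_left (hhalf z hz ξ h0) hC)
  have hb0 := hb z₀ (by rw [sub_self, norm_zero]; positivity)
  have hdiff : ∀ z, ‖z - z₀‖ ≤ c / 2 →
      ‖fm (quot n p z) - fm (quot n p z₀)‖ ≤ C * (2 / c) * ‖z - z₀‖ := fun z hz => by
    rw [← fm_sub (hb z hz) hb0]
    refine norm_fm_le ((hb z hz).sub hb0).1 fun ξ => ?_
    simp only [Pi.sub_apply, quot]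
    by_cases h0 : n ξ = 0
    · simp only [h0, zero_div, sub_self, norm_zero]; positivity
    obtain ⟨h1, h2⟩ := h ξ h0
    have h3 := hhalf z hz ξ h0
    have p0 : 0 < ‖(p ξ : ℂ) - z₀‖ := hc.trans_le h1
    have p1 : 0 < ‖(p ξ : ℂ) - z‖ := by linarith
    have e : n ξ / ((p ξ : ℂ) - z) - n ξ / ((p ξ : ℂ) - z₀) =
        n ξ * (z - z₀) / (((p ξ : ℂ) - z) * ((p ξ : ℂ) - z₀)) := by
      have := norm_pos_iff.1 p0
      have := norm_pos_iff.1 p1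
      field_simp
      ring
    rw [e, norm_div, norm_mul, norm_mul, div_le_iff₀ (by positivity)]
    have h4 : c ≤ 2 * ‖(p ξ : ℂ) - z‖ := h1.trans h3
    calc ‖n ξ‖ * ‖z - z₀‖ ≤ C * ‖(p ξ : ℂ) - z₀‖ * ‖z - z₀‖ := by gcongr
      _ = C * (1 / c * c) * ‖z - z₀‖ * ‖(p ξ : ℂ) - z₀‖ := by
        rw [one_div_mul_cancel hc.ne']; ring
      _ ≤ C * (1 / c * (2 * ‖(p ξ : ℂ) - z‖)) * ‖z - z₀‖ * ‖(p ξ : ℂ) - z₀‖ := by gcongr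
      _ = _ := by ring
  rw [ContinuousAt, tendsto_iff_norm_sub_tendsto_zero]
  have hlim : Tendsto (fun z : ℂ => C * (2 / c) * ‖z - z₀‖) (𝓝 z₀) (𝓝 0) := by
    have : Continuous fun z : ℂ => C * (2 / c) * ‖z - z₀‖ := by fun_prop
    simpa using this.tendsto z₀
  refine squeeze_zero' (Eventually.of_forall fun z => norm_nonneg _) ?_ hlim
  filter_upwards [Metric.closedBall_mem_nhds z₀ (by positivity : 0 < c / 2)] with z hz
  exact hdiff z (by rwa [mem_closedBall_iff_norm] at hz)

theorem freq_sq_eq (ξ : E3) : freq ξ ^ 2 = (2 * Real.pi) ^ 2 * ‖ξ‖ ^ 2 := by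
  rw [freq_eq, mul_pow]

theorem contDiff_freq_sq : ContDiff ℝ (⊤ : ℕ∞) fun ξ => freq ξ ^ 2 := by
  simp_rw [freq_sq_eq]
  exact contDiff_const.mul (contDiff_norm_sq ℝ)

theorem contDiff_perp (j : Fin 3) : ContDiff ℝ (⊤ : ℕ∞) (perp j) := by
  unfold perp
  exact contDiff_freq_sq.sub (by fun_prop)

theorem sum_perp (ξ : E3) : perp 0 ξ + perp 1 ξ + perp 2 ξ = 2 * freq ξ ^ 2 := by
  have h : ‖ξ‖ ^ 2 = ξ 0 ^ 2 + ξ 1 ^ 2 + ξ 2 ^ 2 := by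
    rw [EuclideanSpace.norm_sq_eq, Fin.sum_univ_three]
    simp
  simp only [perp, freq_sq_eq, h]
  ring

theorem hasCompactSupport_of_freq_sq {b : E3 → ℂ} {r : ℝ} (h : ∀ ξ, b ξ ≠ 0 → freq ξ ^ 2 ≤ r) :
    HasCompactSupport b := by
  refine HasCompactSupport.of_support_subset_isCompact (isCompact_closedBall (0 : E3) (1 + r))
    fun ξ hξ => ?_
  rw [mem_closedBall_zero_iff]
  have h1 := h ξ hξ
  rw [freq_sq_eq] at h1
  have h2 : 1 ≤ (2 * Real.pi) ^ 2 := by nlinarith [Real.pi_gt_three]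
  nlinarith [sq_nonneg (‖ξ‖ - 1), mul_nonneg (sub_nonneg.2 h2) (sq_nonneg ‖ξ‖)]

theorem bddMeas_of_compactSupport {b : E3 → ℂ} (hb : Continuous b) (hc : HasCompactSupport b) :
    BddMeas b :=
  ⟨hb.measurable, hb.bounded_above_of_compact_support hc⟩

theorem measurable_freq_sq : Measurable fun ξ => freq ξ ^ 2 := continuous_freq.measurable.pow_const 2

theorem openHalf_im_ne_zero {σ : ℝ} {z : ℂ} (hz : z ∈ openHalf σ) : z.im ≠ 0 := fun h => by
  have h1 : 0 < σ * z.im := hz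
  simp [h] at h1

/-- The sharp slab indicator is 1 on the support of b, so the operator is the sharp slab resolvent
after b(D). Having a Schwartz symbol, b(D) moves past the weight and becomes a fixed bounded factor
on the right. -/
theorem exists_tendsto_of_perp_le {s : ℝ} (hs : 1 / 2 < s) {ρ t : ℝ} (hρ : 0 ≤ ρ) (ht : ρ < t)
    (j : Fin 3) {σ : ℝ} (hσ : σ ^ 2 = 1) {b : E3 → ℂ} (hb : ContDiff ℝ (⊤ : ℕ∞) b)
    (hc : HasCompactSupport b) (h : ∀ ξ, b ξ ≠ 0 → perp j ξ ≤ ρ) :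
    ∃ L, Tendsto (fun z => sandwich s (fm (quot b (fun ξ => freq ξ ^ 2) z)))
      (𝓝[openHalf σ] (t : ℂ)) (𝓝 L) := by
  obtain ⟨K, hK⟩ := exists_weighted_fm (s := s) (by linarith) (hc.toSchwartzMap hb)
  obtain ⟨L, hL⟩ := exists_tendsto_slab hs hρ ht j hσ
  refine ⟨L ∘L K, ?_⟩
  have hlim : Tendsto (fun z => sandwich s (fm (slab j ρ z)) ∘L K) (𝓝[openHalf σ] (t : ℂ))
      (𝓝 (L ∘L K)) :=
    ((by fun_prop : Continuous fun M : L2 →L[ℂ] L2 => M ∘L K).tendsto L).comp hL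
  refine hlim.congr' ?_
  filter_upwards [self_mem_nhdsWithin] with z hz
  have hz' := openHalf_im_ne_zero hz
  ext1 g
  simp only [sandwich, ContinuousLinearMap.comp_apply]
  rw [hK, fm_fm (bddMeas_slab hz') (bddMeas_schwartz _)]
  congr 2
  congr 1
  funext ξ
  rw [Pi.mul_apply, slab, quot, HasCompactSupport.toSchwartzMap_toFun]
  split_ifs with hξ
  · push_cast
    rw [one_div_mul_eq_div]
  · have h0 : b ξ = 0 := by
      by_contra h0
      exact hξ (h ξ h0)
    rw [h0, mul_zero, zero_div]

theorem quot_add (n m : E3 → ℂ) (p : E3 → ℝ) (z : ℂ) :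
    quot (n + m) p z = quot n p z + quot m p z := by
  funext ξ
  simp [quot, add_div]

theorem exists_tendsto_sandwich_add {s : ℝ} {l : Filter ℂ} {M M' : ℂ → L2 →L[ℂ] L2}
    (h : ∃ L, Tendsto (fun z => sandwich s (M z)) l (𝓝 L))
    (h' : ∃ L, Tendsto (fun z => sandwich s (M' z)) l (𝓝 L)) :
    ∃ L, Tendsto (fun z => sandwich s (M z + M' z)) l (𝓝 L) := by
  obtain ⟨L, hL⟩ := h
  obtain ⟨L', hL'⟩ := h'
  exact ⟨L + L', by simpa only [sandwich_add] using hL.add hL'⟩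

/-- The limiting absorption principle for `-Δ`, localized in frequency. -/
theorem exists_tendsto_of_compactSupport {s : ℝ} (hs : 1 / 2 < s) {t : ℝ} (ht : 0 < t)
    {σ : ℝ} (hσ : σ ^ 2 = 1) {a : E3 → ℂ} (ha : ContDiff ℝ (⊤ : ℕ∞) a)
    (hc : HasCompactSupport a) :
    ∃ L, Tendsto (fun z => sandwich s (fm (quot a (fun ξ => freq ξ ^ 2) z)))
      (𝓝[openHalf σ] (t : ℂ)) (𝓝 L) := by
  -- Equal to 1 for `perp j` ≤ 0.7t and to 0 for `perp j` ≥ 0.8t. The products below peel off one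
  -- direction at a time.
  set φ : Fin 3 → E3 → ℂ := fun j ξ =>
    ((Real.smoothTransition ((8 * t - 10 * perp j ξ) / t) : ℝ) : ℂ) with hφ
  have hφs : ∀ j, ContDiff ℝ (⊤ : ℕ∞) (φ j) := fun j => by
    refine Complex.ofRealCLM.contDiff.comp (Real.smoothTransition.contDiff.comp ?_)
    exact (contDiff_const.sub (contDiff_const.mul (contDiff_perp j))).div_const t
  have hφ0 : ∀ j ξ, φ j ξ ≠ 0 → perp j ξ ≤ 8 / 10 * t := fun j ξ h => by
    by_contra! hlt
    refine h ?_
    simp only [hφ]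
    rw [Real.smoothTransition.zero_of_nonpos, Complex.ofReal_zero]
    exact div_nonpos_of_nonpos_of_nonneg (by linarith) ht.le
  have hφ1 : ∀ j ξ, 1 - φ j ξ ≠ 0 → 7 / 10 * t ≤ perp j ξ := fun j ξ h => by
    by_contra! hlt
    refine h ?_
    simp only [hφ]
    rw [Real.smoothTransition.one_of_one_le, Complex.ofReal_one, sub_self]
    rw [le_div_iff₀ ht]
    linarith
  set b₀ : E3 → ℂ := fun ξ => a ξ * φ 0 ξ
  set b₁ : E3 → ℂ := fun ξ => a ξ * (1 - φ 0 ξ) * φ 1 ξ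
  set b₂ : E3 → ℂ := fun ξ => a ξ * (1 - φ 0 ξ) * (1 - φ 1 ξ) * φ 2 ξ
  set b₃ : E3 → ℂ := fun ξ => a ξ * (1 - φ 0 ξ) * (1 - φ 1 ξ) * (1 - φ 2 ξ) with hb₃
  have h1 : ∀ j, ContDiff ℝ (⊤ : ℕ∞) fun ξ => 1 - φ j ξ := fun j => contDiff_const.sub (hφs j)
  have s₀ : ContDiff ℝ (⊤ : ℕ∞) b₀ := ha.mul (hφs 0)
  have s₁ : ContDiff ℝ (⊤ : ℕ∞) b₁ := (ha.mul (h1 0)).mul (hφs 1)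
  have s₂ : ContDiff ℝ (⊤ : ℕ∞) b₂ := ((ha.mul (h1 0)).mul (h1 1)).mul (hφs 2)
  have s₃ : ContDiff ℝ (⊤ : ℕ∞) b₃ := ((ha.mul (h1 0)).mul (h1 1)).mul (h1 2)
  have c₀ : HasCompactSupport b₀ := hc.mul_right
  have c₁ : HasCompactSupport b₁ := hc.mul_right.mul_right
  have c₂ : HasCompactSupport b₂ := hc.mul_right.mul_right.mul_right
  have c₃ : HasCompactSupport b₃ := hc.mul_right.mul_right.mul_right
  have e : a = b₀ + b₁ + b₂ + b₃ := by
    funext ξ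
    simp only [Pi.add_apply, b₀, b₁, b₂, b₃]
    ring
  have hρ : 0 ≤ 8 / 10 * t := by positivity
  have hρt : 8 / 10 * t < t := by linarith
  have L₀ := exists_tendsto_of_perp_le hs hρ hρt 0 hσ s₀ c₀
    fun ξ h => hφ0 0 ξ (right_ne_zero_of_mul h)
  have L₁ := exists_tendsto_of_perp_le hs hρ hρt 1 hσ s₁ c₁
    fun ξ h => hφ0 1 ξ (right_ne_zero_of_mul h)
  have L₂ := exists_tendsto_of_perp_le hs hρ hρt 2 hσ s₂ c₂
    fun ξ h => hφ0 2 ξ (right_ne_zero_of_mul h)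
  have B₀ := bddMeas_of_compactSupport s₀.continuous c₀
  have B₁ := bddMeas_of_compactSupport s₁.continuous c₁
  have B₂ := bddMeas_of_compactSupport s₂.continuous c₂
  have B₃ := bddMeas_of_compactSupport s₃.continuous c₃
  -- On the support of `b₃` all three `perp j` are at least 0.7t, so 2|2πξ|² ≥ 2.1t and |2πξ|²
  -- exceeds t by at least t/20: there is no singularity.
  have L₃ : ∃ L, Tendsto (fun z => sandwich s (fm (quot b₃ (fun ξ => freq ξ ^ 2) z)))
      (𝓝[openHalf σ] (t : ℂ)) (𝓝 L) := by
    obtain ⟨hm, C, hC⟩ := B₃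
    have hC0 : 0 ≤ C := (norm_nonneg _).trans (hC 0)
    have hcont : ContinuousAt (fun z => fm (quot b₃ (fun ξ => freq ξ ^ 2) z)) (t : ℂ) := by
      refine continuousAt_fm_quot hm measurable_freq_sq (c := t / 20) (C := C / (t / 20))
        (by positivity) (by positivity) fun ξ h => ?_
      have k2 := hφ1 2 ξ (right_ne_zero_of_mul h)
      have k1 := hφ1 1 ξ (right_ne_zero_of_mul (left_ne_zero_of_mul h))
      have k0 := hφ1 0 ξ (right_ne_zero_of_mul (left_ne_zero_of_mul (left_ne_zero_of_mul h)))
      have k := sum_perp ξ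
      have hle : t / 20 ≤ ‖((freq ξ ^ 2 : ℝ) : ℂ) - t‖ := by
        rw [← Complex.ofReal_sub, Complex.norm_real]
        exact (by linarith : t / 20 ≤ freq ξ ^ 2 - t).trans (Real.le_norm_self _)
      refine ⟨hle, (hC ξ).trans ?_⟩
      rw [div_mul_eq_mul_div, le_div_iff₀ (by positivity)]
      exact mul_le_mul_of_nonneg_left hle hC0
    exact ⟨_, ((continuous_sandwich s).continuousAt.comp hcont).tendsto.mono_left
      nhdsWithin_le_nhds⟩
  obtain ⟨L, hL⟩ := exists_tendsto_sandwich_add (exists_tendsto_sandwich_add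
    (exists_tendsto_sandwich_add L₀ L₁) L₂) L₃
  refine ⟨L, hL.congr' ?_⟩
  filter_upwards [self_mem_nhdsWithin] with z hz
  have hz' := openHalf_im_ne_zero hz
  have hp := measurable_freq_sq
  rw [e, quot_add, quot_add, quot_add, fm_add, fm_add, fm_add]
  · exact bddMeas_quot B₀ hp hz'
  · exact bddMeas_quot B₁ hp hz'
  · exact (bddMeas_quot B₀ hp hz').add (bddMeas_quot B₁ hp hz')
  · exact bddMeas_quot B₂ hp hz'
  · exact ((bddMeas_quot B₀ hp hz').add (bddMeas_quot B₁ hp hz')).add (bddMeas_quot B₂ hp hz')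
  · exact bddMeas_quot B₃ hp hz'

/-! ### Boundary values of the weighted resolvents -/

theorem bracketSymbol_eq (l : ℝ) (ξ : E3) :
    bracketSymbol l ξ = (((1 + freq ξ ^ 2) ^ (l / 2) : ℝ) : ℂ) := rfl

theorem norm_bracketSymbol (l : ℝ) (ξ : E3) : ‖bracketSymbol l ξ‖ = (1 + freq ξ ^ 2) ^ (l / 2) := by
  rw [bracketSymbol_eq, Complex.norm_real, Real.norm_of_nonneg (by positivity)]

theorem contDiff_bracketSymbol (l : ℝ) : ContDiff ℝ (⊤ : ℕ∞) (bracketSymbol l) :=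
  (bracketSymbol_temperate l).1

theorem norm_bracketSymbol_two (ξ : E3) : ‖bracketSymbol 2 ξ‖ = 1 + freq ξ ^ 2 := by
  rw [norm_bracketSymbol]
  norm_num

theorem norm_bracketSymbol_one_le (ξ : E3) : ‖bracketSymbol 1 ξ‖ ≤ 1 + freq ξ := by
  rw [norm_bracketSymbol, ← Real.sqrt_eq_rpow]
  refine Real.sqrt_le_iff.2 ⟨by linarith [freq_nonneg ξ], ?_⟩
  nlinarith [freq_nonneg ξ]

/-- Write 1 + p = (p - z) + (1 + z) and use |Im z| ≤ |p - z|. Off the real axis the resolvent thus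
absorbs ⟨D⟩^ℓ. -/
theorem one_add_le_mul_norm_sub {z : ℂ} (hz : z.im ≠ 0) {p : ℝ} (hp : 0 ≤ p) :
    1 + p ≤ (1 + ‖1 + z‖ / |z.im|) * ‖(p : ℂ) - z‖ := by
  have h1 : 1 + p ≤ ‖(p : ℂ) - z‖ + ‖1 + z‖ := by
    have h := norm_add_le ((p : ℂ) - z) (1 + z)
    have e : (p : ℂ) - z + (1 + z) = ((1 + p : ℝ) : ℂ) := by push_cast; ring
    rwa [e, Complex.norm_real, Real.norm_of_nonneg (by positivity)] at h
  have h2 : ‖1 + z‖ ≤ ‖1 + z‖ / |z.im| * ‖(p : ℂ) - z‖ := by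
    have h0 := abs_pos.2 hz
    rw [div_mul_eq_mul_div, le_div_iff₀ h0]
    exact mul_le_mul_of_nonneg_left (abs_im_le_norm_sub p z) (norm_nonneg _)
  linarith

/-- The operator `⟨x⟩⁻ˢ ⟨D⟩^ℓ (p(D) - z)⁻¹ ⟨x⟩⁻ˢ`. -/
def weightedResolvent (l s : ℝ) (p : E3 → ℝ) (z : ℂ) : L2 →L[ℂ] L2 :=
  sandwich s (fm (quot (bracketSymbol l) p z))

theorem bddMeas_quot_bracketSymbol {l : ℝ} {p : E3 → ℝ} (hp : Measurable p) (hp0 : ∀ ξ, 0 ≤ p ξ)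
    (hl : ∀ ξ, ‖bracketSymbol l ξ‖ ≤ 1 + p ξ) {z : ℂ} (hz : z.im ≠ 0) :
    BddMeas (quot (bracketSymbol l) p z) :=
  bddMeas_quot_of_le (contDiff_bracketSymbol l).continuous.measurable hp (by positivity)
    fun ξ => (hl ξ).trans (one_add_le_mul_norm_sub hz (hp0 ξ))

theorem continuousAt_weightedResolvent {l : ℝ} {p : E3 → ℝ} (hp : Measurable p)
    (hp0 : ∀ ξ, 0 ≤ p ξ) (hl : ∀ ξ, ‖bracketSymbol l ξ‖ ≤ 1 + p ξ) (s : ℝ) {z : ℂ}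
    (hz : z.im ≠ 0) :
    ContinuousAt (weightedResolvent l s p) z := by
  refine (continuous_sandwich s).continuousAt.comp ?_
  exact continuousAt_fm_quot (contDiff_bracketSymbol l).continuous.measurable hp (abs_pos.2 hz)
    (by positivity) fun ξ _ => ⟨abs_im_le_norm_sub _ _,
      (hl ξ).trans (one_add_le_mul_norm_sub hz (hp0 ξ))⟩

theorem contDiff_ofReal_smoothTransition {g : E3 → ℝ} (hg : ContDiff ℝ (⊤ : ℕ∞) g) :
    ContDiff ℝ (⊤ : ℕ∞) fun ξ => ((Real.smoothTransition (g ξ) : ℝ) : ℂ) :=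
  Complex.ofRealCLM.contDiff.comp (Real.smoothTransition.contDiff.comp hg)

theorem bddMeas_quot_freq_sq {z : ℂ} (hz : z.im ≠ 0) :
    BddMeas (quot (bracketSymbol 2) (fun ξ => freq ξ ^ 2) z) :=
  bddMeas_quot_bracketSymbol measurable_freq_sq (fun _ => sq_nonneg _)
    (fun ξ => (norm_bracketSymbol_two ξ).le) hz

/-- The limiting absorption principle for `-Δ`. -/
theorem exists_tendsto_laplacian {s : ℝ} (hs : 1 / 2 < s) {t : ℝ} (ht : 0 < t)
    {σ : ℝ} (hσ : σ ^ 2 = 1) :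
    ∃ L, Tendsto (weightedResolvent 2 s fun ξ => freq ξ ^ 2) (𝓝[openHalf σ] (t : ℂ)) (𝓝 L) := by
  -- Equal to 1 for |2πξ|² ≤ 2t and to 0 for |2πξ|² ≥ 3t. Where 1 - χ is nonzero, |2πξ|² - t is at
  -- least t and at least half of |2πξ|², which gives the constant 2 + 1/t below.
  set χ : E3 → ℂ := fun ξ => ((Real.smoothTransition (3 - freq ξ ^ 2 / t) : ℝ) : ℂ) with hχ
  have hχs : ContDiff ℝ (⊤ : ℕ∞) χ :=
    contDiff_ofReal_smoothTransition (contDiff_const.sub (contDiff_freq_sq.div_const t))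
  set a : E3 → ℂ := fun ξ => χ ξ * bracketSymbol 2 ξ
  set b : E3 → ℂ := fun ξ => (1 - χ ξ) * bracketSymbol 2 ξ
  have ha : ContDiff ℝ (⊤ : ℕ∞) a := hχs.mul (contDiff_bracketSymbol 2)
  have hb : ContDiff ℝ (⊤ : ℕ∞) b := (contDiff_const.sub hχs).mul (contDiff_bracketSymbol 2)
  have hc : HasCompactSupport a := by
    refine hasCompactSupport_of_freq_sq (r := 3 * t) fun ξ h => ?_
    by_contra! hlt
    refine left_ne_zero_of_mul h ?_
    simp only [hχ]
    rw [Real.smoothTransition.zero_of_nonpos, Complex.ofReal_zero]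
    rw [sub_nonpos, le_div_iff₀ ht]
    exact hlt.le
  have L₁ := exists_tendsto_of_compactSupport hs ht hσ ha hc
  have L₂ : ∃ L, Tendsto (fun z => sandwich s (fm (quot b (fun ξ => freq ξ ^ 2) z)))
      (𝓝[openHalf σ] (t : ℂ)) (𝓝 L) := by
    have hcont : ContinuousAt (fun z => fm (quot b (fun ξ => freq ξ ^ 2) z)) (t : ℂ) := by
      refine continuousAt_fm_quot hb.continuous.measurable measurable_freq_sq (c := t)
        (C := 2 + 1 / t) ht (by positivity) fun ξ h => ?_
      have h1 : 2 * t ≤ freq ξ ^ 2 := by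
        by_contra! hlt
        refine left_ne_zero_of_mul h ?_
        simp only [hχ]
        rw [Real.smoothTransition.one_of_one_le, Complex.ofReal_one, sub_self]
        rw [le_sub_comm, div_le_iff₀ ht]
        linarith
      have h2 : ‖((freq ξ ^ 2 : ℝ) : ℂ) - t‖ = freq ξ ^ 2 - t := by
        rw [← Complex.ofReal_sub, Complex.norm_real, Real.norm_of_nonneg (by linarith)]
      rw [h2]
      refine ⟨by linarith, ?_⟩
      rw [norm_mul, norm_bracketSymbol_two, ← Complex.ofReal_one, ← Complex.ofReal_sub,
        Complex.norm_real, Real.norm_of_nonneg (sub_nonneg.2 (Real.smoothTransition.le_one _))]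
      refine (mul_le_of_le_one_left (by positivity)
        (sub_le_self _ (Real.smoothTransition.nonneg _))).trans ?_
      have h3 : 1 ≤ 1 / t * (freq ξ ^ 2 - t) := by
        rw [div_mul_eq_mul_div, le_div_iff₀ ht]
        linarith
      nlinarith
    exact ⟨_, ((continuous_sandwich s).continuousAt.comp hcont).tendsto.mono_left
      nhdsWithin_le_nhds⟩
  obtain ⟨L, hL⟩ := exists_tendsto_sandwich_add L₁ L₂
  refine ⟨L, hL.congr' ?_⟩
  filter_upwards [self_mem_nhdsWithin] with z hz
  have hz' := openHalf_im_ne_zero hz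
  -- The numerator b grows quadratically, so boundedness of the quotient is read off from a
  -- difference of two bounded symbols.
  have hbq : BddMeas (quot b (fun ξ => freq ξ ^ 2) z) := by
    have := (bddMeas_quot_freq_sq hz').sub
      (bddMeas_quot (bddMeas_of_compactSupport ha.continuous hc) measurable_freq_sq hz')
    convert this using 1
    funext ξ
    simp only [quot, Pi.sub_apply, a, b]
    ring
  rw [weightedResolvent,
    ← fm_add (bddMeas_quot (bddMeas_of_compactSupport ha.continuous hc) measurable_freq_sq hz') hbq]
  congr 2
  funext ξ
  simp only [quot, Pi.add_apply, a, b]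
  ring

/-! ### Reduction of √(-Δ) to -Δ on an annulus of frequencies -/

/-- A smooth cutoff to the annulus `α ≤ |2πξ| ≤ β`. -/
def annulus (α β : ℝ) (ξ : E3) : ℝ :=
  Real.smoothTransition ((4 * freq ξ ^ 2 - α ^ 2) / (3 * α ^ 2)) *
    Real.smoothTransition ((4 * β ^ 2 - freq ξ ^ 2) / (3 * β ^ 2))

section

variable {α β : ℝ}

theorem annulus_nonneg (ξ : E3) : 0 ≤ annulus α β ξ :=
  mul_nonneg (Real.smoothTransition.nonneg _) (Real.smoothTransition.nonneg _)

theorem annulus_le_one (ξ : E3) : annulus α β ξ ≤ 1 :=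
  mul_le_one₀ (Real.smoothTransition.le_one _) (Real.smoothTransition.nonneg _)
    (Real.smoothTransition.le_one _)

theorem annulus_eq_one (hα : 0 < α) (hβ : 0 < β) {ξ : E3} (h1 : α ≤ freq ξ) (h2 : freq ξ ≤ β) :
    annulus α β ξ = 1 := by
  rw [annulus, Real.smoothTransition.one_of_one_le, Real.smoothTransition.one_of_one_le, one_mul]
  · rw [le_div_iff₀ (by positivity)]
    nlinarith [freq_nonneg ξ]
  · rw [le_div_iff₀ (by positivity)]
    nlinarith [freq_nonneg ξ]

theorem annulus_eq_zero_of_le {ξ : E3} (h : 4 * freq ξ ^ 2 ≤ α ^ 2) : annulus α β ξ = 0 := by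
  rw [annulus, Real.smoothTransition.zero_of_nonpos, zero_mul]
  exact div_nonpos_of_nonpos_of_nonneg (by linarith) (by positivity)

theorem freq_sq_le_of_annulus {ξ : E3} (h : annulus α β ξ ≠ 0) : freq ξ ^ 2 ≤ 4 * β ^ 2 := by
  by_contra! hlt
  refine right_ne_zero_of_mul h ?_
  rw [Real.smoothTransition.zero_of_nonpos]
  exact div_nonpos_of_nonpos_of_nonneg (by linarith) (by positivity)

theorem contDiff_annulus : ContDiff ℝ (⊤ : ℕ∞) fun ξ => (annulus α β ξ : ℂ) := by
  simp only [annulus, Complex.ofReal_mul]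
  refine (contDiff_ofReal_smoothTransition ?_).mul (contDiff_ofReal_smoothTransition ?_)
  · exact ((contDiff_const.mul contDiff_freq_sq).sub contDiff_const).div_const _
  · exact (contDiff_const.sub contDiff_freq_sq).div_const _

/-- The symbol |2πξ| is singular only at the origin, and the cutoff vanishes for |2πξ| ≤ α/2. -/
theorem contDiff_annulus_mul_freq (hα : 0 < α) :
    ContDiff ℝ (⊤ : ℕ∞) fun ξ => (annulus α β ξ : ℂ) * (freq ξ : ℂ) := by
  rw [contDiff_iff_contDiffAt]
  intro ξ
  by_cases h0 : ξ = 0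
  · have hev : (fun ξ => (annulus α β ξ : ℂ) * (freq ξ : ℂ)) =ᶠ[𝓝 ξ] fun _ => 0 := by
      have hc : ContinuousAt (fun ξ => 4 * freq ξ ^ 2) ξ :=
        ((continuous_freq.pow 2).const_mul 4 : Continuous _).continuousAt
      have hlt : 4 * freq ξ ^ 2 < α ^ 2 := by
        rw [h0, freq_eq]
        simpa using pow_pos hα 2
      filter_upwards [hc.eventually (gt_mem_nhds hlt)] with ζ hζ
      rw [annulus_eq_zero_of_le hζ.le, Complex.ofReal_zero, zero_mul]
    exact contDiffAt_const.congr_of_eventuallyEq hev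
  · refine contDiff_annulus.contDiffAt.mul ?_
    have hf : ContDiffAt ℝ (⊤ : ℕ∞) freq ξ := by
      have : freq = fun ξ => 2 * Real.pi * ‖ξ‖ := funext freq_eq
      rw [this]
      exact contDiffAt_const.mul (contDiffAt_norm ℝ h0)
    exact Complex.ofRealCLM.contDiff.contDiffAt.comp ξ hf

theorem hasCompactSupport_annulus_mul (g : E3 → ℂ) :
    HasCompactSupport fun ξ => (annulus α β ξ : ℂ) * g ξ :=
  hasCompactSupport_of_freq_sq fun _ h =>
    freq_sq_le_of_annulus (Complex.ofReal_ne_zero.1 (left_ne_zero_of_mul h))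

/-- The part of the weighted resolvent of `√(-Δ)` away from an annulus of frequencies. -/
def remainder (s α β : ℝ) (z : ℂ) : L2 →L[ℂ] L2 :=
  sandwich s (fm (quot (fun ξ => (1 - annulus α β ξ) * bracketSymbol 1 ξ) freq z))

theorem measurable_remainder_num :
    Measurable fun ξ => (1 - (annulus α β ξ : ℂ)) * bracketSymbol 1 ξ :=
  ((contDiff_const.sub contDiff_annulus).mul (contDiff_bracketSymbol 1)).continuous.measurable

/-- Off the annulus either |2πξ| < a/2 or |2πξ| > 2b, while a ≤ Re z ≤ b. Real parts alone separate
|2πξ| from z, so real z are included and the remainder is continuous across the axis. -/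
theorem remainder_num_bound {a b : ℝ} (ha : 0 < a) (hb : 0 < b) {z : ℂ} (hz : z ∈ box a b)
    {ξ : E3} (h : (1 - (annulus (a / 2) (2 * b) ξ : ℂ)) * bracketSymbol 1 ξ ≠ 0) :
    min (a / 2) b ≤ ‖(freq ξ : ℂ) - z‖ ∧
      ‖(1 - (annulus (a / 2) (2 * b) ξ : ℂ)) * bracketSymbol 1 ξ‖ ≤
        (2 + 1 / min (a / 2) b) * ‖(freq ξ : ℂ) - z‖ := by
  obtain ⟨h1, h2, -⟩ := hz
  set m := min (a / 2) b with hm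
  have hm0 : 0 < m := lt_min (by positivity) hb
  have hm1 : m ≤ a / 2 := min_le_left _ _
  have hm2 : m ≤ b := min_le_right _ _
  have hre : |freq ξ - z.re| ≤ ‖(freq ξ : ℂ) - z‖ := by
    simpa using Complex.abs_re_le_norm ((freq ξ : ℂ) - z)
  set D := ‖(freq ξ : ℂ) - z‖
  have hout : freq ξ < a / 2 ∨ 2 * b < freq ξ := by
    by_contra! hin
    refine left_ne_zero_of_mul h ?_
    rw [annulus_eq_one (by positivity) (by positivity) hin.1 hin.2, Complex.ofReal_one, sub_self]
  have hle := abs_le.1 hre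
  have hD : m ≤ D ∧ freq ξ ≤ 2 * D := by
    rcases hout with h | h
    · exact ⟨by linarith, by linarith⟩
    · exact ⟨by linarith, by linarith⟩
  refine ⟨hD.1, ?_⟩
  rw [norm_mul, ← Complex.ofReal_one, ← Complex.ofReal_sub, Complex.norm_real,
    Real.norm_of_nonneg (sub_nonneg.2 (annulus_le_one ξ))]
  refine (mul_le_of_le_one_left (norm_nonneg _) (sub_le_self _ (annulus_nonneg ξ))).trans
    ((norm_bracketSymbol_one_le ξ).trans ?_)
  have h3 : 1 ≤ 1 / m * D := by
    rw [div_mul_eq_mul_div, le_div_iff₀ hm0]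
    linarith [hD.1]
  linarith [hD.2]

theorem bddMeas_remainder {a b : ℝ} (ha : 0 < a) (hb : 0 < b) {z : ℂ} (hz : z ∈ box a b) :
    BddMeas (quot (fun ξ => (1 - annulus (a / 2) (2 * b) ξ) * bracketSymbol 1 ξ) freq z) := by
  have hm0 : 0 < min (a / 2) b := lt_min (by positivity) hb
  refine bddMeas_quot_of_le measurable_remainder_num continuous_freq.measurable
    (C := 2 + 1 / min (a / 2) b) (by positivity) fun ξ => ?_
  by_cases h : (1 - (annulus (a / 2) (2 * b) ξ : ℂ)) * bracketSymbol 1 ξ = 0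
  · rw [h, norm_zero]; positivity
  · exact (remainder_num_bound ha hb hz h).2

theorem continuousAt_remainder (s : ℝ) {a b : ℝ} (ha : 0 < a) (hb : 0 < b) {z : ℂ}
    (hz : z ∈ box a b) : ContinuousAt (remainder s (a / 2) (2 * b)) z := by
  have hm0 : 0 < min (a / 2) b := lt_min (by positivity) hb
  refine (continuous_sandwich s).continuousAt.comp ?_
  exact continuousAt_fm_quot measurable_remainder_num continuous_freq.measurable hm0
    (by positivity) fun ξ h => remainder_num_bound ha hb hz h

end

theorem sq_im_ne_zero {z : ℂ} (h : z.im ≠ 0) (hr : 0 < z.re) : (z ^ 2).im ≠ 0 := by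
  rw [pow_two, Complex.mul_im, mul_comm z.im, ← two_mul]
  exact mul_ne_zero two_ne_zero (mul_ne_zero hr.ne' h)

theorem sq_mem_openHalf {σ : ℝ} {z : ℂ} (h : z ∈ openHalf σ) (hr : 0 < z.re) :
    z ^ 2 ∈ openHalf σ := by
  have h1 : 0 < σ * z.im := h
  change 0 < σ * (z ^ 2).im
  rw [pow_two, Complex.mul_im]
  nlinarith

/-- Multiply numerator and denominator by |2πξ| + z in the share c of the fraction. Since Re z > 0,
z² is not real and the new denominator does not vanish. -/
theorem one_div_freq_sub {z : ℂ} (h : z.im ≠ 0) (hr : 0 < z.re) (ξ : E3) (c n : ℂ) :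
    n / ((freq ξ : ℂ) - z) = c * (freq ξ + z) * n / (((freq ξ ^ 2 : ℝ) : ℂ) - z ^ 2) +
      (1 - c) * n / ((freq ξ : ℂ) - z) := by
  have h1 := sub_ne_zero_of_im h (freq ξ)
  have h2 := sub_ne_zero_of_im (sq_im_ne_zero h hr) (freq ξ ^ 2)
  have e : ((freq ξ ^ 2 : ℝ) : ℂ) - z ^ 2 = (freq ξ - z) * (freq ξ + z) := by
    push_cast
    ring
  rw [e] at h2 ⊢
  have h3 := right_ne_zero_of_mul h2
  field_simp
  ring

/-- The weighted resolvent of `√(-Δ)` in terms of the one of `-Δ`. -/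
theorem weightedResolvent_sqrt_eq (s : ℝ) {a b : ℝ} (ha : 0 < a) (hb : 0 < b) {z : ℂ}
    (hz : z ∈ box a b) (hi : z.im ≠ 0) :
    weightedResolvent 1 s freq z =
      sandwich s (fm (quot (fun ξ => annulus (a / 2) (2 * b) ξ * freq ξ * bracketSymbol 1 ξ)
        (fun ξ => freq ξ ^ 2) (z ^ 2))) +
      z • sandwich s (fm (quot (fun ξ => annulus (a / 2) (2 * b) ξ * bracketSymbol 1 ξ)
        (fun ξ => freq ξ ^ 2) (z ^ 2))) + remainder s (a / 2) (2 * b) z := by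
  have hr : 0 < z.re := ha.trans_le hz.1
  have hi2 := sq_im_ne_zero hi hr
  have b1 : BddMeas fun ξ => (annulus (a / 2) (2 * b) ξ : ℂ) * freq ξ * bracketSymbol 1 ξ :=
    bddMeas_of_compactSupport ((contDiff_annulus_mul_freq (by positivity)).mul
      (contDiff_bracketSymbol 1)).continuous (by
        simp_rw [mul_assoc]
        exact hasCompactSupport_annulus_mul _)
  have b2 : BddMeas fun ξ => (annulus (a / 2) (2 * b) ξ : ℂ) * bracketSymbol 1 ξ :=
    bddMeas_of_compactSupport (contDiff_annulus.mul (contDiff_bracketSymbol 1)).continuous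
      (hasCompactSupport_annulus_mul _)
  have q1 := bddMeas_quot b1 measurable_freq_sq hi2
  have q2 := bddMeas_quot b2 measurable_freq_sq hi2
  rw [remainder, ← sandwich_smul, ← fm_smul q2, ← sandwich_add, ← fm_add q1 (q2.smul z),
    ← sandwich_add, ← fm_add (q1.add (q2.smul z)) (bddMeas_remainder ha hb hz), weightedResolvent]
  congr 2
  funext ξ
  simp only [quot, Pi.add_apply, Pi.smul_apply, smul_eq_mul]
  rw [one_div_freq_sub hi hr ξ (annulus (a / 2) (2 * b) ξ)]
  ring

/-- The limiting absorption principle for `√(-Δ)`. -/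
theorem exists_tendsto_sqrt {s : ℝ} (hs : 1 / 2 < s) {t : ℝ} (ht : 0 < t)
    {σ : ℝ} (hσ : σ ^ 2 = 1) :
    ∃ L, Tendsto (weightedResolvent 1 s freq) (𝓝[openHalf σ] (t : ℂ)) (𝓝 L) := by
  -- The box with real parts in [t/2, 2t] is chosen only because t lies in its interior.
  have ha : 0 < t / 2 := by positivity
  have hb : 0 < 2 * t := by positivity
  have htb : (t : ℂ) ∈ box (t / 2) (2 * t) := by
    refine ⟨?_, ?_, ?_⟩ <;> simp <;> linarith
  have hα : 0 < t / 2 / 2 := by positivity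
  obtain ⟨L₁, h₁⟩ := exists_tendsto_of_compactSupport hs (pow_pos ht 2) hσ
    (a := fun ξ => annulus (t / 2 / 2) (2 * (2 * t)) ξ * freq ξ * bracketSymbol 1 ξ)
    ((contDiff_annulus_mul_freq hα).mul (contDiff_bracketSymbol 1)) (by
        simp_rw [mul_assoc]
        exact hasCompactSupport_annulus_mul _)
  obtain ⟨L₂, h₂⟩ := exists_tendsto_of_compactSupport hs (pow_pos ht 2) hσ
    (a := fun ξ => annulus (t / 2 / 2) (2 * (2 * t)) ξ * bracketSymbol 1 ξ)
    (contDiff_annulus.mul (contDiff_bracketSymbol 1)) (hasCompactSupport_annulus_mul _)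
  have hre : ∀ᶠ z : ℂ in 𝓝 (t : ℂ), z ∈ box (t / 2) (2 * t) := by
    have e1 : ∀ᶠ z : ℂ in 𝓝 (t : ℂ), t / 2 < z.re :=
      Complex.continuous_re.continuousAt.eventually (lt_mem_nhds (by simp; linarith))
    have e2 : ∀ᶠ z : ℂ in 𝓝 (t : ℂ), z.re < 2 * t :=
      Complex.continuous_re.continuousAt.eventually (gt_mem_nhds (by simp; linarith))
    have e3 : ∀ᶠ z : ℂ in 𝓝 (t : ℂ), |z.im| < t / 2 / 2 :=
      (continuous_abs.comp Complex.continuous_im).continuousAt.eventually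
        (gt_mem_nhds (by simpa using hα))
    filter_upwards [e1, e2, e3] with z k1 k2 k3
    exact ⟨k1.le, k2.le, k3.le⟩
  have hsq : Tendsto (fun z : ℂ => z ^ 2) (𝓝[openHalf σ] (t : ℂ))
      (𝓝[openHalf σ] ((t ^ 2 : ℝ) : ℂ)) := by
    refine tendsto_nhdsWithin_iff.2 ⟨?_, ?_⟩
    · have : Continuous fun z : ℂ => z ^ 2 := by fun_prop
      simpa using (this.tendsto (t : ℂ)).mono_left nhdsWithin_le_nhds
    · filter_upwards [self_mem_nhdsWithin, hre.filter_mono nhdsWithin_le_nhds] with z h1 h2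
      exact sq_mem_openHalf h1 (ha.trans_le h2.1)
  have hz : Tendsto (fun z : ℂ => z) (𝓝[openHalf σ] (t : ℂ)) (𝓝 (t : ℂ)) :=
    tendsto_id.mono_left nhdsWithin_le_nhds
  refine ⟨_, (((h₁.comp hsq).add (hz.smul (h₂.comp hsq))).add
    ((continuousAt_remainder s ha hb htb).tendsto.mono_left nhdsWithin_le_nhds)).congr' ?_⟩
  filter_upwards [self_mem_nhdsWithin, hre.filter_mono nhdsWithin_le_nhds] with z h1 h2
  exact (weightedResolvent_sqrt_eq s ha hb h2 (openHalf_im_ne_zero h1)).symm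

/-! ### Multiplication operators and Fourier multipliers as operators on distributions -/

theorem smulLeft_toDist {a : E3 → ℂ} (ha : a.HasTemperateGrowth) {u v : L2}
    (h : v =ᵐ[volume] fun x => a x * u x) : smulLeftCLM ℂ a (toDist u) = toDist v := by
  ext φ
  rw [smulLeftCLM_apply_apply, toDist_apply, toDist_apply]
  refine integral_congr_ae ?_
  filter_upwards [h] with x hx
  rw [hx, SchwartzMap.smulLeftCLM_apply_apply ha, smul_eq_mul]
  ring

theorem fourier_toDist (u : L2) : 𝓕 (toDist u) = toDist (fou u) :=
  Lp.fourier_toTemperedDistribution_eq u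

theorem fourierInv_toDist (u : L2) : 𝓕⁻ (toDist u) = toDist (fou.symm u) :=
  Lp.fourierInv_toTemperedDistribution_eq u

theorem fourierMultiplier_toDist {a : E3 → ℂ} (ha : a.HasTemperateGrowth) {u v : L2}
    (h : fou v =ᵐ[volume] fun x => a x * fou u x) :
    fourierMultiplierCLM ℂ a (toDist u) = toDist v := by
  rw [fourierMultiplierCLM_apply, fourier_toDist, smulLeft_toDist ha h, fourierInv_toDist,
    LinearIsometryEquiv.symm_apply_apply]

theorem weight_toDist {s : ℝ} (hs : 0 ≤ s) (u : L2) :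
    weight (-s) (toDist u) = toDist (mulL (japanese (-s)) u) :=
  smulLeft_toDist (japanese_temperate _) (mulL_coeFn (bddMeas_japanese_neg hs) u)

theorem bracketD_toDist_fm {l : ℝ} {r : E3 → ℂ} (hr : BddMeas r)
    (hlr : BddMeas (bracketSymbol l * r)) (u : L2) :
    bracketD l (toDist (fm r u)) = toDist (fm (bracketSymbol l * r) u) := by
  refine fourierMultiplier_toDist (bracketSymbol_temperate l) ?_
  rw [fou_fm, fou_fm]
  filter_upwards [mulL_coeFn hr (fou u), mulL_coeFn hlr (fou u)] with ξ h1 h2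
  rw [h1, h2, Pi.mul_apply, mul_assoc]

theorem WSobolev.dist_eq {l s : ℝ} (f : WSobolev l s) :
    f.dist = bracketD (-l) (weight (-s) (toDist f.toL2)) := by
  rw [WSobolev.toDist_toL2, weight_neg_weight, bracketD_neg_bracketD]

theorem WSobolev.toL2_surjective {l s : ℝ} :
    Function.Surjective (WSobolev.toL2 : WSobolev l s →ₗ[ℂ] L2) := by
  intro g
  have h : weight s (bracketD l (bracketD (-l) (weight (-s) (toDist g)))) = toDist g := by
    have h1 := bracketD_neg_bracketD (-l) (weight (-s) (toDist g))
    have h2 := weight_neg_weight (-s) (toDist g)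
    rw [neg_neg] at h1 h2
    rw [h1, h2]
  let f : WSobolev l s := ⟨bracketD (-l) (weight (-s) (toDist g)), ⟨g, h.symm⟩⟩
  exact ⟨f, toDist_injective ((WSobolev.toDist_toL2 f).trans h)⟩

/-- The isometry `f ↦ ⟨x⟩ˢ ⟨D⟩^ℓ f` from `H^{ℓ,s}` onto `L²`. -/
def WSobolev.equivL2 (l s : ℝ) : WSobolev l s ≃ₗᵢ[ℂ] L2 :=
  LinearIsometryEquiv.ofSurjective ⟨WSobolev.toL2, fun _ => rfl⟩ WSobolev.toL2_surjective

theorem WSobolev.equivL2_apply {l s : ℝ} (f : WSobolev l s) : WSobolev.equivL2 l s f = f.toL2 := rfl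

/-- Elements of different weighted spaces are compared as distributions; continuity lets such
identities pass to norm limits. -/
theorem WSobolev.continuous_dist {l s : ℝ} :
    Continuous (WSobolev.dist : WSobolev l s → 𝓢'(E3, ℂ)) := by
  have e : (WSobolev.dist : WSobolev l s → 𝓢'(E3, ℂ)) = fun f =>
      bracketD (-l) (weight (-s) (Lp.toTemperedDistributionCLM ℂ (volume : Measure E3) 2
        (WSobolev.equivL2 l s f))) := funext WSobolev.dist_eq
  rw [e]
  exact (bracketD (-l)).continuous.comp ((weight (-s)).continuous.comp
    ((Lp.toTemperedDistributionCLM ℂ (volume : Measure E3) 2).continuous.comp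
      (WSobolev.equivL2 l s).continuous))

theorem WL2.dist_eq {s : ℝ} (hs : 0 ≤ s) (f : WL2 s) :
    f.dist = toDist (mulL (japanese (-s)) f.toL2) := by
  rw [WSobolev.dist_eq, neg_zero, bracketD_zero, weight_toDist hs]

theorem WSobolev.dist_of_toL2 {l s : ℝ} (hs : 0 ≤ s) {r : E3 → ℂ} (hr : BddMeas r)
    (hlr : BddMeas (bracketSymbol l * r)) (u : L2) {f : WSobolev l (-s)}
    (h : f.toL2 = mulL (japanese (-s)) (fm (bracketSymbol l * r) u)) : f.dist = toDist (fm r u) := by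
  apply weightBracket_injective l (-s)
  change weight (-s) (bracketD l f.dist) = weight (-s) (bracketD l (toDist (fm r u)))
  rw [← WSobolev.toDist_toL2, h, bracketD_toDist_fm hr hlr, weight_toDist hs]

/-- Operators between weighted Sobolev spaces, from operators on `L²`. -/
def ofL2 (l s l' s' : ℝ) (N : L2 →L[ℂ] L2) : WSobolev l s →L[ℂ] WSobolev l' s' :=
  ((WSobolev.equivL2 l' s').symm : L2 →L[ℂ] WSobolev l' s') ∘L N ∘L
    (WSobolev.equivL2 l s : WSobolev l s →L[ℂ] L2)

theorem toL2_ofL2 {l s l' s' : ℝ} (N : L2 →L[ℂ] L2) (f : WSobolev l s) :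
    (ofL2 l s l' s' N f).toL2 = N f.toL2 := by
  rw [← WSobolev.equivL2_apply, ofL2]
  simp [WSobolev.equivL2_apply]

theorem continuous_ofL2 (l s l' s' : ℝ) : Continuous (ofL2 l s l' s') := by
  unfold ofL2
  fun_prop

theorem dist_ofL2_sandwich {l s : ℝ} (hs : 0 ≤ s) {n : E3 → ℂ} {p : E3 → ℝ} {z : ℂ}
    (h1 : BddMeas (quot n p z)) (h2 : BddMeas (quot (fun ξ => n ξ * bracketSymbol l ξ) p z))
    (f : WL2 s) :
    (ofL2 0 s l (-s) (sandwich s (fm (quot (fun ξ => n ξ * bracketSymbol l ξ) p z))) f).dist =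
      toDist (fm (quot n p z) (mulL (japanese (-s)) f.toL2)) := by
  have e : quot (fun ξ => n ξ * bracketSymbol l ξ) p z = bracketSymbol l * quot n p z := by
    funext ξ
    simp only [quot, Pi.mul_apply]
    ring
  refine WSobolev.dist_of_toL2 hs h1 (e ▸ h2) _ ?_
  rw [toL2_ofL2, ← e]
  rfl

/-! ### The resolvents of `-Δ` and `√(-Δ)` -/

theorem bddMeas_resolvent {p : E3 → ℝ} (hp : Measurable p) {z : ℂ} (hz : z.im ≠ 0) :
    BddMeas (quot (fun _ => 1) p z) := bddMeas_quot (.const 1) hp hz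

theorem bddMeas_mul_resolvent {p : E3 → ℝ} (hp : Measurable p) (hp0 : ∀ ξ, 0 ≤ p ξ) {z : ℂ}
    (hz : z.im ≠ 0) : BddMeas (quot (fun ξ => (p ξ : ℂ)) p z) := by
  refine bddMeas_quot_of_le (Complex.measurable_ofReal.comp hp) hp
    (C := 1 + ‖1 + z‖ / |z.im|) (by positivity) fun ξ => ?_
  change ‖((p ξ : ℝ) : ℂ)‖ ≤ _
  rw [Complex.norm_real, Real.norm_of_nonneg (hp0 ξ)]
  linarith [one_add_le_mul_norm_sub hz (hp0 ξ)]

theorem fm_mul_resolvent_sub {p : E3 → ℝ} (hp : Measurable p) (hp0 : ∀ ξ, 0 ≤ p ξ) {z : ℂ}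
    (hz : z.im ≠ 0) (f : L2) :
    fm (quot (fun ξ => (p ξ : ℂ)) p z) f - z • fm (quot (fun _ => 1) p z) f = f := by
  have h1 := bddMeas_resolvent hp hz
  have h2 := bddMeas_mul_resolvent hp hp0 hz
  conv_rhs => rw [← fm_one f]
  rw [← smul_apply, ← fm_smul h1, ← sub_apply, ← fm_sub h2 (h1.smul z)]
  congr 2
  funext ξ
  have := sub_ne_zero_of_im hz (p ξ)
  simp only [quot, Pi.sub_apply, Pi.smul_apply, smul_eq_mul]
  field_simp

theorem fm_resolvent_sub {p : E3 → ℝ} (hp : Measurable p) {z : ℂ}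
    (hz : z.im ≠ 0) {u v : L2} (h : fou v =ᵐ[volume] fun ξ => (p ξ : ℂ) * fou u ξ) :
    fm (quot (fun _ => 1) p z) (v - z • u) = u := by
  apply fou.injective
  rw [fou_fm, map_sub, map_smul]
  refine Lp.ext ?_
  filter_upwards [h, mulL_coeFn (bddMeas_resolvent hp hz) (fou v - z • fou u),
    Lp.coeFn_sub (fou v) (z • fou u), Lp.coeFn_smul z (fou u)] with ξ h1 h2 h3 h4
  have := sub_ne_zero_of_im hz (p ξ)
  rw [h2, h3, Pi.sub_apply, h4, Pi.smul_apply, h1, quot, smul_eq_mul]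
  field_simp

theorem isResolventAt_sqrtNegLaplacian {z : ℂ} (hz : z.im ≠ 0) :
    IsResolventAt sqrtNegLaplacian z (fm (quot (fun _ => 1) freq z)) := by
  have hp := continuous_freq.measurable
  have h1 := bddMeas_resolvent hp hz
  have h2 := bddMeas_mul_resolvent hp freq_nonneg hz
  refine ⟨fun f => ?_, fun u => ?_⟩
  · have e : fou (fm (quot (fun ξ => (freq ξ : ℂ)) freq z) f) =ᵐ[volume]
        fun ξ => absSymbol ξ * (𝓕 (fm (quot (fun _ => 1) freq z) f) : L2) ξ := by
      rw [← fou_apply, fou_fm, fou_fm]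
      filter_upwards [mulL_coeFn h1 (fou f), mulL_coeFn h2 (fou f)] with ξ e1 e2
      rw [e1, e2]
      simp only [quot, absSymbol, freq]
      ring
    have hm : fm (quot (fun _ => 1) freq z) f ∈ sqrtNegLaplacian.domain :=
      (memLp_congr_ae e).1 (Lp.memLp _)
    refine ⟨hm, ?_⟩
    have hT : sqrtNegLaplacian ⟨_, hm⟩ = fm (quot (fun ξ => (freq ξ : ℂ)) freq z) f := by
      apply fou.injective
      change 𝓕 (𝓕⁻ (MemLp.toLp _ hm : L2)) = _
      rw [FourierTransform.fourier_fourierInv_eq]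
      refine Lp.ext ?_
      filter_upwards [MemLp.coeFn_toLp hm, e] with ξ e1 e2
      rw [e1, e2]
    rw [hT]
    exact fm_mul_resolvent_sub hp freq_nonneg hz f
  · refine fm_resolvent_sub hp hz ?_
    have hT : fou (sqrtNegLaplacian u) = MemLp.toLp _ u.2 := by
      change 𝓕 (𝓕⁻ (MemLp.toLp _ u.2 : L2)) = _
      rw [FourierTransform.fourier_fourierInv_eq]
    rw [hT]
    exact MemLp.coeFn_toLp u.2

theorem freqSq_temperate : (fun ξ : E3 => ((freq ξ ^ 2 : ℝ) : ℂ)).HasTemperateGrowth := by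
  simp_rw [freq_sq_eq]
  fun_prop

theorem neg_laplacian_eq (f : 𝓢'(E3, ℂ)) :
    -Δ f = fourierMultiplierCLM ℂ (fun ξ : E3 => ((freq ξ ^ 2 : ℝ) : ℂ)) f := by
  have e : (fun ξ : E3 => ((freq ξ ^ 2 : ℝ) : ℂ)) =
      (((2 * Real.pi) ^ 2 : ℝ) : ℂ) • fun ξ : E3 => ((‖ξ‖ ^ 2 : ℝ) : ℂ) := by
    funext ξ
    rw [freq_sq_eq]
    simp
  rw [e, TemperedDistribution.fourierMultiplierCLM_smul (by fun_prop),
    TemperedDistribution.laplacian_eq_fourierMultiplierCLM, neg_smul, neg_neg]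
  rfl

/-- The symbol |2πξ|² is unbounded on L². Applying ⟨D⟩⁻² turns both sides into bounded multipliers,
which can be compared in L²; its symbol vanishes nowhere and cancels. -/
theorem fou_negLaplacian (u : negLaplacian.domain) :
    fou (negLaplacian u) =ᵐ[volume] fun ξ => ((freq ξ ^ 2 : ℝ) : ℂ) * fou (u : L2) ξ := by
  have hbr : BddMeas (bracketSymbol (-2)) := by
    refine ⟨(contDiff_bracketSymbol _).continuous.measurable, 1, fun ξ => ?_⟩
    rw [norm_bracketSymbol]
    exact Real.rpow_le_one_of_one_le_of_nonpos (by nlinarith [freq_nonneg ξ]) (by norm_num)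
  have hinv : ∀ ξ, ‖bracketSymbol (-2) ξ‖ = (1 + freq ξ ^ 2)⁻¹ := fun ξ => by
    rw [norm_bracketSymbol, show (-2 : ℝ) / 2 = -1 by norm_num, Real.rpow_neg_one]
  have hp : BddMeas (bracketSymbol (-2) * fun ξ => ((freq ξ ^ 2 : ℝ) : ℂ)) := by
    refine ⟨(contDiff_bracketSymbol _).continuous.measurable.mul
      (Complex.measurable_ofReal.comp measurable_freq_sq), 1, fun ξ => ?_⟩
    rw [Pi.mul_apply, norm_mul, hinv, Complex.norm_real, Real.norm_of_nonneg (sq_nonneg _),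
      inv_mul_le_iff₀ (by positivity)]
    linarith
  have h1 : bracketD (-2) (toDist (negLaplacian u)) =
      toDist (fm (bracketSymbol (-2)) (negLaplacian u)) := by
    refine fourierMultiplier_toDist (bracketSymbol_temperate _) ?_
    rw [fou_fm]
    exact mulL_coeFn hbr _
  have h2 : bracketD (-2) (toDist (negLaplacian u)) =
      toDist (fm (bracketSymbol (-2) * fun ξ => ((freq ξ ^ 2 : ℝ) : ℂ)) (u : L2)) := by
    rw [toDist_negLaplacian, neg_laplacian_eq, bracketD,
      TemperedDistribution.fourierMultiplierCLM_fourierMultiplierCLM_apply freqSq_temperate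
        (bracketSymbol_temperate _), mul_comm]
    refine fourierMultiplier_toDist ((bracketSymbol_temperate _).mul freqSq_temperate) ?_
    rw [fou_fm]
    exact mulL_coeFn hp _
  have h3 := congrArg fou (toDist_injective (h1.symm.trans h2))
  rw [fou_fm, fou_fm] at h3
  filter_upwards [mulL_coeFn hbr (fou (negLaplacian u)), mulL_coeFn hp (fou (u : L2))] with ξ k1 k2
  rw [h3, k2, Pi.mul_apply, mul_assoc] at k1
  refine (mul_left_cancel₀ ?_ k1).symm
  rw [← norm_ne_zero_iff, hinv]
  positivity

theorem isResolventAt_negLaplacian {z : ℂ} (hz : z.im ≠ 0) :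
    IsResolventAt negLaplacian z (fm (quot (fun _ => 1) (fun ξ => freq ξ ^ 2) z)) := by
  have hp := measurable_freq_sq
  have h1 := bddMeas_resolvent hp hz
  have h2 := bddMeas_mul_resolvent hp (fun _ => sq_nonneg _) hz
  refine ⟨fun f => ?_, fun u => fm_resolvent_sub hp hz (fou_negLaplacian u)⟩
  have e : -Δ (toDist (fm (quot (fun _ => 1) (fun ξ => freq ξ ^ 2) z) f)) =
      toDist (fm (quot (fun ξ => ((freq ξ ^ 2 : ℝ) : ℂ)) (fun ξ => freq ξ ^ 2) z) f) := by
    rw [neg_laplacian_eq]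
    refine fourierMultiplier_toDist freqSq_temperate ?_
    rw [fou_fm, fou_fm]
    filter_upwards [mulL_coeFn h1 (fou f), mulL_coeFn h2 (fou f)] with ξ e1 e2
    rw [e1, e2]
    simp only [quot]
    ring
  have hm : fm (quot (fun _ => 1) (fun ξ => freq ξ ^ 2) z) f ∈ negLaplacian.domain :=
    ⟨_, e.symm.trans (congrArg Neg.neg (laplacianCLM_apply _).symm)⟩
  refine ⟨hm, ?_⟩
  have hT : negLaplacian ⟨_, hm⟩ =
      fm (quot (fun ξ => ((freq ξ ^ 2 : ℝ) : ℂ)) (fun ξ => freq ξ ^ 2) z) f :=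
    toDist_injective ((toDist_negLaplacian _).trans e)
  rw [hT]
  exact fm_mul_resolvent_sub hp (fun _ => sq_nonneg _) hz f

/-! ### Extended resolvents -/

/-- The weighted resolvent, extended by continuity from the half-plane `σ Im z > 0`. -/
def extendedResolvent (l s : ℝ) (p : E3 → ℝ) (σ : ℝ) : ℂ → (WL2 s →L[ℂ] WSobolev l (-s)) :=
  extendFrom (openHalf σ) fun z => ofL2 0 s l (-s) (weightedResolvent l s p z)

section

variable {l s : ℝ} {p : E3 → ℝ} {σ : ℝ}

theorem exists_tendsto_ofL2 {x : Filter ℂ} (h : ∃ L, Tendsto (weightedResolvent l s p) x (𝓝 L)) :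
    ∃ L, Tendsto (fun z => ofL2 0 s l (-s) (weightedResolvent l s p z)) x (𝓝 L) := by
  obtain ⟨L, hL⟩ := h
  exact ⟨_, ((continuous_ofL2 0 s l (-s)).tendsto L).comp hL⟩

theorem continuousOn_extendedResolvent (hσ : σ ^ 2 = 1) (hp : Measurable p) (hp0 : ∀ ξ, 0 ≤ p ξ)
    (hl : ∀ ξ, ‖bracketSymbol l ξ‖ ≤ 1 + p ξ)
    (h : ∀ t : ℝ, 0 < t → ∃ L, Tendsto (weightedResolvent l s p) (𝓝[openHalf σ] (t : ℂ)) (𝓝 L)) :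
    ContinuousOn (extendedResolvent l s p σ) (extendedHalfPlane σ) := by
  refine continuousOn_extendFrom (extendedHalfPlane_subset_closure hσ) fun z hz =>
    exists_tendsto_ofL2 ?_
  rcases hz with hz | ⟨hi, hr⟩
  · exact ⟨_, (continuousAt_weightedResolvent hp hp0 hl s
      (openHalf_im_ne_zero (σ := σ) hz)).tendsto.mono_left nhdsWithin_le_nhds⟩
  · obtain ⟨L, hL⟩ := h z.re hr
    rw [show ((z.re : ℝ) : ℂ) = z from Complex.ext rfl (by simp [hi])] at hL
    exact ⟨L, hL⟩

theorem extendedResolvent_eq (hp : Measurable p) (hp0 : ∀ ξ, 0 ≤ p ξ)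
    (hl : ∀ ξ, ‖bracketSymbol l ξ‖ ≤ 1 + p ξ) {z : ℂ} (hz : z ∈ openHalf σ) :
    extendedResolvent l s p σ z = ofL2 0 s l (-s) (weightedResolvent l s p z) := by
  refine extendFrom_eq (subset_closure hz) ?_
  exact ((continuous_ofL2 0 s l (-s)).continuousAt.comp (continuousAt_weightedResolvent hp hp0 hl s
      (openHalf_im_ne_zero hz))).tendsto.mono_left nhdsWithin_le_nhds

theorem dist_extendedResolvent (hs : 0 ≤ s) (hp : Measurable p) (hp0 : ∀ ξ, 0 ≤ p ξ)
    (hl : ∀ ξ, ‖bracketSymbol l ξ‖ ≤ 1 + p ξ) {z : ℂ} (hz : z ∈ openHalf σ) (f : WL2 s) :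
    (extendedResolvent l s p σ z f).dist =
      toDist (fm (quot (fun _ => 1) p z) (mulL (japanese (-s)) f.toL2)) := by
  have hi := openHalf_im_ne_zero hz
  have e : (fun ξ => (fun _ => (1 : ℂ)) ξ * bracketSymbol l ξ) = bracketSymbol l := by
    funext ξ
    simp
  rw [extendedResolvent_eq hp hp0 hl hz, weightedResolvent]
  have h := dist_ofL2_sandwich (l := l) hs (n := fun _ => 1) (bddMeas_resolvent hp hi)
    (by rw [e]; exact bddMeas_quot_bracketSymbol hp hp0 hl hi) f
  rwa [e] at h

theorem tendsto_add_mul_I (z : ℂ) (σ : ℝ) :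
    Tendsto (fun μ : ℝ => z + (σ * μ : ℝ) * Complex.I) (𝓝[>] 0) (𝓝 z) := by
  have : Continuous fun μ : ℝ => z + (σ * μ : ℝ) * Complex.I := by fun_prop
  simpa using (this.tendsto 0).mono_left nhdsWithin_le_nhds

theorem add_mul_I_im (t σ μ : ℝ) : ((t : ℂ) + (σ * μ : ℝ) * Complex.I).im = σ * μ := by
  simp

theorem add_mul_I_mem (hσ : σ ^ 2 = 1) (t : ℝ) {μ : ℝ} (hμ : 0 < μ) :
    (t : ℂ) + (σ * μ : ℝ) * Complex.I ∈ openHalf σ := by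
  change 0 < σ * ((t : ℂ) + (σ * μ : ℝ) * Complex.I).im
  rw [add_mul_I_im, ← mul_assoc, ← pow_two, hσ, one_mul]
  exact hμ

theorem isExtendedResolvent (hσ : σ ^ 2 = 1) (hs : 0 ≤ s) (hp : Measurable p) (hp0 : ∀ ξ, 0 ≤ p ξ)
    (hl : ∀ ξ, ‖bracketSymbol l ξ‖ ≤ 1 + p ξ)
    (h : ∀ t : ℝ, 0 < t → ∃ L, Tendsto (weightedResolvent l s p) (𝓝[openHalf σ] (t : ℂ)) (𝓝 L))
    {T : L2 →ₗ.[ℂ] L2} (hT : ∀ z : ℂ, z.im ≠ 0 → IsResolventAt T z (fm (quot (fun _ => 1) p z))) :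
    IsExtendedResolvent T σ (extendedResolvent l s p σ) where
  resolvent z hz := ⟨_, hT z (openHalf_im_ne_zero (σ := σ) hz), fun f =>
    ⟨mulL (japanese (-s)) f.toL2, WL2.dist_eq hs f, dist_extendedResolvent hs hp hp0 hl hz f⟩⟩
  limit t ht := by
    have hc := continuousOn_extendedResolvent hσ hp hp0 hl h (t : ℂ)
      (Or.inr ⟨Complex.ofReal_im t, ht⟩)
    refine hc.tendsto.comp (tendsto_nhdsWithin_iff.2 ⟨tendsto_add_mul_I _ _, ?_⟩)
    filter_upwards [self_mem_nhdsWithin] with μ hμ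
    exact Or.inl (add_mul_I_mem hσ t hμ)

theorem isExtendedResolvent_sqrtNegLaplacian (hσ : σ ^ 2 = 1) (hs : 1 / 2 < s) :
    IsExtendedResolvent sqrtNegLaplacian σ (extendedResolvent 1 s freq σ) :=
  isExtendedResolvent hσ (by linarith) continuous_freq.measurable freq_nonneg
    norm_bracketSymbol_one_le (fun _ ht => exists_tendsto_sqrt hs ht hσ)
    fun _ hz => isResolventAt_sqrtNegLaplacian hz

theorem isExtendedResolvent_negLaplacian (hσ : σ ^ 2 = 1) (hs : 1 / 2 < s) :
    IsExtendedResolvent negLaplacian σ (extendedResolvent 2 s (fun ξ => freq ξ ^ 2) σ) :=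
  isExtendedResolvent hσ (by linarith) measurable_freq_sq (fun _ => sq_nonneg _)
    (fun ξ => (norm_bracketSymbol_two ξ).le) (fun _ ht => exists_tendsto_laplacian hs ht hσ)
    fun _ hz => isResolventAt_negLaplacian hz

theorem continuousOn_extendedResolvent_sqrtNegLaplacian (hσ : σ ^ 2 = 1) (hs : 1 / 2 < s) :
    ContinuousOn (extendedResolvent 1 s freq σ) (extendedHalfPlane σ) :=
  continuousOn_extendedResolvent hσ continuous_freq.measurable freq_nonneg
    norm_bracketSymbol_one_le fun _ ht => exists_tendsto_sqrt hs ht hσ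

end

/-! ### The representation formula -/

theorem tendsto_clm_apply {ι X Y : Type*} [NormedAddCommGroup X] [NormedSpace ℂ X]
    [NormedAddCommGroup Y] [NormedSpace ℂ Y] {l : Filter ι} {F : ι → (X →L[ℂ] Y)} {G : X →L[ℂ] Y}
    {u : ι → X} {v : X} (hF : Tendsto F l (𝓝 G)) (hu : Tendsto u l (𝓝 v)) :
    Tendsto (fun i => F i (u i)) l (𝓝 (G v)) :=
  ((isBoundedBilinearMap_apply (𝕜 := ℂ) (E := X) (F := Y)).continuous.tendsto (G, v)).comp
    (hF.prodMk_nhds hu)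

/-- A(z) = χ(D)(|D| + z) and B(z) = (1 - χ(D))(√(-Δ) - z)⁻¹ do not involve the sign σ, so the same
pair serves both half-planes. -/
theorem exists_representation {s : ℝ} (hs : 1 / 2 < s) {a b : ℝ} (ha : 0 < a) (hab : a < b) :
    ∃ (A : ℂ → (WL2 s →L[ℂ] WL2 s)) (B : ℂ → (WL2 s →L[ℂ] WSobolev 1 (-s))),
      Continuous A ∧ ContinuousOn B (box a b) ∧ ∀ σ : ℝ, σ ^ 2 = 1 → ∀ z ∈ halfBox σ a b,
        ∀ f : WL2 s, (extendedResolvent 1 s freq σ z f).dist =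
          (extendedResolvent 2 s (fun ξ => freq ξ ^ 2) σ (z ^ 2) (A z f)).dist + (B z f).dist := by
  have hb : 0 < b := ha.trans hab
  have hs0 : 0 ≤ s := by linarith
  have hα : 0 < a / 2 := by positivity
  set χ : E3 → ℂ := fun ξ => (annulus (a / 2) (2 * b) ξ : ℂ)
  have c₁ : HasCompactSupport fun ξ => χ ξ * (freq ξ : ℂ) := hasCompactSupport_annulus_mul _
  have c₂ : HasCompactSupport χ := by
    simpa using hasCompactSupport_annulus_mul (α := a / 2) (β := 2 * b) fun _ => 1
  have d₁ : ContDiff ℝ (⊤ : ℕ∞) fun ξ => χ ξ * (freq ξ : ℂ) := contDiff_annulus_mul_freq hα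
  have d₂ : ContDiff ℝ (⊤ : ℕ∞) χ := contDiff_annulus
  have m₁ := bddMeas_of_compactSupport d₁.continuous c₁
  have m₂ := bddMeas_of_compactSupport d₂.continuous c₂
  obtain ⟨K₁, hK₁⟩ := exists_weighted_fm hs0 (c₁.toSchwartzMap d₁)
  obtain ⟨K₂, hK₂⟩ := exists_weighted_fm hs0 (c₂.toSchwartzMap d₂)
  -- `K₁` and `K₂` are χ(D)|D| and χ(D) on L^{2,s}, conjugated to L² by the weight; the first has a
  -- smooth symbol because χ vanishes near 0.
  set A : ℂ → (WL2 s →L[ℂ] WL2 s) := fun z => ofL2 0 s 0 s (K₁ + z • K₂) with hA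
  set B : ℂ → (WL2 s →L[ℂ] WSobolev 1 (-s)) := fun z =>
    ofL2 0 s 1 (-s) (remainder s (a / 2) (2 * b) z) with hB
  have hAc : Continuous A := (continuous_ofL2 0 s 0 s).comp (by fun_prop)
  have hBc : ∀ z ∈ box a b, ContinuousAt B z := fun z hz =>
    (continuous_ofL2 0 s 1 (-s)).continuousAt.comp (continuousAt_remainder s ha hb hz)
  have hopen : ∀ σ : ℝ, σ ^ 2 = 1 → ∀ z ∈ box a b, z ∈ openHalf σ → ∀ f : WL2 s,
      (extendedResolvent 1 s freq σ z f).dist =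
        (extendedResolvent 2 s (fun ξ => freq ξ ^ 2) σ (z ^ 2) (A z f)).dist + (B z f).dist :=
    fun σ hσ z hz hzσ f => by
      have hr : 0 < z.re := ha.trans_le hz.1
      have hi := openHalf_im_ne_zero hzσ
      have hi2 := sq_im_ne_zero hi hr
      have hrem : BddMeas (quot (fun ξ => 1 - χ ξ) freq z) :=
        bddMeas_quot ((BddMeas.const 1).sub m₂) continuous_freq.measurable hi
      have eB : (B z f).dist =
          toDist (fm (quot (fun ξ => 1 - χ ξ) freq z) (mulL (japanese (-s)) f.toL2)) :=
        dist_ofL2_sandwich hs0 hrem (bddMeas_remainder ha hb hz) f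
      have eA : mulL (japanese (-s)) (A z f).toL2 =
          fm ((fun ξ => χ ξ * (freq ξ : ℂ)) + z • χ) (mulL (japanese (-s)) f.toL2) := by
        rw [hA, toL2_ofL2, add_apply, smul_apply, map_add, map_smul, hK₁, hK₂, fm_add m₁ (m₂.smul z),
          fm_smul m₂, add_apply, smul_apply]
        rfl
      rw [dist_extendedResolvent hs0 continuous_freq.measurable freq_nonneg
          norm_bracketSymbol_one_le hzσ,
        dist_extendedResolvent hs0 measurable_freq_sq (fun _ => sq_nonneg _)
          (fun ξ => (norm_bracketSymbol_two ξ).le) (sq_mem_openHalf hzσ hr), eA, eB, ← map_add,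
        fm_fm (bddMeas_resolvent measurable_freq_sq hi2) (m₁.add (m₂.smul z)), ← add_apply,
        ← fm_add ((bddMeas_resolvent measurable_freq_sq hi2).mul (m₁.add (m₂.smul z))) hrem]
      congr 3
      funext ξ
      simp only [quot, Pi.add_apply, Pi.mul_apply, Pi.smul_apply, smul_eq_mul]
      rw [one_div_freq_sub hi hr ξ (χ ξ) 1]
      ring
  refine ⟨A, B, hAc, fun z hz => (hBc z hz).continuousWithinAt, fun σ hσ z hz f => ?_⟩
  obtain ⟨hzb, hzσ⟩ := hz
  rcases hzσ.lt_or_eq with hpos | hzero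
  · exact hopen σ hσ z hzb hpos f
  obtain ⟨t, rfl⟩ : ∃ t : ℝ, z = t := by
    refine ⟨z.re, Complex.ext rfl ?_⟩
    have hσ0 : σ ≠ 0 := fun h => by simp [h] at hσ
    simpa using (mul_eq_zero.1 hzero.symm).resolve_left hσ0
  have ht : 0 < t := ha.trans_le hzb.1
  -- A real point is approached vertically inside the box. The squares also stay in the half-plane σ
  -- Im > 0, so all terms converge, and uniqueness of limits in 𝓢' gives the identity.
  set ζ : ℝ → ℂ := fun μ => (t : ℂ) + (σ * μ : ℝ) * Complex.I
  have hζ : Tendsto ζ (𝓝[>] 0) (𝓝 (t : ℂ)) := tendsto_add_mul_I _ _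
  have hζb : ∀ᶠ μ in 𝓝[>] (0 : ℝ), ζ μ ∈ box a b ∧ ζ μ ∈ openHalf σ := by
    filter_upwards [Ioo_mem_nhdsGT hα] with μ hμ
    refine ⟨⟨?_, ?_, ?_⟩, add_mul_I_mem hσ t hμ.1⟩
    · simpa [ζ] using hzb.1
    · simpa [ζ] using hzb.2.1
    · rw [add_mul_I_im, abs_mul, abs_eq_one_of_sq hσ, one_mul, abs_of_pos hμ.1]
      exact hμ.2.le
  have hR := (isExtendedResolvent_sqrtNegLaplacian hσ hs).limit t ht
  have hΓ : Tendsto (fun μ => extendedResolvent 2 s (fun ξ => freq ξ ^ 2) σ (ζ μ ^ 2)) (𝓝[>] 0)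
      (𝓝 (extendedResolvent 2 s (fun ξ => freq ξ ^ 2) σ ((t : ℂ) ^ 2))) := by
    have hc := continuousOn_extendedResolvent (s := s) hσ measurable_freq_sq (fun _ => sq_nonneg _)
      (fun ξ => (norm_bracketSymbol_two ξ).le) (fun t ht => exists_tendsto_laplacian hs ht hσ)
      ((t : ℂ) ^ 2) (Or.inr (by
        rw [← Complex.ofReal_pow]
        exact ⟨Complex.ofReal_im _, pow_pos ht 2⟩))
    refine hc.tendsto.comp (tendsto_nhdsWithin_iff.2 ⟨hζ.pow 2, ?_⟩)
    filter_upwards [hζb] with μ hμ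
    exact Or.inl (sq_mem_openHalf hμ.2 (ha.trans_le hμ.1.1))
  have hAlim : Tendsto (fun μ => A (ζ μ)) (𝓝[>] 0) (𝓝 (A t)) := (hAc.tendsto _).comp hζ
  have hBlim : Tendsto (fun μ => B (ζ μ)) (𝓝[>] 0) (𝓝 (B t)) := (hBc _ hzb).tendsto.comp hζ
  have l₁ := (WSobolev.continuous_dist.tendsto _).comp
    (tendsto_clm_apply hR (tendsto_const_nhds (x := f)))
  have l₂ := (WSobolev.continuous_dist.tendsto _).comp
    (tendsto_clm_apply hΓ (tendsto_clm_apply hAlim (tendsto_const_nhds (x := f))))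
  have l₃ := (WSobolev.continuous_dist.tendsto _).comp
    (tendsto_clm_apply hBlim (tendsto_const_nhds (x := f)))
  refine tendsto_nhds_unique (l₁.congr' ?_) (l₂.add l₃)
  filter_upwards [hζb] with μ hμ
  exact hopen σ hσ _ hμ.1 hμ.2 f

end

end SqrtLaplacian

theorem theorem3p2 (s : ℝ) (hs : 1 / 2 < s) :
    -- the extended resolvents of `√(-Δ)` and of `-Δ`
    ∃ (Rp Rm : ℂ → (SqrtLaplacian.WL2 s →L[ℂ] SqrtLaplacian.WSobolev 1 (-s)))
      (Γp Γm : ℂ → (SqrtLaplacian.WL2 s →L[ℂ] SqrtLaplacian.WSobolev 2 (-s))),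
      SqrtLaplacian.IsExtendedResolvent SqrtLaplacian.sqrtNegLaplacian 1 Rp ∧
      SqrtLaplacian.IsExtendedResolvent SqrtLaplacian.sqrtNegLaplacian (-1) Rm ∧
      SqrtLaplacian.IsExtendedResolvent SqrtLaplacian.negLaplacian 1 Γp ∧
      SqrtLaplacian.IsExtendedResolvent SqrtLaplacian.negLaplacian (-1) Γm ∧
      -- limiting absorption principle for `√(-Δ)`
      ContinuousOn Rp (SqrtLaplacian.extendedHalfPlane 1) ∧
      ContinuousOn Rm (SqrtLaplacian.extendedHalfPlane (-1)) ∧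
      -- the representation formulae
      ∀ a b : ℝ, 0 < a → a < b →
        ∃ (A : ℂ → (SqrtLaplacian.WL2 s →L[ℂ] SqrtLaplacian.WL2 s))
          (B : ℂ → (SqrtLaplacian.WL2 s →L[ℂ] SqrtLaplacian.WSobolev 1 (-s))),
          Continuous A ∧
          ContinuousOn B (SqrtLaplacian.box a b) ∧
          (∀ z ∈ SqrtLaplacian.halfBox 1 a b, ∀ f : SqrtLaplacian.WL2 s,
            (Rp z f).dist = (Γp (z ^ 2) (A z f)).dist + (B z f).dist) ∧
          (∀ z ∈ SqrtLaplacian.halfBox (-1) a b, ∀ f : SqrtLaplacian.WL2 s,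
            (Rm z f).dist = (Γm (z ^ 2) (A z f)).dist + (B z f).dist) := by
  have hp : (1 : ℝ) ^ 2 = 1 := by norm_num
  have hm : (-1 : ℝ) ^ 2 = 1 := by norm_num
  refine ⟨_, _, _, _, SqrtLaplacian.isExtendedResolvent_sqrtNegLaplacian hp hs,
    SqrtLaplacian.isExtendedResolvent_sqrtNegLaplacian hm hs,
    SqrtLaplacian.isExtendedResolvent_negLaplacian hp hs,
    SqrtLaplacian.isExtendedResolvent_negLaplacian hm hs,
    SqrtLaplacian.continuousOn_extendedResolvent_sqrtNegLaplacian hp hs,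
    SqrtLaplacian.continuousOn_extendedResolvent_sqrtNegLaplacian hm hs, fun a b ha hab => ?_⟩
  obtain ⟨A, B, hA, hB, h⟩ := SqrtLaplacian.exists_representation hs ha hab
  exact ⟨A, B, hA, hB, h 1 hp, h (-1) hm⟩
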